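/- **Setting.** Let $(V,Y,\mathbf 1)$ be an $\mathbb N$-graded vertex algebra over $\mathbb C$: a vertex algebra with $V=\coprod_{n\in\mathbb Z}V_{(n)}$, $V_{(n)}=0$ for $n<0$, and $u_nV_{(k)}\subseteq V_{(m+k-n-1)}$ for $u\in V_{(m)}$, where $Y(u,x)=\sum_n u_nx^{-n-1}$. Write $\mathrm{wt}\,u=m$ for $u\in V_{(m)}$ and $Du=u_{-2}\mathbf 1$. Let $L(0)$ be the grading operator and let $A(V)=V/O(V)$ be Zhu's algebra, where $O(V)$ is spanned by $\mathrm{Res}_x\,x^nY((x+1)^{L(0)}u,x)v$ $(n\le -2)$ and the product is induced by $u*v=\mathrm{Res}_x\,x^{-1}Y((x+1)^{L(0)}u,x)v$. Modules for $A(V)$ are unital. An *$\mathbb N$-gradable weak $V$-module* is a $V$-module $W=\coprod_{n\in\mathbb N}W_{(n)}$ ($V$ viewed as a vertex algebra) with $u_nW_{(k)}\subseteq W_{(k+m-n-1)}$ for $u\in V_{(m)}$; morphisms are all $V$-module maps, whether or not they preserve the gradings. Its top level $T(W)$ is the space of all $w$ with $u_nw=0$ whenever $u$ is homogeneous and $\mathrm{wt}\,u-n-1<0$;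 $A(V)$ acts on it by $u+O(V)\mapsto o(u)$, where $o(u)=u_{\mathrm{wt}\,u-1}$ for homogeneous $u$. **The functor $S$.** Let $M$ be an $A(V)$-module with representation $\rho$. In $T(V[t,t^{-1}])\otimes M$ (tensor algebra of $V\otimes\mathbb C[t,t^{-1}]$, $u(m)=u\otimes t^m$, $\deg u(m)=\mathrm{wt}\,u-m-1$, $\deg M=0$) let $\mathcal I$ be the $T(V[t,t^{-1}])$-submodule generated by: * $u(m)w$ for homogeneous $u,w$ with $\mathrm{wt}\,u-m-1+\deg w<0$; * $o_t(u)w-\rho(u+O(V))w$ for $u\in V$, $w\in M$, where $o_t(u)=u(\mathrm{wt}\,u-1)$ for homogeneous $u$, extended linearly; * $\displaystyle u(p)v(q)w-\sum_{i=0}^{\mathrm{wt}\,v+\deg w-q-1}\ \sum_{j=0}^{\mathrm{wt}\,u+\deg w}\binom{p-\mathrm{wt}\,u-\deg w}{i}\binom{\mathrm{wt}\,u+\deg w}{j}(u_{p-\mathrm{wt}\,u-\deg w-i+j}v)(q+\mathrm{wt}\,u+\deg w+i-j)w$ for homogeneous $u,v,w$ and $p,q\in\mathbb Z$ with $\mathrm{wt}\,v+\deg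 w>q$ and $\mathrm{wt}\,u-p-1+\mathrm{wt}\,v-q-1+\deg w\ge 0$. Put $S_1(M)=(T(V[t,t^{-1}])\otimes M)/\mathcal I$, and $S(M)=S_1(M)/\mathcal J$, where $\mathcal J$ is the submodule generated by $$\sum_{j=0}^{\mathrm{wt}\,u+\deg w}\binom{\mathrm{wt}\,u+\deg w}{j}(u_{j+m}v)(K+\mathrm{wt}\,u+\mathrm{wt}\,v-j-m-2)w$$ for homogeneous $u,v\in V$, $w\in S_1(M)$ and $K,m\in\mathbb Z$ with $m\le K-2\deg w-2$. The vertex operators are $Y_{S(M)}(u,x)=\sum_m u(m)x^{-m-1}$, the grading is by degree, $e_M:M\to S(M)$ is the canonical map, and $S(f)$ is induced by $\mathrm{id}\otimes f$. **The functor $\bar M_0$ (Dong–Li–Mason).** Let $\hat V=V[t,t^{-1}]/(D\otimes1+1\otimes\frac{d}{dt})V[t,t^{-1}]$, the Lie algebra with bracket $[u(m),v(n)]=\sum_{i\ge0}\binom mi(u_iv)(m+n-i)$, graded by degree as above. An $A(V)$-module $M$ is a module for $P=\hat V_{\le 0}$, elements of negative degree acting by $0$ and $u(\mathrm{wt}\,u-1)$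 acting as $u+O(V)$. Let $M_0(M)=U(\hat V)\otimes_{U(P)}M$, and let $\bar M_0(M)$ be its quotient by the $U(\hat V)$-submodule generated by the coefficients of $$(z_0+z_2)^{\mathrm{wt}\,a}Y(a,z_0+z_2)Y(b,z_2)w-(z_2+z_0)^{\mathrm{wt}\,a}Y(Y(a,z_0)b,z_2)w$$ for homogeneous $a,b\in V$ and $w\in M$. Vertex operators, grading ($M$ in degree $0$), canonical map $\bar e_M:M\to\bar M_0(M)$ and morphisms are defined as for $S$. **Corollary 5.6.** $S$ and $\bar M_0$ are functors from the category of $A(V)$-modules to the category of $\mathbb N$-gradable weak $V$-modules, and they coincide: there is a natural isomorphism $\Phi:S\to\bar M_0$ with $\Phi_M\circ e_M=\bar e_M$ for every $A(V)$-module $M$, and each $\Phi_M$ maps $S(M)_{(d)}$ onto $\bar M_0(M)_{(d)}$ for every $d$. Both satisfy the same universal property: for $(F,e)=(S,e)$ and for $(F,e)=(\bar M_0,\bar e)$, the maps $e_M$ are natural in $M$, each $e_M$ is an $A(V)$-module map into $T(F(M))$ and an isomorphism of $M$ onto the homogeneous subspace $F(M)_{(0)}$, and for every $\mathbb N$-gradable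 weak $V$-module $W$ and every $A(V)$-module map $f:M\to T(W)$ there is a unique $V$-module map $\tilde f:F(M)\to W$ with $\tilde f\circ e_M=f$, i.e. $\tilde f|_{F(M)_{(0)}}=f\circ e_M^{-1}$. -/

import Mathlib

open CategoryTheory
open scoped TensorProduct

universe u v w

noncomputable section

namespace ZhuInduction

/-! ### Vertex algebras and their modules, in components

`mode n u w` is the component `u_n w` of `Y(u, x) w = ∑ u_n w x^(-n-1)`. -/

/-- The Jacobi identity for the vertex operators `YV` of `V` and `YW` on `W`, written as the equality
of all coefficients (Borcherds' identity). All sums have finite support as soon as the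
lower truncation conditions hold. -/
def JacobiIdentity {V : Type u} {W : Type v} [AddCommGroup V] [Module ℂ V] [AddCommGroup W]
    [Module ℂ W] (YV : ℤ → V →ₗ[ℂ] V →ₗ[ℂ] V) (YW : ℤ → V →ₗ[ℂ] W →ₗ[ℂ] W) : Prop :=
  ∀ (a b : V) (x : W) (l m n : ℤ),
    ∑ᶠ i : ℕ, (Ring.choose m i : ℤ) • YW (m + n - i) (YV (l + i) a b) x =
      ∑ᶠ i : ℕ, ((-1 : ℤ) ^ i * Ring.choose l i) •
        (YW (m + l - i) a (YW (n + i) b x)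
          - (l.negOnePow : ℤ) • YW (n + l - i) b (YW (m + i) a x))

/-- A vertex algebra `(V, Y, 𝟏)` over `ℂ`. -/
class VertexAlgebra (V : Type u) [AddCommGroup V] [Module ℂ V] where
  mode : ℤ → V →ₗ[ℂ] V →ₗ[ℂ] V
  vac : V
  truncation : ∀ a b : V, ∃ N : ℤ, ∀ n ≥ N, mode n a b = 0
  vacuum : ∀ (n : ℤ) (b : V), mode n vac b = if n = -1 then b else 0
  creation_nonneg : ∀ (a : V) (n : ℤ), 0 ≤ n → mode n a vac = 0
  creation : ∀ a : V, mode (-1) a vac = a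
  jacobi : JacobiIdentity mode mode

/-- An `ℕ`-graded vertex algebra: a `ℤ`-graded vertex algebra with `V_(n) = 0` for `n < 0`.
The condition `[d, Y(u,x)] = x (d/dx) Y(u,x) + Y(du,x)` on the grading operator `d` says that
`u_n V_(k) ⊆ V_(m+k-n-1)` for `u ∈ V_(m)`. -/
class NGradedVertexAlgebra (V : Type u) [AddCommGroup V] [Module ℂ V] extends
    VertexAlgebra V where
  gr : ℤ → Submodule ℂ V
  internal : DirectSum.IsInternal gr
  mode_mem : ∀ (m k n : ℤ) (a b : V), a ∈ gr m → b ∈ gr k → mode n a b ∈ gr (m + k - n - 1)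
  gr_neg : ∀ n : ℤ, n < 0 → gr n = ⊥

open VertexAlgebra NGradedVertexAlgebra

section Basic

variable {V : Type u} [AddCommGroup V] [Module ℂ V] [NGradedVertexAlgebra V]

/-- Linear extension of an expression `F k a` given for homogeneous `a` of weight `k`: the map
`a ↦ ∑ₖ F k aₖ`, where `aₖ` is the component of `a` in `V_(k)`. -/
def byWeight {X : Type w} [AddCommGroup X] [Module ℂ X] (F : ℤ → V →ₗ[ℂ] X) : V →ₗ[ℂ] X :=
  DirectSum.toModule ℂ ℤ X (fun k => F k ∘ₗ (gr (V := V) k).subtype) ∘ₗ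
    (LinearEquiv.ofBijective (DirectSum.coeLinearMap (gr (V := V))) internal).symm.toLinearMap

theorem byWeight_of_mem {X : Type w} [AddCommGroup X] [Module ℂ X] (F : ℤ → V →ₗ[ℂ] X)
    {k : ℤ} {a : V} (ha : a ∈ gr (V := V) k) : byWeight F a = F k a := by
  have h : (LinearEquiv.ofBijective (DirectSum.coeLinearMap (gr (V := V))) internal).symm a
      = DirectSum.lof ℂ ℤ (fun i => gr (V := V) i) k ⟨a, ha⟩ := by
    refine (LinearEquiv.symm_apply_eq _).2 ?_
    exact (DirectSum.coeLinearMap_lof (gr (V := V)) k ⟨a, ha⟩).symm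
  simp only [byWeight, LinearMap.comp_apply, LinearEquiv.coe_coe]
  rw [h, DirectSum.toModule_lof]
  rfl

/-- `zhuRes n a b = Res_x x^n Y((x+1)^{L(0)} a, x) b`. -/
def zhuRes (n : ℤ) : V →ₗ[ℂ] V →ₗ[ℂ] V :=
  byWeight fun k => ∑ j ∈ Finset.range (k.toNat + 1), (k.toNat.choose j) • mode (n + j)

/-- Zhu's product `a * b = Res_x x^{-1} Y((x+1)^{L(0)} a, x) b` on `V`. -/
def zhuMul (a b : V) : V := zhuRes (-1) a b

variable (V) in
/-- The subspace `O(V)`. -/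
def zhuO : Submodule ℂ V :=
  Submodule.span ℂ {x | ∃ (a b : V) (n : ℤ), n ≤ -2 ∧ x = zhuRes n a b}

variable (V) in
/-- The space `A(V) = V / O(V)` underlying Zhu's algebra; its product is induced by `zhuMul`
and its unit is the class of the vacuum. -/
abbrev ZhuA : Type u := V ⧸ zhuO V

variable (V) in
/-- The class `a + O(V)`. -/
abbrev zhuMk : V →ₗ[ℂ] ZhuA V := (zhuO V).mkQ

end Basic

section Categories

variable (V : Type u) [AddCommGroup V] [Module ℂ V] [NGradedVertexAlgebra V]

/-- A module for Zhu's algebra `A(V)`: a vector space with a unital representation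
`ρ : A(V) → End M`. As the product of `A(V)` is the one induced by `zhuMul` on
representatives, `map_mul` says that `ρ` is multiplicative. -/
structure ZhuMod where
  carrier : Type v
  [addCommGroup : AddCommGroup carrier]
  [module : Module ℂ carrier]
  ρ : ZhuA V →ₗ[ℂ] Module.End ℂ carrier
  map_one : ρ (zhuMk V vac) = 1
  map_mul : ∀ a b : V, ρ (zhuMk V (zhuMul a b)) = ρ (zhuMk V a) * ρ (zhuMk V b)

attribute [instance] ZhuMod.addCommGroup ZhuMod.module

instance : CoeSort (ZhuMod.{u, v} V) (Type v) := ⟨ZhuMod.carrier⟩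

variable {V}

/-- Homomorphisms of `A(V)`-modules. -/
@[ext]
structure ZhuHom (M N : ZhuMod.{u, v} V) where
  lin : M →ₗ[ℂ] N
  comm : ∀ (a : ZhuA V) (x : M), lin (M.ρ a x) = N.ρ a (lin x)

instance : Category (ZhuMod.{u, v} V) where
  Hom := ZhuHom
  id M := ⟨LinearMap.id, fun _ _ => rfl⟩
  comp f g := ⟨g.lin ∘ₗ f.lin, fun a x => by simp [f.comm, g.comm]⟩

/-- `W = ∐ W_(n)`, `n ∈ ℕ`, with the vertex operators `Y`, is an `ℕ`-gradable weak `V`-module. The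
grading is indexed by `ℤ` with `W_(n) = 0` for `n < 0`, so that the condition
`u_n W_(k) ⊆ W_(m+k-n-1)` makes sense for all indices. -/
structure IsNGradableWeakModule {W : Type w} [AddCommGroup W] [Module ℂ W]
    (Y : ℤ → V →ₗ[ℂ] W →ₗ[ℂ] W) (grW : ℤ → Submodule ℂ W) : Prop where
  truncation : ∀ (a : V) (x : W), ∃ N : ℤ, ∀ n ≥ N, Y n a x = 0
  vacuum : ∀ (n : ℤ) (x : W), Y n (vac : V) x = if n = -1 then x else 0
  jacobi : JacobiIdentity mode Y
  internal : DirectSum.IsInternal grW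
  mode_mem : ∀ (m k n : ℤ) (a : V) (x : W), a ∈ gr (V := V) m → x ∈ grW k →
    Y n a x ∈ grW (m + k - n - 1)
  gr_neg : ∀ n : ℤ, n < 0 → grW n = ⊥

variable (V) in
/-- `ℕ`-gradable weak `V`-modules. -/
structure WeakMod where
  carrier : Type w
  [addCommGroup : AddCommGroup carrier]
  [module : Module ℂ carrier]
  Y : ℤ → V →ₗ[ℂ] carrier →ₗ[ℂ] carrier
  grading : ℤ → Submodule ℂ carrier
  isModule : IsNGradableWeakModule Y grading

attribute [instance] WeakMod.addCommGroup WeakMod.module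

instance : CoeSort (WeakMod.{u, w} V) (Type w) := ⟨WeakMod.carrier⟩

/-- `V`-module maps: linear maps that commute with all vertex operators (they are not
required to preserve the gradings). -/
@[ext]
structure WeakHom (W : WeakMod.{u, v} V) (X : WeakMod.{u, w} V) where
  lin : W →ₗ[ℂ] X
  comm : ∀ (n : ℤ) (a : V) (x : W), lin (W.Y n a x) = X.Y n a (lin x)

instance : Category (WeakMod.{u, w} V) where
  Hom := WeakHom
  id W := ⟨LinearMap.id, fun _ _ _ => rfl⟩
  comp f g := ⟨g.lin ∘ₗ f.lin, fun n a x => by simp [f.comm, g.comm]⟩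

/-- The top level `T(W)`. -/
def topLevel (W : WeakMod.{u, w} V) : Submodule ℂ W where
  carrier := {x | ∀ (k n : ℤ) (a : V), a ∈ gr (V := V) k → k - n - 1 < 0 → W.Y n a x = 0}
  zero_mem' := by simp
  add_mem' hx hy := by
    intro k n a ha h
    rw [map_add, hx k n a ha h, hy k n a ha h, add_zero]
  smul_mem' c x hx := by
    intro k n a ha h
    rw [map_smul, hx k n a ha h, smul_zero]

/-- `o(a) = Res_x x^{-1} Y_W(x^{L(0)} a, x)`, i.e. `a_{k-1}` for `a` of weight `k`. -/
def zeroMode {W : Type w} [AddCommGroup W] [Module ℂ W] (Y : ℤ → V →ₗ[ℂ] W →ₗ[ℂ] W) :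
    V →ₗ[ℂ] W →ₗ[ℂ] W :=
  byWeight fun k => Y (k - 1)

/-- `f` is an `A(V)`-module map from `M` to `T(W)`, where `a + O(V)` acts on `T(W)` as `o(a)`. -/
def IsTopHom (M : ZhuMod.{u, v} V) (W : WeakMod.{u, w} V) (f : M →ₗ[ℂ] W) : Prop :=
  (∀ x, f x ∈ topLevel W) ∧
    ∀ (a : V) (x : M), f (M.ρ (zhuMk V a) x) = zeroMode W.Y a (f x)

end Categories

section Words

variable {V : Type u} [AddCommGroup V] [Module ℂ V] [NGradedVertexAlgebra V]
variable {M : Type v} [AddCommGroup M] [Module ℂ M]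
variable {X : Type w} [AddCommGroup X] [Module ℂ X]

/-- `IsWord Y e d x`: `x = u₁(m₁) ⋯ uₖ(mₖ) e(w)` with `w ∈ M`, homogeneous `uᵢ`, and
`∑ (wt uᵢ - mᵢ - 1) = d`. -/
inductive IsWord (Y : ℤ → V →ₗ[ℂ] X →ₗ[ℂ] X) (e : M →ₗ[ℂ] X) : ℤ → X → Prop
  | base (y : M) : IsWord Y e 0 (e y)
  | mode (k m d : ℤ) (a : V) (x : X) (ha : a ∈ gr (V := V) k) (hx : IsWord Y e d x) :
      IsWord Y e (k - m - 1 + d) (Y m a x)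

/-- The space of homogeneous elements of degree `d`. -/
def wordDeg (Y : ℤ → V →ₗ[ℂ] X →ₗ[ℂ] X) (e : M →ₗ[ℂ] X) (d : ℤ) : Submodule ℂ X :=
  Submodule.span ℂ {x | IsWord Y e d x}

theorem map_wordDeg {M' : Type*} [AddCommGroup M'] [Module ℂ M'] {X' : Type*}
    [AddCommGroup X'] [Module ℂ X'] {Y : ℤ → V →ₗ[ℂ] X →ₗ[ℂ] X} {e : M →ₗ[ℂ] X}
    {Y' : ℤ → V →ₗ[ℂ] X' →ₗ[ℂ] X'} {e' : M' →ₗ[ℂ] X'} (F : X →ₗ[ℂ] X') (f : M → M')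
    (he : ∀ y, F (e y) = e' (f y)) (hY : ∀ n a x, F (Y n a x) = Y' n a (F x)) {d : ℤ} {x : X}
    (hx : x ∈ wordDeg Y e d) : F x ∈ wordDeg Y' e' d := by
  have key : ∀ d x, IsWord Y e d x → IsWord Y' e' d (F x) := by
    intro d x h
    induction h with
    | base y => rw [he]; exact .base _
    | mode k m d a x ha hx ih => rw [hY]; exact .mode k m d a _ ha ih
  have : wordDeg Y e d ≤ (wordDeg Y' e' d).comap F :=
    Submodule.span_le.2 fun x h => Submodule.subset_span (key d x h)
  exact this hx

end Words

section TensorAlgebra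

variable (V : Type u) [AddCommGroup V] [Module ℂ V]

/-- The tensor algebra `T(V[t,t⁻¹])` of the affinization `V[t,t⁻¹] = V ⊗ ℂ[t,t⁻¹]`. -/
def TV : Type u := TensorAlgebra ℂ (V ⊗[ℂ] LaurentPolynomial ℂ)

instance : Ring (TV V) := inferInstanceAs (Ring (TensorAlgebra ℂ (V ⊗[ℂ] LaurentPolynomial ℂ)))

instance : Algebra ℂ (TV V) :=
  inferInstanceAs (Algebra ℂ (TensorAlgebra ℂ (V ⊗[ℂ] LaurentPolynomial ℂ)))

variable {V}

/-- `a ↦ a(m) = a ⊗ t^m`. -/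
def gen (m : ℤ) : V →ₗ[ℂ] TV V :=
  (TensorAlgebra.ι ℂ : V ⊗[ℂ] LaurentPolynomial ℂ →ₗ[ℂ]
      TensorAlgebra ℂ (V ⊗[ℂ] LaurentPolynomial ℂ)) ∘ₗ
    (TensorProduct.mk ℂ V (LaurentPolynomial ℂ)).flip (LaurentPolynomial.T m)

/-- The action of elements `g m a` of an algebra `A` on an `A`-module. -/
def act {A : Type u} [Ring A] [Algebra ℂ A] (g : ℤ → V →ₗ[ℂ] A) (X : Type w) [AddCommGroup X]
    [Module ℂ X] [Module A X] [IsScalarTower ℂ A X] (m : ℤ) : V →ₗ[ℂ] X →ₗ[ℂ] X :=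
  (Algebra.lsmul ℂ ℂ X : A →ₐ[ℂ] Module.End ℂ X).toLinearMap ∘ₗ g m

@[simp]
theorem act_apply {A : Type u} [Ring A] [Algebra ℂ A] (g : ℤ → V →ₗ[ℂ] A) (X : Type w)
    [AddCommGroup X] [Module ℂ X] [Module A X] [IsScalarTower ℂ A X] (m : ℤ) (a : V) (x : X) :
    act g X m a x = g m a • x := rfl

/-- The inclusion `M → A ⊗ M`. -/
def incl (A : Type u) [Ring A] [Algebra ℂ A] (M : Type v) [AddCommGroup M] [Module ℂ M] :
    M →ₗ[ℂ] A ⊗[ℂ] M := TensorProduct.mk ℂ A M 1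

/-- The `A`-linear map `A ⊗ M → A ⊗ N` induced by `M → N`. -/
def inducedMap (A : Type u) [Ring A] [Algebra ℂ A] {M N : Type v} [AddCommGroup M] [Module ℂ M]
    [AddCommGroup N] [Module ℂ N] (f : M →ₗ[ℂ] N) : A ⊗[ℂ] M →ₗ[A] A ⊗[ℂ] N :=
  TensorProduct.AlgebraTensorModule.map LinearMap.id f

theorem inducedMap_incl (A : Type u) [Ring A] [Algebra ℂ A] {M N : Type v} [AddCommGroup M]
    [Module ℂ M] [AddCommGroup N] [Module ℂ N] (f : M →ₗ[ℂ] N) (y : M) :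
    inducedMap A f (incl A M y) = incl A N (f y) := rfl

theorem inducedMap_id (A : Type u) [Ring A] [Algebra ℂ A] (M : Type v) [AddCommGroup M]
    [Module ℂ M] (x : A ⊗[ℂ] M) : inducedMap A (LinearMap.id : M →ₗ[ℂ] M) x = x := by
  simp [inducedMap]

theorem inducedMap_comp (A : Type u) [Ring A] [Algebra ℂ A] {M N P : Type v} [AddCommGroup M]
    [Module ℂ M] [AddCommGroup N] [Module ℂ N] [AddCommGroup P] [Module ℂ P]
    (f : M →ₗ[ℂ] N) (g : N →ₗ[ℂ] P) (x : A ⊗[ℂ] M) :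
    inducedMap A (g ∘ₗ f) x = inducedMap A g (inducedMap A f x) := by
  induction x with
  | zero => simp
  | tmul a y => simp [inducedMap]
  | add x y hx hy => simp only [map_add, hx, hy]

end TensorAlgebra

section FunctorS

variable {V : Type u} [AddCommGroup V] [Module ℂ V] [NGradedVertexAlgebra V]

/-- The space `T(V[t,t⁻¹]) ⊗ M`. -/
abbrev TM (M : ZhuMod.{u, v} V) : Type (max u v) := TV V ⊗[ℂ] M

/-- The action of `a(m)` on `T(V[t,t⁻¹]) ⊗ M`. -/
def modeTM (M : ZhuMod.{u, v} V) : ℤ → V →ₗ[ℂ] TM M →ₗ[ℂ] TM M := act gen (TM M)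

/-- The homogeneous elements of degree `d` of `T(V[t,t⁻¹]) ⊗ M`. -/
def degTM (M : ZhuMod.{u, v} V) (d : ℤ) : Submodule ℂ (TM M) :=
  wordDeg (modeTM M) (incl (TV V) M) d

/-- The generators of the submodule `𝓘` of `T(V[t,t⁻¹]) ⊗ M`. -/
inductive RelI (M : ZhuMod.{u, v} V) : TM M → Prop
  | neg (k m d : ℤ) (a : V) (x : TM M) (ha : a ∈ gr (V := V) k) (hx : x ∈ degTM M d)
      (h : k - m - 1 + d < 0) : RelI M (gen m a • x)
  | zhu (a : V) (y : M) :
      RelI M (zeroMode (modeTM M) a (incl (TV V) M y)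
        - incl (TV V) M (M.ρ (zhuMk V a) y))
  | assoc (k l d p q : ℤ) (a b : V) (x : TM M) (ha : a ∈ gr (V := V) k)
      (hb : b ∈ gr (V := V) l) (hx : x ∈ degTM M d) (hq : q < l + d)
      (hdeg : 0 ≤ k - p - 1 + (l - q - 1) + d) :
      RelI M (gen p a • gen q b • x
        - ∑ i ∈ Finset.range (l + d - q).toNat, ∑ j ∈ Finset.range (k + d + 1).toNat,
            (Ring.choose (p - k - d) i * Ring.choose (k + d) j : ℤ) •
              gen (q + k + d + i - j) (mode (p - k - d - i + j) a b) • x)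

/-- The submodule `𝓘`. -/
def subI (M : ZhuMod.{u, v} V) : Submodule (TV V) (TM M) :=
  Submodule.span (TV V) {x | RelI M x}

/-- `S₁(M) = (T(V[t,t⁻¹]) ⊗ M) / 𝓘`. -/
abbrev S1 (M : ZhuMod.{u, v} V) : Type (max u v) := TM M ⧸ subI M

/-- The map `M → S₁(M)`. -/
def inclS1 (M : ZhuMod.{u, v} V) : M →ₗ[ℂ] S1 M :=
  (subI M).mkQ.restrictScalars ℂ ∘ₗ incl (TV V) M

/-- The action of `a(m)` on `S₁(M)`. -/
def modeS1 (M : ZhuMod.{u, v} V) : ℤ → V →ₗ[ℂ] S1 M →ₗ[ℂ] S1 M := act gen (S1 M)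

/-- The homogeneous elements of degree `d` of `S₁(M)`. -/
def degS1 (M : ZhuMod.{u, v} V) (d : ℤ) : Submodule ℂ (S1 M) :=
  wordDeg (modeS1 M) (inclS1 M) d

/-- The generators of the submodule `𝓙` of `S₁(M)`. -/
inductive RelJ (M : ZhuMod.{u, v} V) : S1 M → Prop
  | mk (k l d K m : ℤ) (a b : V) (x : S1 M) (ha : a ∈ gr (V := V) k) (hb : b ∈ gr (V := V) l)
      (hx : x ∈ degS1 M d) (hm : m ≤ K - 2 * d - 2) :
      RelJ M (∑ j ∈ Finset.range (k + d + 1).toNat,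
        (Ring.choose (k + d) j : ℤ) • gen (K + k + l - j - m - 2) (mode (j + m) a b) • x)

/-- The submodule `𝓙`. -/
def subJ (M : ZhuMod.{u, v} V) : Submodule (TV V) (S1 M) :=
  Submodule.span (TV V) {x | RelJ M x}

/-- `S(M) = S₁(M) / 𝓙`. -/
abbrev SM (M : ZhuMod.{u, v} V) : Type (max u v) := S1 M ⧸ subJ M

/-- The map `e_M : M → S(M)`. -/
def inclS (M : ZhuMod.{u, v} V) : M →ₗ[ℂ] SM M :=
  (subJ M).mkQ.restrictScalars ℂ ∘ₗ inclS1 M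

/-- The vertex operators `Y_{S(M)}`: the component `a_m` acts as `a(m)`. -/
def modeS (M : ZhuMod.{u, v} V) : ℤ → V →ₗ[ℂ] SM M →ₗ[ℂ] SM M := act gen (SM M)

/-- The grading of `S(M)`. -/
def gradS (M : ZhuMod.{u, v} V) : ℤ → Submodule ℂ (SM M) := wordDeg (modeS M) (inclS M)

theorem zeroMode_map {X X' : Type*} [AddCommGroup X] [Module ℂ X] [AddCommGroup X'] [Module ℂ X']
    {Y : ℤ → V →ₗ[ℂ] X →ₗ[ℂ] X} {Y' : ℤ → V →ₗ[ℂ] X' →ₗ[ℂ] X'} (F : X →ₗ[ℂ] X')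
    (hY : ∀ n a x, F (Y n a x) = Y' n a (F x)) (a : V) (x : X) :
    F (zeroMode Y a x) = zeroMode Y' a (F x) := by
  obtain ⟨s, rfl⟩ := (internal (V := V)).2 a
  induction s using DirectSum.induction_on with
  | zero => simp
  | of k b =>
    simp only [DirectSum.coeAddMonoidHom_of]
    rw [zeroMode, zeroMode, byWeight_of_mem _ b.2, byWeight_of_mem _ b.2, hY]
  | add s t hs ht => simp only [map_add, LinearMap.add_apply, hs, ht]

theorem RelI.map {M N : ZhuMod.{u, v} V} (f : M ⟶ N) {x : TM M} (hx : RelI M x) :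
    RelI N (inducedMap (TV V) (ZhuHom.lin f) x) := by
  have hd : ∀ d y, y ∈ degTM M d → inducedMap (TV V) (ZhuHom.lin f) y ∈ degTM N d :=
    fun d y hy => map_wordDeg ((inducedMap (TV V) (ZhuHom.lin f)).restrictScalars ℂ)
      (ZhuHom.lin f) (fun _ => rfl) (fun n a x => by simp [modeTM]) hy
  cases hx with
  | neg k m d a x ha hx h =>
    rw [map_smul]
    exact .neg k m d a _ ha (hd _ _ hx) h
  | zhu a y =>
    have h1 := zeroMode_map (Y := modeTM M) (Y' := modeTM N)
      ((inducedMap (TV V) (ZhuHom.lin f)).restrictScalars ℂ) (fun n a x => by simp [modeTM]) a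
      (incl (TV V) M y)
    simp only [LinearMap.coe_restrictScalars] at h1
    rw [map_sub, h1, inducedMap_incl, inducedMap_incl, ZhuHom.comm]
    exact .zhu a _
  | assoc k l d p q a b x ha hb hx hq hdeg =>
    simp only [map_sub, map_sum, map_smul, map_zsmul]
    exact .assoc k l d p q a b _ ha hb (hd _ _ hx) hq hdeg

/-- The map `S₁(M) → S₁(N)` induced by `M → N`. -/
def mapS1 {M N : ZhuMod.{u, v} V} (f : M ⟶ N) : S1 M →ₗ[TV V] S1 N :=
  (subI M).mapQ (subI N) (inducedMap (TV V) (ZhuHom.lin f))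
    (Submodule.span_le.2 fun _ hx => Submodule.subset_span (RelI.map f hx))

theorem RelJ.map {M N : ZhuMod.{u, v} V} (f : M ⟶ N) {x : S1 M} (hx : RelJ M x) :
    RelJ N (mapS1 f x) := by
  have hd : ∀ d y, y ∈ degS1 M d → mapS1 f y ∈ degS1 N d :=
    fun d y hy => map_wordDeg ((mapS1 f).restrictScalars ℂ)
      (ZhuHom.lin f) (fun _ => rfl) (fun n a x => by simp [modeS1]) hy
  cases hx with
  | mk k l d K m a b x ha hb hx hm =>
    simp only [map_sum, map_smul, map_zsmul]
    exact .mk k l d K m a b _ ha hb (hd _ _ hx) hm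

/-- The map `S(f) : S(M) → S(N)`. -/
def mapS {M N : ZhuMod.{u, v} V} (f : M ⟶ N) : SM M →ₗ[TV V] SM N :=
  (subJ M).mapQ (subJ N) (mapS1 f)
    (Submodule.span_le.2 fun _ hx => Submodule.subset_span (RelJ.map f hx))

/-- The functor `S`, given that its values are `ℕ`-gradable weak `V`-modules. -/
def functorS (h : ∀ M : ZhuMod.{u, v} V, IsNGradableWeakModule (modeS M) (gradS M)) :
    ZhuMod.{u, v} V ⥤ WeakMod.{u, max u v} V where
  obj M := ⟨SM M, modeS M, gradS M, h M⟩
  map f := ⟨(mapS f).restrictScalars ℂ, fun n a x => by simp [modeS]⟩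
  map_id M := by
    refine WeakHom.ext (LinearMap.ext fun x => ?_)
    obtain ⟨y, rfl⟩ := (subJ M).mkQ_surjective x
    obtain ⟨z, rfl⟩ := (subI M).mkQ_surjective y
    exact congrArg (fun t => (subJ M).mkQ ((subI M).mkQ t)) (inducedMap_id (TV V) M z)
  map_comp {M N P} f g := by
    refine WeakHom.ext (LinearMap.ext fun x => ?_)
    obtain ⟨y, rfl⟩ := (subJ M).mkQ_surjective x
    obtain ⟨z, rfl⟩ := (subI M).mkQ_surjective y
    exact congrArg (fun t => (subJ P).mkQ ((subI P).mkQ t))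
      (inducedMap_comp (TV V) (ZhuHom.lin f) (ZhuHom.lin g) z)

end FunctorS

/-! ### The Dong–Li–Mason functor

`V̂ = V[t,t⁻¹] / (L(-1) ⊗ 1 + 1 ⊗ d/dt) V[t,t⁻¹]` is a Lie algebra with bracket
`[a(m), b(n)] = ∑ᵢ (m choose i) (aᵢ b)(m+n-i)`, graded by `deg a(m) = wt a - m - 1`; here
`L(-1) a = a₋₂ 𝟏`. An `A(V)`-module `M` is a module for the subalgebra
`P = V̂_{<0} ⊕ V̂_0`, where `V̂_{<0}` acts by `0` and `a(wt a - 1)` as `a + O(V)`. -/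

section FunctorMbar

variable {V : Type u} [AddCommGroup V] [Module ℂ V] [NGradedVertexAlgebra V]

/-- The defining relations of the universal enveloping algebra of `V̂`. -/
inductive HatRel : TV V → TV V → Prop
  | deriv (a : V) (m : ℤ) : HatRel (gen m (mode (-2) a vac)) ((-m) • gen (m - 1) a)
  | bracket (a b : V) (m n : ℤ) :
      HatRel (gen m a * gen n b)
        (gen n b * gen m a + ∑ᶠ i : ℕ, (Ring.choose m i : ℤ) • gen (m + n - i) (mode i a b))

variable (V) in
/-- The universal enveloping algebra `U(V̂)`: the tensor algebra of `V[t,t⁻¹]` modulo the image of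
`L(-1) ⊗ 1 + 1 ⊗ d/dt` and `x y - y x = [x, y]`. -/
def UHat : Type u := RingQuot (HatRel (V := V))

instance : Ring (UHat V) := inferInstanceAs (Ring (RingQuot (HatRel (V := V))))

instance : Algebra ℂ (UHat V) := inferInstanceAs (Algebra ℂ (RingQuot (HatRel (V := V))))

/-- The image of `a(m)` in `U(V̂)`. -/
def hatGen (m : ℤ) : V →ₗ[ℂ] UHat V :=
  (RingQuot.mkAlgHom ℂ (HatRel (V := V)) : TV V →ₐ[ℂ] RingQuot (HatRel (V := V))).toLinearMap ∘ₗ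
    gen m

/-- The relations defining `U(V̂) ⊗_{U(P)} M` as a quotient of `U(V̂) ⊗ M`: elements of `P`
act on `M ⊆ U(V̂) ⊗_{U(P)} M` through the `P`-module structure of `M`. -/
inductive RelInd (M : ZhuMod.{u, v} V) : UHat V ⊗[ℂ] M → Prop
  | neg (k m : ℤ) (a : V) (y : M) (ha : a ∈ gr (V := V) k) (h : k - m - 1 < 0) :
      RelInd M (hatGen m a • incl (UHat V) M y)
  | zero (a : V) (y : M) :
      RelInd M (zeroMode (act hatGen (UHat V ⊗[ℂ] M)) a (incl (UHat V) M y)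
        - incl (UHat V) M (M.ρ (zhuMk V a) y))

/-- The kernel of `U(V̂) ⊗ M → U(V̂) ⊗_{U(P)} M`. -/
def subInd (M : ZhuMod.{u, v} V) : Submodule (UHat V) (UHat V ⊗[ℂ] M) :=
  Submodule.span (UHat V) {x | RelInd M x}

/-- The induced module `M₀(M) = U(V̂) ⊗_{U(P)} M`. -/
abbrev IndM (M : ZhuMod.{u, v} V) : Type (max u v) := (UHat V ⊗[ℂ] M) ⧸ subInd M

/-- The map `M → M₀(M)`. -/
def inclInd (M : ZhuMod.{u, v} V) : M →ₗ[ℂ] IndM M :=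
  (subInd M).mkQ.restrictScalars ℂ ∘ₗ incl (UHat V) M

/-- The coefficients, at `z₀^r z₂^s`, of
`(z₀+z₂)^{wt a} Y(a, z₀+z₂) Y(b, z₂) y - (z₂+z₀)^{wt a} Y(Y(a, z₀)b, z₂) y`
for homogeneous `a, b ∈ V` and `y ∈ M`; in the first product `b(n) y = 0` for `n ≥ wt b`. -/
inductive RelW (M : ZhuMod.{u, v} V) : IndM M → Prop
  | mk (k l r s : ℤ) (a b : V) (y : M) (ha : a ∈ gr (V := V) k) (hb : b ∈ gr (V := V) l) :
      RelW M (∑ i ∈ Finset.range (l + s + 1).toNat, (Ring.choose (r + i) i : ℤ) •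
            hatGen (k - 1 - i - r) a • hatGen (i - s - 1) b • inclInd M y
        - ∑ j ∈ Finset.range (k.toNat + 1), (Ring.choose k j : ℤ) •
            hatGen (k - j - s - 1) (mode (j - r - 1) a b) • inclInd M y)

/-- The `U(V̂)`-submodule of `M₀(M)` generated by these coefficients. -/
def subW (M : ZhuMod.{u, v} V) : Submodule (UHat V) (IndM M) :=
  Submodule.span (UHat V) {x | RelW M x}

/-- `M̄₀(M)`. -/
abbrev MbarM (M : ZhuMod.{u, v} V) : Type (max u v) := IndM M ⧸ subW M

/-- The map `M → M̄₀(M)`. -/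
def inclMbar (M : ZhuMod.{u, v} V) : M →ₗ[ℂ] MbarM M :=
  (subW M).mkQ.restrictScalars ℂ ∘ₗ inclInd M

/-- The vertex operators of `M̄₀(M)`. -/
def modeMbar (M : ZhuMod.{u, v} V) : ℤ → V →ₗ[ℂ] MbarM M →ₗ[ℂ] MbarM M := act hatGen (MbarM M)

/-- The grading of `M̄₀(M)`, with `M` in degree `0`. -/
def gradMbar (M : ZhuMod.{u, v} V) : ℤ → Submodule ℂ (MbarM M) :=
  wordDeg (modeMbar M) (inclMbar M)

theorem RelInd.map {M N : ZhuMod.{u, v} V} (f : M ⟶ N) {x : UHat V ⊗[ℂ] M} (hx : RelInd M x) :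
    RelInd N (inducedMap (UHat V) (ZhuHom.lin f) x) := by
  cases hx with
  | neg k m a y ha h =>
    rw [map_smul, inducedMap_incl]
    exact .neg k m a _ ha h
  | zero a y =>
    have h1 := zeroMode_map (Y := act hatGen (UHat V ⊗[ℂ] M)) (Y' := act hatGen (UHat V ⊗[ℂ] N))
      ((inducedMap (UHat V) (ZhuHom.lin f)).restrictScalars ℂ) (fun n a x => by simp) a
      (incl (UHat V) M y)
    simp only [LinearMap.coe_restrictScalars] at h1
    rw [map_sub, h1, inducedMap_incl, inducedMap_incl, ZhuHom.comm]
    exact .zero a _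

/-- The map `M₀(M) → M₀(N)` induced by `M → N`. -/
def mapInd {M N : ZhuMod.{u, v} V} (f : M ⟶ N) : IndM M →ₗ[UHat V] IndM N :=
  (subInd M).mapQ (subInd N) (inducedMap (UHat V) (ZhuHom.lin f))
    (Submodule.span_le.2 fun _ hx => Submodule.subset_span (RelInd.map f hx))

theorem mapInd_incl {M N : ZhuMod.{u, v} V} (f : M ⟶ N) (y : M) :
    mapInd f (inclInd M y) = inclInd N (ZhuHom.lin f y) := rfl

theorem RelW.map {M N : ZhuMod.{u, v} V} (f : M ⟶ N) {x : IndM M} (hx : RelW M x) :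
    RelW N (mapInd f x) := by
  cases hx with
  | mk k l r s a b y ha hb =>
    simp only [map_sub, map_sum, map_smul, map_zsmul, mapInd_incl]
    exact .mk k l r s a b _ ha hb

/-- The map `M̄₀(f) : M̄₀(M) → M̄₀(N)`. -/
def mapMbar {M N : ZhuMod.{u, v} V} (f : M ⟶ N) : MbarM M →ₗ[UHat V] MbarM N :=
  (subW M).mapQ (subW N) (mapInd f)
    (Submodule.span_le.2 fun _ hx => Submodule.subset_span (RelW.map f hx))

/-- The functor `M̄₀`, given that its values are `ℕ`-gradable weak `V`-modules. -/
def functorMbar (h : ∀ M : ZhuMod.{u, v} V, IsNGradableWeakModule (modeMbar M) (gradMbar M)) :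
    ZhuMod.{u, v} V ⥤ WeakMod.{u, max u v} V where
  obj M := ⟨MbarM M, modeMbar M, gradMbar M, h M⟩
  map f := ⟨(mapMbar f).restrictScalars ℂ, fun n a x => by simp [modeMbar]⟩
  map_id M := by
    refine WeakHom.ext (LinearMap.ext fun x => ?_)
    obtain ⟨y, rfl⟩ := (subW M).mkQ_surjective x
    obtain ⟨z, rfl⟩ := (subInd M).mkQ_surjective y
    exact congrArg (fun t => (subW M).mkQ ((subInd M).mkQ t)) (inducedMap_id (UHat V) M z)
  map_comp {M N P} f g := by
    refine WeakHom.ext (LinearMap.ext fun x => ?_)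
    obtain ⟨y, rfl⟩ := (subW M).mkQ_surjective x
    obtain ⟨z, rfl⟩ := (subInd M).mkQ_surjective y
    exact congrArg (fun t => (subW P).mkQ ((subInd P).mkQ t))
      (inducedMap_comp (UHat V) (ZhuHom.lin f) (ZhuHom.lin g) z)

end FunctorMbar

section Universal

variable {V : Type u} [AddCommGroup V] [Module ℂ V] [NGradedVertexAlgebra V]

/-- The universal property of a functor `F` from `A(V)`-modules to `ℕ`-gradable weak `V`-modules
with maps `e_M : M → F(M)`: each `e_M` is a natural `A(V)`-module map into `T(F(M))` and an
isomorphism onto the homogeneous subspace `F(M)_(0)`, and every `A(V)`-module map `f : M → T(W)`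
extends uniquely along `e_M` to a `V`-module map `F(M) → W`. -/
structure HasUniversalProperty (F : ZhuMod.{u, v} V ⥤ WeakMod.{u, max u v} V)
    (e : ∀ M : ZhuMod.{u, v} V, M →ₗ[ℂ] F.obj M) : Prop where
  natural : ∀ (M N : ZhuMod.{u, v} V) (f : M ⟶ N) (y : M),
    WeakHom.lin (F.map f) (e M y) = e N (ZhuHom.lin f y)
  isTopHom : ∀ M : ZhuMod.{u, v} V, IsTopHom M (F.obj M) (e M)
  injective : ∀ M : ZhuMod.{u, v} V, Function.Injective (e M)
  range : ∀ M : ZhuMod.{u, v} V, LinearMap.range (e M) = (F.obj M).grading 0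
  existsUnique_lift : ∀ (M : ZhuMod.{u, v} V) (W : WeakMod.{u, w} V) (f : M →ₗ[ℂ] W),
    IsTopHom M W f → ∃! g : WeakHom (F.obj M) W, ∀ y : M, g.lin (e M y) = f y

end Universal

end ZhuInduction

end

open ZhuInduction

/-!
Both functors solve the same universal problem: `S(M)` and `M̄₀(M)` are the universal weak modules
with an `A(V)`-module map from `M` to their top level. The comparison, the gradings and the
bijectivity of `M → F(M)_(0)` are consequences of this, except for the injectivity of `M → F(M)`,
which needs a module in which no element of `M` is killed.

*Borcherds' identity by indices.* `Bor Y a b x l m n` is the identity with indices `(l, m, n)`. Both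
sides satisfy the recurrence `(l + 1, m, n) = (l, m + 1, n) - (l, m, n + 1)`, so that the identities
for some indices imply others: the commutator formula (`l = 0`) gives all `l ≥ 0`, and with the
identities for a single value of `m` (weak associativity) it gives all `l` (`Bor.of_weakAssoc`);
weak associativity in both factors gives everything by skew symmetry (`Bor.of_large`, `Bor.skew`).

*`S(M)`.* On a vector killed by `a_n` for `n ≥ m`, weak associativity expresses iterates by products,
and binomial inversion turns this into a formula for the products plus the vanishing of certain
combinations of iterates (`product_eq_sum`, `bor_of_product_eq_sum`). These are the relations that define `S(M)`,
so `S(M)` is a weak module (`isWeakModule_modeS`), and a map from `M` to the top level of a weak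
module extends to it (`exists_lift_S`).

*`M̄₀(M)`.* The relations of `U(V̂)` are the commutator formula and the derivative property, and the
further relations are weak associativity on `M`. Given the commutator formula, the vectors on which
Borcherds' identity holds are stable under all modes (`Bor.mode`), so `M̄₀(M)` is a weak module
(`isWeakModule_modeMbar`). Maps out of it exist under the same assumptions (`exists_lift_Mbar`).

*Grading.* Letting `aₙ` act as `2^(wt a - n - 1) aₙ` gives another weak module. The universal property
supplies a map from `F(M)` to this twist that fixes `M`; a word of degree `d` in the modes, applied
to `M`, is an eigenvector of it with eigenvalue `2^d`, so the spaces of words of different degrees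
are independent (`isNGradableWeakModule_of_scale`). By weak associativity every word is a
combination of words of length at most one, so there is nothing in negative degree, and the part of
degree `0` is the image of `M` (`wordDeg_neg`, `wordDeg_zero`).

*Injectivity of `M → M̄₀(M)`.* Put `z = 1 + x`, and for `g ∈ ℂ[x, x⁻¹, z, z⁻¹]` let
`a[g] = Res_x g(x) Y(a, x)` (`smear`). The coinduced module `coind V M` consists of the functionals
`f : V → M` such that `g ↦ f ∘ a[g]`, for `g` of degree at most `-2` at infinity, is continuous at
`z = 0`. There `aₙ` acts by `f ↦ -f ∘ a[g]` where `g` approximates `zⁿ` at `z = 0`; the sign is that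
of the residue theorem, as `g dx` has no pole at infinity. Borcherds' identity on `V` holds
for test functions (`smear_jacobi`). At `l = -1` it involves expansions of
`1 / (x₁ - x₂) = 1 / (z₁ - z₂)`, and passing from the expansion in `x` to the one in `z`
(`sum_apply_smear_smear`) gives the identity on `coind V M` (`bor_neg_one_coindMode`); the other `l`
follow by the recurrence and by the derivation (`bor_of_neg_one`). The functional `v ↦ ρ(v + O(V)) y`
lies in `coind V M`, in its top level, because `O(V)` is the span of the `a[g] v` with `g` of order at
least `wt a` at `z = 0` and degree at most `wt a - 2` at infinity, and the zero modes act on it through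
`ρ` by Zhu's formula for `v * a` modulo `O(V)` (`zhuMul_sub_smear_mem_zhuO`, `isTopMap_zhuIncl`).
Therefore this map `M → coind V M` factors through `M̄₀(M)`, and evaluation at the vacuum recovers `y`.
The injectivity for `S(M)` follows by means of the isomorphism `S(M) ≅ M̄₀(M)`.
-/

set_option linter.unusedSectionVars false

noncomputable section

namespace ZhuInduction

open VertexAlgebra NGradedVertexAlgebra

/-! ### Finitely supported sums over `ℕ` and binomial identities -/

section Sums

variable {X : Type*} [AddCommGroup X]

theorem finsum_eq_sum_range {F : ℕ → X} {N : ℕ} (h : ∀ i, N ≤ i → F i = 0) :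
    ∑ᶠ i, F i = ∑ i ∈ Finset.range N, F i := by
  refine finsum_eq_sum_of_support_subset _ fun i hi => ?_
  by_contra hc
  exact hi (h i (by simpa using hc))

theorem exists_nat_forall_eq_zero {F : ℤ → X} (h : ∃ N : ℤ, ∀ n ≥ N, F n = 0) (l : ℤ) :
    ∃ N : ℕ, ∀ i : ℕ, N ≤ i → F (l + i) = 0 := by
  obtain ⟨N, hN⟩ := h
  exact ⟨(N - l).toNat, fun i hi => hN _ (by omega)⟩

/-- Pascal's rule, summed against a sequence. -/
theorem sum_choose_add_one (m : ℤ) (u : ℕ → X) (N : ℕ) :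
    ∑ i ∈ Finset.range (N + 1), (Ring.choose (m + 1) i : ℤ) • u i
      = ∑ i ∈ Finset.range (N + 1), (Ring.choose m i : ℤ) • u i
        + ∑ i ∈ Finset.range N, (Ring.choose m i : ℤ) • u (i + 1) := by
  rw [Finset.sum_range_succ', Finset.sum_range_succ' (fun i => (Ring.choose m i : ℤ) • u i)]
  simp only [Ring.choose_succ_succ, add_smul, Finset.sum_add_distrib, Ring.choose_zero_right]
  abel

/-- `∑ᵢ ∑ⱼ f i j = ∑ₜ ∑_{i+j=t} f i j` for `f` supported in a triangle. -/
theorem sum_range_sum_range_eq_sum_antidiagonal (f : ℕ → ℕ → X) {I J R : ℕ}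
    (h : ∀ i j, R ≤ i + j → f i j = 0) (hI : R ≤ I) (hJ : R ≤ J) :
    ∑ i ∈ Finset.range I, ∑ j ∈ Finset.range J, f i j
      = ∑ t ∈ Finset.range R, ∑ p ∈ Finset.HasAntidiagonal.antidiagonal t, f p.1 p.2 := by
  rw [← Finset.sum_product', Finset.sum_sigma']
  symm
  refine Finset.sum_bij_ne_zero (fun p _ _ => p.2) ?_ ?_ ?_ ?_
  · rintro ⟨t, i, j⟩ h1 _
    simp only [Finset.mem_sigma, Finset.mem_range, Finset.HasAntidiagonal.mem_antidiagonal,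
      Finset.mem_product] at h1 ⊢
    omega
  · rintro ⟨t, i, j⟩ h1 _ ⟨t', i', j'⟩ h2 _ h3
    simp only [Finset.mem_sigma, Finset.mem_range, Finset.HasAntidiagonal.mem_antidiagonal,
      Prod.mk.injEq] at h1 h2 h3
    obtain ⟨rfl, rfl⟩ := h3
    obtain rfl : t = t' := by omega
    rfl
  · rintro ⟨i, j⟩ _ h2
    refine ⟨⟨i + j, i, j⟩, ?_, h2, rfl⟩
    simp only [Finset.mem_sigma, Finset.mem_range, Finset.HasAntidiagonal.mem_antidiagonal,
      and_true]
    by_contra hc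
    exact h2 (h i j (by omega))
  · intros; rfl

/-- The Chu–Vandermonde identity, summed against a sequence. -/
theorem sum_choose_sum_choose (m p : ℤ) (u : ℕ → X) {R I J : ℕ} (h : ∀ r, R ≤ r → u r = 0)
    (hI : R ≤ I) (hJ : R ≤ J) :
    ∑ i ∈ Finset.range I, ∑ j ∈ Finset.range J,
        (Ring.choose m i * Ring.choose p j : ℤ) • u (i + j)
      = ∑ r ∈ Finset.range R, (Ring.choose (m + p) r : ℤ) • u r := by
  rw [sum_range_sum_range_eq_sum_antidiagonal
    (fun i j => (Ring.choose m i * Ring.choose p j : ℤ) • u (i + j))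
    (fun i j hij => by rw [h _ hij, smul_zero]) hI hJ]
  refine Finset.sum_congr rfl fun t _ => ?_
  rw [Ring.add_choose_eq t (Commute.all m p), Finset.sum_smul]
  refine Finset.sum_congr rfl fun q hq => ?_
  rw [Finset.HasAntidiagonal.mem_antidiagonal.1 hq]

end Sums

theorem choose_mul_choose_sub (L : ℤ) (i j : ℕ) :
    (Ring.choose L i * Ring.choose (L - i) j : ℤ)
      = Ring.choose L (i + j) * ((i + j).choose i : ℤ) := by
  have h := Ring.choose_smul_choose L (Nat.le_add_right i j)
  simp only [nsmul_eq_mul, Nat.add_sub_cancel_left] at h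
  linarith

theorem sum_antidiagonal_neg_one_pow_choose (t : ℕ) :
    ∑ p ∈ Finset.HasAntidiagonal.antidiagonal t, ((-1 : ℤ) ^ p.1 * (t.choose p.1 : ℤ))
      = if t = 0 then 1 else 0 := by
  rw [Finset.Nat.sum_antidiagonal_eq_sum_range_succ_mk]
  exact Int.alternating_sum_range_choose

theorem intChoose_neg (r : ℤ) (k : ℕ) :
    Ring.choose r k = (-1) ^ k * Ring.choose (k - r - 1 : ℤ) k := by
  have h := Ring.choose_neg (-r) k
  rw [neg_neg] at h
  rw [h, Int.negOnePow_def, Units.smul_def]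
  simp only [zpow_natCast, Units.val_pow_eq_pow_val, Units.val_neg, Units.val_one, smul_eq_mul]
  congr 2
  ring

/-- The binomial identity behind the skew symmetry of Borcherds' identity. -/
theorem sum_antidiagonal_choose_skew (m n : ℤ) (t : ℕ) :
    ∑ p ∈ Finset.HasAntidiagonal.antidiagonal t,
        ((-1 : ℤ) ^ p.1 * Ring.choose m p.1 * Ring.choose (m + n - p.1) p.2)
      = Ring.choose n t := by
  rw [intChoose_neg n t, show (t - n - 1 : ℤ) = m + (t - m - n - 1) by ring,
    Ring.add_choose_eq t (Commute.all _ _), Finset.mul_sum]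
  refine Finset.sum_congr rfl fun p hp => ?_
  have hp' := Finset.HasAntidiagonal.mem_antidiagonal.1 hp
  rw [intChoose_neg (m + n - p.1) p.2, ← hp', pow_add]
  rw [show ((p.2 : ℤ) - (m + n - p.1) - 1) = (((p.1 + p.2 : ℕ) : ℤ) - m - n - 1) by
    push_cast; ring]
  ring

theorem sub_mul_choose (l : ℤ) (i : ℕ) :
    (l - i) * (Ring.choose l i : ℤ) = l * Ring.choose (l - 1) i := by
  have h1 := Ring.choose_smul_choose l (Nat.le_add_left 1 i)
  have h2 := Ring.choose_smul_choose l (Nat.le_add_right i 1)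
  simp only [nsmul_eq_mul, Nat.add_sub_cancel_left, Nat.add_sub_cancel, Ring.choose_one_right,
    Nat.choose_one_right, Nat.choose_succ_self_right, Nat.cast_one] at h1 h2
  linarith

theorem add_one_mul_choose (l : ℤ) (i : ℕ) :
    (i + 1) * (Ring.choose l (i + 1) : ℤ) = l * Ring.choose (l - 1) i := by
  have h1 := Ring.choose_smul_choose l (Nat.le_add_left 1 i)
  simp only [nsmul_eq_mul, Nat.add_sub_cancel,
    Ring.choose_one_right, Nat.choose_one_right, Nat.cast_one] at h1
  push_cast at h1
  linarith


/-! ### Alternating binomial sums -/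

section Alternating

variable {X : Type*} [AddCommGroup X]

/-- Binomial inversion: if `c = ∑ᵢ εⁱ (L choose i) w(L-i, n+i)` with `ε = ±1`, then
`w = ∑ᵢ (-ε)ⁱ (L choose i) c(L-i, n+i)`. -/
theorem binomial_inversion {w c : ℤ → ℤ → X} {N ε : ℤ} (hw : ∀ L n, N ≤ n → w L n = 0)
    (hc : ∀ (L n : ℤ) (R : ℕ), N ≤ n + R →
      c L n = ∑ i ∈ Finset.range R, (ε ^ i * Ring.choose L i : ℤ) • w (L - i) (n + i))
    (L n : ℤ) (R : ℕ) (hR : N ≤ n + R) :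
    w L n = ∑ i ∈ Finset.range R, ((-ε) ^ i * Ring.choose L i : ℤ) • c (L - i) (n + i) := by
  have h1 : ∀ i ∈ Finset.range R, ((-ε) ^ i * Ring.choose L i : ℤ) • c (L - i) (n + i)
      = ∑ j ∈ Finset.range R, ((-ε) ^ i * Ring.choose L i * (ε ^ j * Ring.choose (L - i) j) : ℤ)
          • w (L - (i + j : ℕ)) (n + (i + j : ℕ)) := by
    intro i _
    rw [hc (L - i) (n + i) R (by omega), Finset.smul_sum]
    refine Finset.sum_congr rfl fun j _ => ?_
    rw [smul_smul]
    congr 2 <;> push_cast <;> ring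
  rw [Finset.sum_congr rfl h1, sum_range_sum_range_eq_sum_antidiagonal
    (fun i j => ((-ε) ^ i * Ring.choose L i * (ε ^ j * Ring.choose (L - i) j) : ℤ)
      • w (L - (i + j : ℕ)) (n + (i + j : ℕ)))
    (fun i j hij => by rw [hw _ _ (by omega), smul_zero]) le_rfl le_rfl]
  have h2 : ∀ t ∈ Finset.range R, ∑ p ∈ Finset.HasAntidiagonal.antidiagonal t,
      ((-ε) ^ p.1 * Ring.choose L p.1 * (ε ^ p.2 * Ring.choose (L - p.1) p.2) : ℤ)
        • w (L - (p.1 + p.2 : ℕ)) (n + (p.1 + p.2 : ℕ))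
      = if t = 0 then w L n else 0 := by
    intro t _
    have h3 : ∀ p ∈ Finset.HasAntidiagonal.antidiagonal t,
        ((-ε) ^ p.1 * Ring.choose L p.1 * (ε ^ p.2 * Ring.choose (L - p.1) p.2) : ℤ)
          • w (L - (p.1 + p.2 : ℕ)) (n + (p.1 + p.2 : ℕ))
        = (ε ^ t * Ring.choose L t * ((-1) ^ p.1 * (t.choose p.1 : ℤ))) • w (L - t) (n + t) := by
      intro p hp
      have hp' := Finset.HasAntidiagonal.mem_antidiagonal.1 hp
      have h4 := choose_mul_choose_sub L p.1 p.2
      rw [hp'] at h4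
      rw [hp', neg_pow]
      congr 1
      calc _ = (-1) ^ p.1 * ε ^ (p.1 + p.2) * (Ring.choose L p.1 * Ring.choose (L - p.1) p.2) := by
              rw [pow_add]; ring
        _ = _ := by rw [h4, hp']; ring
    rw [Finset.sum_congr rfl h3, ← Finset.sum_smul, ← Finset.mul_sum,
      sum_antidiagonal_neg_one_pow_choose]
    split_ifs with h0
    · subst h0; simp
    · simp
  rw [Finset.sum_congr rfl h2]
  cases R with
  | zero => simp [hw L n (by simpa using hR)]
  | succ R => simp [Finset.sum_ite_eq']

/-- `∑ᵢ (-1)ⁱ (l choose i) w(m+l-i, n+i)`: the coefficient of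
`(z₁ - z₂)ˡ z₁ᵐ z₂ⁿ ∑ w(p, q) z₁^(-p-1) z₂^(-q-1)` expanded in `|z₁| > |z₂|`. -/
def altSum (w : ℤ → ℤ → X) (l m n : ℤ) : X :=
  ∑ᶠ i : ℕ, ((-1 : ℤ) ^ i * Ring.choose l i) • w (m + l - i) (n + i)

theorem altSum_eq_sum {w : ℤ → ℤ → X} {N n : ℤ} (hw : ∀ p q, N ≤ q → w p q = 0) {R : ℕ}
    (hR : N ≤ n + R) (l m : ℤ) :
    altSum w l m n
      = ∑ i ∈ Finset.range R, ((-1 : ℤ) ^ i * Ring.choose l i) • w (m + l - i) (n + i) :=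
  finsum_eq_sum_range fun i hi => by rw [hw _ _ (by omega), smul_zero]

theorem altSum_succ {w : ℤ → ℤ → X} {N : ℤ} (hw : ∀ p q, N ≤ q → w p q = 0) (l m n : ℤ) :
    altSum w (l + 1) m n = altSum w l (m + 1) n - altSum w l m (n + 1) := by
  have hR : N ≤ n + ((N - n).toNat : ℕ) := by omega
  rw [altSum_eq_sum hw (R := (N - n).toNat + 1) (by push_cast; omega),
    altSum_eq_sum hw (R := (N - n).toNat + 1) (by push_cast; omega),
    altSum_eq_sum hw (R := (N - n).toNat) (by omega)]
  have h := sum_choose_add_one l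
    (fun i : ℕ => ((-1 : ℤ) ^ i) • w (m + (l + 1) - i) (n + i)) (N - n).toNat
  simp only [smul_smul] at h
  simp only [mul_comm ((-1 : ℤ) ^ _)]
  rw [h, sub_eq_add_neg (∑ i ∈ _, _), ← Finset.sum_neg_distrib]
  congr 1
  · refine Finset.sum_congr rfl fun i _ => ?_
    rw [show m + (l + 1) - (i : ℤ) = m + 1 + l - i by ring]
  · refine Finset.sum_congr rfl fun i _ => ?_
    rw [← neg_smul, pow_succ]
    push_cast
    rw [show m + (l + 1) - ((i : ℤ) + 1) = m + l - i by ring,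
      show n + ((i : ℤ) + 1) = n + 1 + i by ring]
    congr 1
    ring

theorem altSum_add {w w' : ℤ → ℤ → X} {N N' : ℤ}
    (hw : ∀ p q, N ≤ q → w p q = 0) (hw' : ∀ p q, N' ≤ q → w' p q = 0) (l m n : ℤ) :
    altSum (fun p q => w p q + w' p q) l m n = altSum w l m n + altSum w' l m n := by
  set R := (N - n).toNat + (N' - n).toNat
  rw [altSum_eq_sum hw (R := R) (by omega), altSum_eq_sum hw' (R := R) (by omega),
    altSum_eq_sum (N := max N N') (R := R) _ (by omega), ← Finset.sum_add_distrib]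
  · simp only [smul_add]
  · intro p q h
    rw [hw _ _ (le_of_max_le_left h), hw' _ _ (le_of_max_le_right h), add_zero]

end Alternating

section Truncation

variable {V : Type*} [AddCommGroup V] [Module ℂ V]
variable {X : Type*} [AddCommGroup X] [Module ℂ X] {Y : ℤ → V →ₗ[ℂ] X →ₗ[ℂ] X}

/-- Lower truncation: `aₙ x = 0` for `n` large. -/
def LowerTruncated (Y : ℤ → V →ₗ[ℂ] X →ₗ[ℂ] X) : Prop :=
  ∀ (a : V) (x : X), ∃ N : ℤ, ∀ n ≥ N, Y n a x = 0

theorem altSum_comp_trunc (hY : LowerTruncated Y) (a b : V) (x : X) :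
    ∃ N : ℤ, ∀ p q, N ≤ q → Y p a (Y q b x) = 0 := by
  obtain ⟨N, hN⟩ := hY b x
  exact ⟨N, fun p q h => by rw [hN q h, map_zero]⟩

/-- The product side of Borcherds' identity. -/
def borR (Y : ℤ → V →ₗ[ℂ] X →ₗ[ℂ] X) (a b : V) (x : X) (l m n : ℤ) : X :=
  ∑ᶠ i : ℕ, ((-1 : ℤ) ^ i * Ring.choose l i) •
    (Y (m + l - i) a (Y (n + i) b x) - (l.negOnePow : ℤ) • Y (n + l - i) b (Y (m + i) a x))

theorem borR_eq_altSum (hY : LowerTruncated Y) (a b : V) (x : X) (l m n : ℤ) :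
    borR Y a b x l m n = altSum (fun p q => Y p a (Y q b x)) l m n
      - (l.negOnePow : ℤ) • altSum (fun p q => Y p b (Y q a x)) l n m := by
  obtain ⟨A, hA⟩ := hY a x
  obtain ⟨B, hB⟩ := hY b x
  have h1 : ∀ p q, max A B ≤ q → Y p a (Y q b x) = 0 := fun p q h => by
    rw [hB q (le_of_max_le_right h), map_zero]
  have h2 : ∀ p q, max A B ≤ q → Y p b (Y q a x) = 0 := fun p q h => by
    rw [hA q (le_of_max_le_left h), map_zero]
  set R := (max A B - n).toNat + (max A B - m).toNat with hR
  rw [altSum_eq_sum h1 (R := R) (by omega), altSum_eq_sum h2 (R := R) (by omega), Finset.smul_sum,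
    ← Finset.sum_sub_distrib, borR, finsum_eq_sum_range (N := R)]
  · refine Finset.sum_congr rfl fun i _ => ?_
    rw [smul_sub, smul_comm]
  · intro i hi
    rw [h1 _ _ (by omega), h2 _ _ (by omega)]
    simp

end Truncation

/-! ### Borcherds' identity for given indices -/

section Borcherds

variable {V : Type*} [AddCommGroup V] [Module ℂ V] [VertexAlgebra V]
variable {X : Type*} [AddCommGroup X] [Module ℂ X] {Y : ℤ → V →ₗ[ℂ] X →ₗ[ℂ] X}

/-- The iterate side of Borcherds' identity. -/
def borL (Y : ℤ → V →ₗ[ℂ] X →ₗ[ℂ] X) (a b : V) (x : X) (l m n : ℤ) : X :=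
  ∑ᶠ i : ℕ, (Ring.choose m i : ℤ) • Y (m + n - i) (mode (l + i) a b) x

/-- Borcherds' identity for the given elements and indices. -/
def Bor (Y : ℤ → V →ₗ[ℂ] X →ₗ[ℂ] X) (a b : V) (x : X) (l m n : ℤ) : Prop :=
  borL Y a b x l m n = borR Y a b x l m n

theorem exists_mode_eq_zero (a b : V) (l : ℤ) :
    ∃ N : ℕ, ∀ i : ℕ, N ≤ i → mode (l + i) a b = 0 :=
  exists_nat_forall_eq_zero (VertexAlgebra.truncation a b) l

theorem borL_eq_sum {a b : V} {l : ℤ} {N : ℕ} (hN : ∀ i : ℕ, N ≤ i → mode (l + i) a b = 0)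
    (x : X) (m n : ℤ) :
    borL Y a b x l m n
      = ∑ i ∈ Finset.range N, (Ring.choose m i : ℤ) • Y (m + n - i) (mode (l + i) a b) x :=
  finsum_eq_sum_range fun i hi => by simp [hN i hi]

/-- The recurrence in the indices for the iterate side. -/
theorem borL_succ (a b : V) (x : X) (l m n : ℤ) :
    borL Y a b x (l + 1) m n = borL Y a b x l (m + 1) n - borL Y a b x l m (n + 1) := by
  obtain ⟨N, hN⟩ := exists_mode_eq_zero a b l
  have hN1 : ∀ i : ℕ, N ≤ i → mode (l + 1 + i) a b = 0 := fun i hi => by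
    have := hN (i + 1) (by omega)
    rwa [Nat.cast_add, Nat.cast_one, ← add_assoc, add_right_comm] at this
  have hN2 : ∀ i : ℕ, N + 1 ≤ i → mode (l + i) a b = 0 := fun i hi => hN i (by omega)
  rw [borL_eq_sum hN1, borL_eq_sum hN2, borL_eq_sum hN2, sum_choose_add_one, add_comm m 1,
    add_assoc 1 m n, show m + (n + 1) = 1 + (m + n) by ring, add_sub_cancel_left]
  refine Finset.sum_congr rfl fun i _ => ?_
  rw [Nat.cast_add, Nat.cast_one, show 1 + (m + n) - ((i : ℤ) + 1) = m + n - i by ring,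
    show l + ((i : ℤ) + 1) = l + 1 + i by ring]

/-- The recurrence in the indices for the product side. -/
theorem borR_succ (hY : LowerTruncated Y) (a b : V) (x : X) (l m n : ℤ) :
    borR Y a b x (l + 1) m n = borR Y a b x l (m + 1) n - borR Y a b x l m (n + 1) := by
  obtain ⟨A, hA⟩ := hY a x
  obtain ⟨B, hB⟩ := hY b x
  have h1 : ∀ p q, B ≤ q → Y p a (Y q b x) = 0 := fun p q h => by rw [hB q h, map_zero]
  have h2 : ∀ p q, A ≤ q → Y p b (Y q a x) = 0 := fun p q h => by rw [hA q h, map_zero]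
  simp only [borR_eq_altSum hY]
  rw [altSum_succ h1, altSum_succ h2, Int.negOnePow_succ]
  simp only [Units.val_neg, neg_smul, smul_sub]
  abel

theorem Bor.succ (hY : LowerTruncated Y) {a b : V} {x : X} {l m n : ℤ}
    (h1 : Bor Y a b x l (m + 1) n) (h2 : Bor Y a b x l m (n + 1)) : Bor Y a b x (l + 1) m n := by
  unfold Bor at *
  rw [borL_succ, borR_succ hY, h1, h2]

theorem Bor.add_one_middle (hY : LowerTruncated Y) {a b : V} {x : X} {l m n : ℤ}
    (h1 : Bor Y a b x (l + 1) m n) (h2 : Bor Y a b x l m (n + 1)) : Bor Y a b x l (m + 1) n := by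
  unfold Bor at *
  rw [borL_succ, borR_succ hY, h2] at h1
  simpa using h1

theorem Bor.add_one_right (hY : LowerTruncated Y) {a b : V} {x : X} {l m n : ℤ}
    (h1 : Bor Y a b x (l + 1) m n) (h2 : Bor Y a b x l (m + 1) n) : Bor Y a b x l m (n + 1) := by
  unfold Bor at *
  rw [borL_succ, borR_succ hY, h2] at h1
  simpa using h1

/-- Borcherds' identity for `l ≥ 0` follows from the commutator formula. -/
theorem Bor.of_nonneg (hY : LowerTruncated Y) {a b : V} {x : X}
    (h : ∀ m n, Bor Y a b x 0 m n) {l : ℤ} (hl : 0 ≤ l) (m n : ℤ) : Bor Y a b x l m n := by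
  lift l to ℕ using hl
  induction l generalizing m n with
  | zero => exact h m n
  | succ l ih => exact_mod_cast Bor.succ hY (ih _ _) (ih _ _)

/-- If Borcherds' identity holds for `l + 1`, then for `l` it suffices to know it for a single
value of `m`. -/
theorem Bor.of_succ_of_middle (hY : LowerTruncated Y) {a b : V} {x : X} {l m₀ : ℤ}
    (h : ∀ m n, Bor Y a b x (l + 1) m n) (h₀ : ∀ n, Bor Y a b x l m₀ n) (m n : ℤ) :
    Bor Y a b x l m n := by
  induction m using Int.induction_on generalizing n with
  | zero =>
    have hz : ∀ (j : ℕ) (n : ℤ), Bor Y a b x l (m₀ + j) n ∧ Bor Y a b x l (m₀ - j) n := by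
      intro j
      induction j with
      | zero => intro n; simp [h₀ n]
      | succ j ih =>
        refine fun n => ⟨?_, ?_⟩
        · push_cast
          rw [← add_assoc]
          exact Bor.add_one_middle hY (h _ _) (ih _).1
        · have := Bor.add_one_right hY (h (m₀ - (j + 1 : ℕ)) (n - 1))
            (by push_cast; rw [show m₀ - ((j : ℤ) + 1) + 1 = m₀ - j by ring]; exact (ih _).2)
          rwa [sub_add_cancel] at this
    rcases le_total m₀ 0 with h0 | h0
    · have := (hz (-m₀).toNat n).1
      rwa [show m₀ + ((-m₀).toNat : ℤ) = 0 by omega] at this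
    · have := (hz m₀.toNat n).2
      rwa [show m₀ - (m₀.toNat : ℤ) = 0 by omega] at this
  | succ j ih => exact Bor.add_one_middle hY (h _ _) (ih _)
  | pred j ih =>
    have := Bor.add_one_right hY (h (-(j : ℤ) - 1) (n - 1)) (by rw [sub_add_cancel]; exact ih _)
    rwa [sub_add_cancel] at this

/-- If Borcherds' identity holds, for all `l`, in the region where `m` or `n` is large, then it
always holds. -/
theorem Bor.of_large (hY : LowerTruncated Y) {a b : V} {x : X} {M N : ℤ}
    (h1 : ∀ l m n, M ≤ m → Bor Y a b x l m n) (h2 : ∀ l m n, N ≤ n → Bor Y a b x l m n)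
    (l m n : ℤ) : Bor Y a b x l m n := by
  suffices H : ∀ (s : ℕ) (l m n : ℤ), M + N ≤ m + n + s → Bor Y a b x l m n from
    H (M + N - m - n).toNat l m n (by omega)
  intro s
  induction s with
  | zero =>
    intro l m n hs
    rcases le_or_gt M m with h | h
    · exact h1 l m n h
    · exact h2 l m n (by push_cast at hs; omega)
  | succ s ih =>
    intro l m n hs
    have := Bor.succ hY (ih (l - 1) (m + 1) n (by push_cast at hs; omega))
      (ih (l - 1) m (n + 1) (by push_cast at hs; omega))
    rwa [sub_add_cancel] at this

theorem borL_add_right (a b : V) (x y : X) (l m n : ℤ) :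
    borL Y a b (x + y) l m n = borL Y a b x l m n + borL Y a b y l m n := by
  obtain ⟨N, hN⟩ := exists_mode_eq_zero a b l
  simp only [borL_eq_sum hN, map_add, smul_add, Finset.sum_add_distrib]

theorem borR_add_right (hY : LowerTruncated Y) (a b : V) (x y : X) (l m n : ℤ) :
    borR Y a b (x + y) l m n = borR Y a b x l m n + borR Y a b y l m n := by
  simp only [borR_eq_altSum hY, map_add]
  rw [altSum_add (altSum_comp_trunc hY a b x).choose_spec (altSum_comp_trunc hY a b y).choose_spec,
    altSum_add (altSum_comp_trunc hY b a x).choose_spec (altSum_comp_trunc hY b a y).choose_spec,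
    smul_add]
  abel

theorem borL_add_left (a a' b : V) (x : X) (l m n : ℤ) :
    borL Y (a + a') b x l m n = borL Y a b x l m n + borL Y a' b x l m n := by
  obtain ⟨N, hN⟩ := exists_mode_eq_zero a b l
  obtain ⟨N', hN'⟩ := exists_mode_eq_zero a' b l
  have h1 : ∀ i : ℕ, max N N' ≤ i → mode (l + i) a b = 0 := fun i h => hN i (by omega)
  have h2 : ∀ i : ℕ, max N N' ≤ i → mode (l + i) a' b = 0 := fun i h => hN' i (by omega)
  rw [borL_eq_sum h1, borL_eq_sum h2, borL_eq_sum (N := max N N') (fun i h => by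
    rw [map_add, LinearMap.add_apply, h1 i h, h2 i h, add_zero]), ← Finset.sum_add_distrib]
  simp only [map_add, LinearMap.add_apply, smul_add]

theorem borL_add_middle (a b b' : V) (x : X) (l m n : ℤ) :
    borL Y a (b + b') x l m n = borL Y a b x l m n + borL Y a b' x l m n := by
  obtain ⟨N, hN⟩ := exists_mode_eq_zero a b l
  obtain ⟨N', hN'⟩ := exists_mode_eq_zero a b' l
  have h1 : ∀ i : ℕ, max N N' ≤ i → mode (l + i) a b = 0 := fun i h => hN i (by omega)
  have h2 : ∀ i : ℕ, max N N' ≤ i → mode (l + i) a b' = 0 := fun i h => hN' i (by omega)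
  rw [borL_eq_sum h1, borL_eq_sum h2, borL_eq_sum (N := max N N') (fun i h => by
    rw [map_add, h1 i h, h2 i h, add_zero]), ← Finset.sum_add_distrib]
  simp only [map_add, LinearMap.add_apply, smul_add]

theorem borR_add_left (hY : LowerTruncated Y) (a a' b : V) (x : X) (l m n : ℤ) :
    borR Y (a + a') b x l m n = borR Y a b x l m n + borR Y a' b x l m n := by
  simp only [borR_eq_altSum hY, map_add, LinearMap.add_apply]
  rw [altSum_add (altSum_comp_trunc hY a b x).choose_spec (altSum_comp_trunc hY a' b x).choose_spec,
    altSum_add (altSum_comp_trunc hY b a x).choose_spec (altSum_comp_trunc hY b a' x).choose_spec,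
    smul_add]
  abel

theorem borR_add_middle (hY : LowerTruncated Y) (a b b' : V) (x : X) (l m n : ℤ) :
    borR Y a (b + b') x l m n = borR Y a b x l m n + borR Y a b' x l m n := by
  simp only [borR_eq_altSum hY, map_add, LinearMap.add_apply]
  rw [altSum_add (altSum_comp_trunc hY a b x).choose_spec (altSum_comp_trunc hY a b' x).choose_spec,
    altSum_add (altSum_comp_trunc hY b a x).choose_spec (altSum_comp_trunc hY b' a x).choose_spec,
    smul_add]
  abel

theorem Bor.zero_left (b : V) (x : X) (l m n : ℤ) : Bor Y 0 b x l m n := by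
  simp [Bor, borL, borR]

theorem Bor.zero_middle (a : V) (x : X) (l m n : ℤ) : Bor Y a 0 x l m n := by
  simp [Bor, borL, borR]

theorem Bor.zero_right (a b : V) (l m n : ℤ) : Bor Y a b 0 l m n := by
  simp [Bor, borL, borR]

theorem Bor.add_left (hY : LowerTruncated Y) {a a' b : V} {x : X} {l m n : ℤ}
    (h : Bor Y a b x l m n) (h' : Bor Y a' b x l m n) : Bor Y (a + a') b x l m n := by
  unfold Bor at *; rw [borL_add_left, borR_add_left hY, h, h']

theorem Bor.add_middle (hY : LowerTruncated Y) {a b b' : V} {x : X} {l m n : ℤ}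
    (h : Bor Y a b x l m n) (h' : Bor Y a b' x l m n) : Bor Y a (b + b') x l m n := by
  unfold Bor at *; rw [borL_add_middle, borR_add_middle hY, h, h']

theorem Bor.add_right (hY : LowerTruncated Y) {a b : V} {x y : X} {l m n : ℤ}
    (h : Bor Y a b x l m n) (h' : Bor Y a b y l m n) : Bor Y a b (x + y) l m n := by
  unfold Bor at *; rw [borL_add_right, borR_add_right hY, h, h']

theorem Bor.smul_right {a b : V} {x : X} {l m n : ℤ} (c : ℂ)
    (h : Bor Y a b x l m n) : Bor Y a b (c • x) l m n := by
  unfold Bor at *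
  have h1 : borL Y a b (c • x) l m n = c • borL Y a b x l m n := by
    simp only [borL, smul_finsum, map_smul]
    exact finsum_congr fun i => smul_comm _ _ _
  have h2 : borR Y a b (c • x) l m n = c • borR Y a b x l m n := by
    simp only [borR, smul_finsum, map_smul]
    refine finsum_congr fun i => ?_
    rw [smul_comm c, smul_sub c, smul_comm c (l.negOnePow : ℤ)]
  rw [h1, h2, h]

end Borcherds


/-! ### Weak modules without a grading -/

section WeakModule

variable {V : Type*} [AddCommGroup V] [Module ℂ V] [VertexAlgebra V]
variable {X : Type*} [AddCommGroup X] [Module ℂ X] {Y : ℤ → V →ₗ[ℂ] X →ₗ[ℂ] X}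

/-- `X` with the vertex operators `Y` is a module for the vertex algebra `V`; no grading on `X` is
required. -/
structure IsWeakModule (Y : ℤ → V →ₗ[ℂ] X →ₗ[ℂ] X) : Prop where
  trunc : LowerTruncated Y
  vacuum : ∀ (n : ℤ) (x : X), Y n (vac : V) x = if n = -1 then x else 0
  bor : ∀ (a b : V) (x : X) (l m n : ℤ), Bor Y a b x l m n

variable (V) in
theorem isWeakModule_mode : IsWeakModule (mode : ℤ → V →ₗ[ℂ] V →ₗ[ℂ] V) :=
  ⟨VertexAlgebra.truncation, VertexAlgebra.vacuum, VertexAlgebra.jacobi⟩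

/-- The `L(-1)`-derivative property, with `L(-1) a = a₋₂ 𝟏`. -/
def HasDerivProperty (Y : ℤ → V →ₗ[ℂ] X →ₗ[ℂ] X) : Prop :=
  ∀ (a : V) (n : ℤ) (x : X), Y n (mode (-2) a vac) x = (-n) • Y (n - 1) a x

theorem altSum_vacuum_right (u : ℤ → X) (l m n : ℤ) :
    altSum (fun p q => if q = -1 then u p else 0) l m n
      = if n ≤ -1 then ((-1 : ℤ) ^ (-1 - n).toNat * Ring.choose l (-1 - n).toNat) • u (m + l + 1 + n)
        else 0 := by
  rw [altSum]
  split_ifs with h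
  · rw [finsum_eq_single _ (-1 - n).toNat]
    · rw [if_pos (by omega)]
      congr 2
      omega
    · intro i hi
      rw [if_neg (by omega), smul_zero]
  · refine finsum_eq_zero_of_forall_eq_zero fun i => ?_
    rw [if_neg (by omega), smul_zero]

theorem altSum_vacuum_left (u : ℤ → X) (l m n : ℤ) :
    altSum (fun p q => if p = -1 then u q else 0) l n m
      = if 0 ≤ n + l + 1 then
          ((-1 : ℤ) ^ (n + l + 1).toNat * Ring.choose l (n + l + 1).toNat) • u (m + n + l + 1)
        else 0 := by
  rw [altSum]
  split_ifs with h
  · rw [finsum_eq_single _ (n + l + 1).toNat]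
    · rw [if_pos (by omega)]
      congr 2
      omega
    · intro i hi
      rw [if_neg (by omega), smul_zero]
  · refine finsum_eq_zero_of_forall_eq_zero fun i => ?_
    rw [if_neg (by omega), smul_zero]

theorem choose_neg_two (i : ℕ) : (-1 : ℤ) ^ i * (Ring.choose (-2 : ℤ) i : ℤ) = i + 1 := by
  rw [intChoose_neg, ← mul_assoc, ← mul_pow]
  have : Ring.choose (((i + 1 : ℕ) : ℤ)) i = ((i + 1).choose i : ℤ) := Ring.choose_natCast _ _
  rw [show (i - (-2) - 1 : ℤ) = ((i + 1 : ℕ) : ℤ) by push_cast; ring, this]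
  simp

theorem deriv_of_bor (hY : LowerTruncated Y)
    (hvac : ∀ (n : ℤ) (x : X), Y n (vac : V) x = if n = -1 then x else 0) {b : V} {x : X} {m : ℤ}
    (h : ∀ n, Bor Y b vac x (-2) m n) (q : ℤ) :
    Y q (mode (-2) b vac) x = (-q) • Y (q - 1) b x := by
  obtain ⟨n, rfl⟩ : ∃ n, q = m + n := ⟨q - m, by ring⟩
  have h1 := h n
  unfold Bor at h1
  rw [borL_eq_sum (N := 2) (fun i hi => creation_nonneg b _ (by omega)), borR_eq_altSum hY] at h1
  simp only [hvac, Finset.sum_range_succ, Finset.sum_range_zero, zero_add, Ring.choose_zero_right,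
    Ring.choose_one_right, Nat.cast_zero, Nat.cast_one, sub_zero, add_zero, one_smul,
    show (-2 + 1 : ℤ) = -1 by norm_num, creation] at h1
  have h2 := altSum_vacuum_right (fun p => Y p b x) (-2) m n
  have h3 := altSum_vacuum_left (fun q => Y q b x) (-2) m n
  have h4 : ∀ p q : ℤ, Y p b (if q = -1 then x else 0) = if q = -1 then Y p b x else 0 := by
    intro p q; split_ifs <;> simp
  simp only [h4, h2, h3, choose_neg_two] at h1
  rw [show m + -2 + 1 + n = m + n - 1 by ring, show m + n + -2 + 1 = m + n - 1 by ring] at h1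
  have hs : ((-2 : ℤ).negOnePow : ℤ) = 1 := by decide
  rw [hs, one_smul, ← eq_sub_iff_add_eq] at h1
  rw [h1]
  rcases lt_or_ge n 0 with hn | hn
  · rw [if_pos (by omega), if_neg (by omega), sub_zero, ← sub_smul]
    congr 1
    omega
  · rw [if_neg (by omega)]
    split_ifs with h5
    · rw [zero_sub, ← neg_smul, ← sub_smul]
      congr 1
      omega
    · obtain rfl : n = 0 := by omega
      simp

theorem IsWeakModule.deriv (hY : IsWeakModule Y) : HasDerivProperty Y :=
  fun _ q _ => deriv_of_bor (m := 0) hY.trunc hY.vacuum (fun _ => hY.bor _ _ _ _ _ _) q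

/-- `(D⁽ˢ⁾a)_q = (-1)ˢ (q choose s) a_{q-s}` for `D⁽ˢ⁾a = a_{-1-s} 𝟏`. -/
theorem HasDerivProperty.divided_power (hY : HasDerivProperty Y) (s : ℕ) (a : V) (q : ℤ) (x : X) :
    Y q (mode (-1 - s) a vac) x = ((-1 : ℤ) ^ s * Ring.choose q s) • Y (q - s) a x := by
  induction s generalizing a q with
  | zero => simp [creation]
  | succ s ih =>
    have h1 := ih (mode (-2) a vac) q
    rw [(isWeakModule_mode V).deriv a, hY, map_zsmul, LinearMap.smul_apply, smul_smul] at h1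
    have h2 := add_one_mul_choose q s
    have h3 := sub_mul_choose q s
    have h5 : (((s : ℤ) + 1 : ℤ) : ℂ) ≠ 0 := by exact_mod_cast Nat.succ_ne_zero s
    have h6 : ∀ u v : X, ((s : ℤ) + 1) • u = ((s : ℤ) + 1) • v → u = v := by
      intro u v huv
      rw [← Int.cast_smul_eq_zsmul ℂ, ← Int.cast_smul_eq_zsmul ℂ] at huv
      exact smul_right_injective _ h5 huv
    apply h6
    push_cast
    rw [show -(-1 - (s : ℤ)) = s + 1 by ring] at h1
    rw [show -1 - ((s : ℤ) + 1) = -1 - s - 1 by ring, h1, smul_smul,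
      show q - ((s : ℤ) + 1) = q - s - 1 by ring]
    congr 1
    rw [pow_succ]
    linear_combination (-1) ^ s * (h2 - h3)

theorem choose_neg_one (i : ℕ) : (Ring.choose (-1 : ℤ) i : ℤ) = (-1) ^ i := by
  rw [intChoose_neg, show (i - (-1) - 1 : ℤ) = (i : ℤ) by ring]
  have : Ring.choose (i : ℤ) i = (i.choose i : ℤ) := Ring.choose_natCast _ _
  rw [this]
  simp

/-- Skew symmetry: `aₗ b = -(-1)ˡ ∑ₛ (-1)ˢ D⁽ˢ⁾(b_{l+s} a)`. -/
theorem skew_symmetry {a b : V} {l : ℤ} {N : ℕ} (hN : ∀ i : ℕ, N ≤ i → mode (l + i) b a = 0) :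
    mode l a b = -((l.negOnePow : ℤ) • ∑ s ∈ Finset.range N,
      (-1 : ℤ) ^ s • mode (-1 - s) (mode (l + s) b a) vac) := by
  have h := (isWeakModule_mode V).bor b a vac l (-1) 0
  unfold Bor at h
  rw [borL_eq_sum hN, borR, finsum_eq_single _ 0] at h
  · simp only [choose_neg_one, pow_zero, Ring.choose_zero_right, mul_one, one_smul, Nat.cast_zero,
      sub_zero, add_zero, creation, zero_add] at h
    rw [creation_nonneg a 0 le_rfl, map_zero, zero_sub] at h
    rw [h, smul_neg, smul_smul, neg_neg]
    have : (l.negOnePow : ℤ) * (l.negOnePow : ℤ) = 1 := by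
      rcases Int.even_or_odd l with h | h
      · simp [Int.negOnePow_even l h]
      · simp [Int.negOnePow_odd l h]
    rw [this, one_smul]
  · intro i hi
    rw [creation_nonneg a (0 + (i : ℤ)) (by omega),
      creation_nonneg b (-1 + (i : ℤ)) (by omega)]
    simp

theorem borL_skew (hY : HasDerivProperty Y) (a b : V) (x : X) (l m n : ℤ) :
    borL Y b a x l m n = -((l.negOnePow : ℤ) • borL Y a b x l n m) := by
  obtain ⟨R, hR⟩ := exists_mode_eq_zero a b l
  obtain ⟨N, hN⟩ := exists_mode_eq_zero b a l
  have hN' : ∀ i : ℕ, N + R ≤ i → mode (l + i) b a = 0 := fun i hi => hN i (by omega)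
  rw [borL_eq_sum hN', borL_eq_sum hR]
  set u : ℕ → X := fun t => Y (m + n - t) (mode (l + t) a b) x with hu
  have h1 : ∀ i ∈ Finset.range (N + R),
      (Ring.choose m i : ℤ) • Y (m + n - i) (mode (l + i) b a) x
        = ∑ s ∈ Finset.range R, (-(l.negOnePow : ℤ)
            * ((-1 : ℤ) ^ i * Ring.choose m i * Ring.choose (m + n - i) s)) • u (i + s) := by
    intro i _
    have hi : ∀ s : ℕ, R ≤ s → mode (l + i + s) a b = 0 := fun s hs => by
      have := hR (i + s) (by omega)
      rwa [Nat.cast_add, ← add_assoc] at this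
    rw [skew_symmetry hi]
    simp only [map_neg, map_sum, map_zsmul, LinearMap.neg_apply, LinearMap.smul_apply,
      LinearMap.sum_apply, hY.divided_power, Finset.smul_sum, smul_neg, smul_smul,
      ← Finset.sum_neg_distrib]
    refine Finset.sum_congr rfl fun s _ => ?_
    rw [← neg_smul, hu]
    simp only [Nat.cast_add]
    rw [Int.negOnePow_add, sub_sub, add_assoc l]
    congr 1
    rw [Units.val_mul, Int.negOnePow_def (i : ℤ)]
    simp only [zpow_natCast, Units.val_pow_eq_pow_val, Units.val_neg, Units.val_one]
    have : ((-1 : ℤ) ^ s) * (-1) ^ s = 1 := by rw [← mul_pow]; simp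
    linear_combination (-(l.negOnePow : ℤ) * ((-1 : ℤ) ^ i * Ring.choose m i
      * Ring.choose (m + n - i) s)) * this
  rw [Finset.sum_congr rfl h1, sum_range_sum_range_eq_sum_antidiagonal
    (fun i s => (-(l.negOnePow : ℤ)
            * ((-1 : ℤ) ^ i * Ring.choose m i * Ring.choose (m + n - i) s)) • u (i + s))
    (fun i j hij => by
      have h0 : u (i + j) = 0 := by simp only [hu, hR _ hij, map_zero, LinearMap.zero_apply]
      rw [h0, smul_zero]) (by omega) le_rfl, Finset.smul_sum,
    ← Finset.sum_neg_distrib]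
  refine Finset.sum_congr rfl fun t _ => ?_
  rw [← sum_antidiagonal_choose_skew m n t, smul_smul, ← neg_smul, ← neg_mul, Finset.mul_sum,
    add_comm n m, Finset.sum_smul]
  refine Finset.sum_congr rfl fun p hp => ?_
  rw [Finset.HasAntidiagonal.mem_antidiagonal.1 hp]

/-- Borcherds' identity for `(a, b)` is equivalent to that for `(b, a)` by skew symmetry. -/
theorem Bor.skew (hY : LowerTruncated Y) (hD : HasDerivProperty Y) {a b : V} {x : X} {l m n : ℤ}
    (h : Bor Y a b x l n m) : Bor Y b a x l m n := by
  unfold Bor at *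
  rw [borL_skew hD, h, borR_eq_altSum hY, borR_eq_altSum hY, smul_sub, smul_smul]
  have : (l.negOnePow : ℤ) * (l.negOnePow : ℤ) = 1 := by
    rcases Int.even_or_odd l with h | h
    · simp [Int.negOnePow_even l h]
    · simp [Int.negOnePow_odd l h]
  rw [this, one_smul]
  abel

theorem borL_eq_sum_of_nonneg {m : ℤ} (hm : 0 ≤ m) (a b : V) (x : X) (l n : ℤ) :
    borL Y a b x l m n = ∑ j ∈ Finset.range (m + 1).toNat,
      (Ring.choose m j : ℤ) • Y (m + n - j) (mode (l + j) a b) x := by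
  lift m to ℕ using hm
  refine finsum_eq_sum_range fun i hi => ?_
  have : Ring.choose (m : ℤ) i = (m.choose i : ℤ) := Ring.choose_natCast _ _
  rw [this, Nat.choose_eq_zero_of_lt (by omega)]
  simp

/-- If `a_{m+i} x = 0` for `i ≥ 0`, Borcherds' identity at `m` is weak associativity. -/
theorem borR_eq_altSum_of_trunc (hY : LowerTruncated Y) {a b : V} {x : X} {m : ℤ}
    (ha : ∀ n, m ≤ n → Y n a x = 0) (l n : ℤ) :
    borR Y a b x l m n = altSum (fun p q => Y p a (Y q b x)) l m n := by
  have h : ∀ p q, m ≤ q → Y p b (Y q a x) = 0 := fun p q h => by rw [ha q h, map_zero]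
  rw [borR_eq_altSum hY, altSum_eq_sum h (n := m) (R := 0) (by simp)]
  simp

/-- Weak associativity, solved for the product `a_p b_q x`. -/
theorem product_eq_sum (hY : LowerTruncated Y) {a b : V} {x : X} {m N : ℤ}
    (ha : ∀ n, m ≤ n → Y n a x = 0) (hb : ∀ n, N ≤ n → Y n b x = 0)
    (h : ∀ l n, Bor Y a b x l m n) (p q : ℤ) :
    Y p a (Y q b x) = ∑ i ∈ Finset.range (N - q).toNat,
      (Ring.choose (p - m) i : ℤ) • borL Y a b x (p - m - i) m (q + i) := by
  have hw : ∀ p q, N ≤ q → Y p a (Y q b x) = 0 := fun p q h => by rw [hb q h, map_zero]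
  have h1 := binomial_inversion (w := fun L n => Y (m + L) a (Y n b x))
    (c := fun L n => borL Y a b x L m n) (N := N) (ε := -1) (fun L n h => hw _ _ h)
    (fun L n R hR => by
      have := h L n
      unfold Bor at this
      rw [this, borR_eq_altSum_of_trunc hY ha, altSum_eq_sum hw hR]
      refine Finset.sum_congr rfl fun i _ => ?_
      rw [add_sub_assoc])
    (p - m) q (N - q).toNat (by omega)
  simp only [neg_neg, one_pow, one_mul, add_sub_cancel] at h1
  exact h1

/-- The converse of `product_eq_sum`, given that the iterate sides vanish when `b_n x` does. -/
theorem bor_of_product_eq_sum (hY : LowerTruncated Y) {a b : V} {x : X} {m N : ℤ}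
    (ha : ∀ n, m ≤ n → Y n a x = 0) (hb : ∀ n, N ≤ n → Y n b x = 0)
    (h0 : ∀ l n, N ≤ n → borL Y a b x l m n = 0)
    (h : ∀ p q, q < N → Y p a (Y q b x) = ∑ i ∈ Finset.range (N - q).toNat,
      (Ring.choose (p - m) i : ℤ) • borL Y a b x (p - m - i) m (q + i)) (l n : ℤ) :
    Bor Y a b x l m n := by
  have hw : ∀ p q, N ≤ q → Y p a (Y q b x) = 0 := fun p q h => by rw [hb q h, map_zero]
  have h1 := binomial_inversion (c := fun L n => Y (m + L) a (Y n b x))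
    (w := fun L n => borL Y a b x L m n) (N := N) (ε := 1) h0
    (fun L n R hR => by
      simp only [one_pow, one_mul]
      rcases lt_or_ge n N with hn | hn
      · rw [h _ _ hn]
        simp only [add_sub_cancel_left]
        refine Finset.sum_subset (Finset.range_mono (by omega)) fun i _ hi => ?_
        rw [h0 _ _ (by simp at hi; omega), smul_zero]
      · rw [hw _ _ hn]
        exact (Finset.sum_eq_zero fun i _ => by rw [h0 _ _ (by omega), smul_zero]).symm)
    l n (N - n).toNat (by omega)
  unfold Bor
  rw [h1, borR_eq_altSum_of_trunc hY ha, altSum_eq_sum hw (R := (N - n).toNat) (by omega)]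
  refine Finset.sum_congr rfl fun i _ => ?_
  rw [add_sub_assoc]

end WeakModule


/-! ### Words in weak modules -/

section Graded

variable {V : Type u} [AddCommGroup V] [Module ℂ V] [NGradedVertexAlgebra V]

theorem homogeneous_induction {p : V → Prop} (h0 : p 0) (hadd : ∀ a b, p a → p b → p (a + b))
    (hhom : ∀ k a, a ∈ gr (V := V) k → p a) (a : V) : p a := by
  obtain ⟨s, rfl⟩ := (internal (V := V)).2 a
  induction s using DirectSum.induction_on with
  | zero => simpa using h0
  | of k b => simpa using hhom k b b.2
  | add s t hs ht => rw [map_add]; exact hadd _ _ hs ht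

theorem eq_zero_of_mem_gr_neg {k : ℤ} {a : V} (ha : a ∈ gr (V := V) k) (hk : k < 0) : a = 0 := by
  rw [NGradedVertexAlgebra.gr_neg k hk] at ha
  simpa using ha

theorem vac_mem_gr : (vac : V) ∈ gr (V := V) 0 := by
  classical
  let := (internal (V := V)).chooseDecomposition
  obtain ⟨s, hs⟩ := (internal (V := V)).2 (vac : V)
  have hcomp : ∀ (k : ℤ) (b : V), b ∈ gr (V := V) k → ∀ s : DirectSum ℤ fun i => gr (V := V) i,
      (DirectSum.decompose (gr (V := V)) (mode (-1) (DirectSum.coeAddMonoidHom (gr (V := V)) s) b) k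
        : V) = mode (-1) (s 0 : V) b := by
    intro k b hb s
    induction s using DirectSum.induction_on with
    | zero => simp
    | of j c =>
      have h2 : mode (-1) (c : V) b ∈ gr (V := V) (j + k) := by
        have := mode_mem j k (-1) (c : V) b c.2 hb
        rwa [show j + k - (-1) - 1 = j + k by ring] at this
      rw [DirectSum.coeAddMonoidHom_of]
      by_cases hj : j = 0
      · subst hj
        rw [zero_add] at h2
        rw [DirectSum.decompose_of_mem_same _ h2, DirectSum.of_eq_same]
      · rw [DirectSum.decompose_of_mem_ne _ h2 (by omega),
          DirectSum.of_eq_of_ne _ _ _ (Ne.symm hj)]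
        simp
    | add s t hs ht => simp [hs, ht]
  -- The component of degree `0` of the vacuum acts as the identity, because the vacuum does.
  have key : ∀ b : V, mode (-1) (s 0 : V) b = b := by
    refine homogeneous_induction (by simp) (fun a b ha hb => by rw [map_add, ha, hb]) ?_
    intro k b hb
    rw [← hcomp k b hb s, hs, VertexAlgebra.vacuum, if_pos rfl, DirectSum.decompose_of_mem_same _ hb]
  have := key vac
  rw [creation] at this
  rw [← this]
  exact (s 0).2

variable {X : Type w} [AddCommGroup X] [Module ℂ X] {Y : ℤ → V →ₗ[ℂ] X →ₗ[ℂ] X}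

theorem Bor.of_homogeneous (hY : LowerTruncated Y) {x : X} {l m n : ℤ}
    (h : ∀ (k k' : ℤ) (a b : V), a ∈ gr (V := V) k → b ∈ gr (V := V) k' → Bor Y a b x l m n)
    (a b : V) : Bor Y a b x l m n := by
  refine homogeneous_induction (p := fun a => Bor Y a b x l m n) (Bor.zero_left _ _ _ _ _)
    (fun _ _ => Bor.add_left hY) (fun k a ha => ?_) a
  exact homogeneous_induction (p := fun b => Bor Y a b x l m n) (Bor.zero_middle _ _ _ _ _)
    (fun _ _ => Bor.add_middle hY) (fun k' b hb => h k k' a b ha hb) b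

/-- `f` is an `A(V)`-module map from `M` into the top level of `X`, for vertex operators `Y` that
need not make `X` a module. -/
structure IsTopMap (M : ZhuMod.{u, v} V) (Y : ℤ → V →ₗ[ℂ] X →ₗ[ℂ] X) (f : M →ₗ[ℂ] X) : Prop where
  neg : ∀ (y : M) (k n : ℤ) (a : V), a ∈ gr (V := V) k → k ≤ n → Y n a (f y) = 0
  zero : ∀ (a : V) (y : M), f (M.ρ (zhuMk V a) y) = zeroMode Y a (f y)

/-- The span of the elements `aₙ f(y)` of degree `d`, `a` homogeneous. -/
def singleSpan {M : Type v} [AddCommGroup M] [Module ℂ M] (Y : ℤ → V →ₗ[ℂ] X →ₗ[ℂ] X)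
    (f : M →ₗ[ℂ] X) (d : ℤ) : Submodule ℂ X :=
  Submodule.span ℂ {x | ∃ (k n : ℤ) (a : V) (y : M), a ∈ gr (V := V) k ∧ k - n - 1 = d ∧
    x = Y n a (f y)}

variable {M : ZhuMod.{u, v} V} {f : M →ₗ[ℂ] X}

/-- By weak associativity, words of length two on `f(M)` are combinations of words of length one. -/
theorem mode_singleSpan (hY : IsWeakModule Y) (hf : IsTopMap M Y f) {k m d : ℤ} {a : V}
    (ha : a ∈ gr (V := V) k) {x : X} (hx : x ∈ singleSpan Y f d) :
    Y m a x ∈ singleSpan Y f (k - m - 1 + d) := by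
  suffices H : singleSpan Y f d ≤ (singleSpan Y f (k - m - 1 + d)).comap (Y m a) from H hx
  refine Submodule.span_le.2 ?_
  rintro _ ⟨l, n, b, y, hb, rfl, rfl⟩
  simp only [Submodule.comap_coe, Set.mem_preimage, SetLike.mem_coe]
  rcases lt_or_ge k 0 with hk | hk
  · rw [eq_zero_of_mem_gr_neg ha hk]; simp
  rw [product_eq_sum hY.trunc (fun n hn => hf.neg y k n a ha hn) (fun n hn => hf.neg y l n b hb hn)
    (fun _ _ => hY.bor _ _ _ _ _ _)]
  refine Submodule.sum_mem _ fun i _ => ?_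
  rw [borL_eq_sum_of_nonneg hk]
  refine zsmul_mem (Submodule.sum_mem _ fun j _ => zsmul_mem (Submodule.subset_span ?_) _) _
  exact ⟨_, _, _, y, mode_mem _ _ _ _ _ ha hb, by ring, rfl⟩

theorem wordDeg_le_singleSpan (hY : IsWeakModule Y) (hf : IsTopMap M Y f) (d : ℤ) :
    wordDeg Y f d ≤ singleSpan Y f d := by
  refine Submodule.span_le.2 ?_
  intro x hx
  induction hx with
  | base y =>
    exact Submodule.subset_span ⟨0, -1, vac, y, vac_mem_gr, by norm_num, by simp [hY.vacuum]⟩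
  | mode k m d a x ha _ ih => exact mode_singleSpan hY hf ha ih

theorem wordDeg_neg (hY : IsWeakModule Y) (hf : IsTopMap M Y f) {d : ℤ} (hd : d < 0) {x : X}
    (hx : x ∈ wordDeg Y f d) : x = 0 := by
  have h : singleSpan Y f d ≤ ⊥ := by
    refine Submodule.span_le.2 ?_
    rintro _ ⟨k, n, a, y, ha, rfl, rfl⟩
    simpa using hf.neg y k n a ha (by omega)
  simpa using h (wordDeg_le_singleSpan hY hf d hx)

/-- The part of degree `0` of a weak module generated by `M` is the image of `M`: a word of length
one and degree `0` is a zero mode, which acts on `M` through `A(V)`. -/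
theorem wordDeg_zero (hY : IsWeakModule Y) (hf : IsTopMap M Y f) :
    wordDeg Y f 0 = LinearMap.range f := by
  apply le_antisymm
  · refine (wordDeg_le_singleSpan hY hf 0).trans (Submodule.span_le.2 ?_)
    rintro _ ⟨k, n, a, y, ha, h, rfl⟩
    obtain rfl : n = k - 1 := by omega
    refine ⟨M.ρ (zhuMk V a) y, ?_⟩
    rw [hf.zero, zeroMode, byWeight_of_mem _ ha]
  · rintro _ ⟨y, rfl⟩
    exact Submodule.subset_span (.base y)

theorem mode_mem_wordDeg {M : Type v} [AddCommGroup M] [Module ℂ M] {f : M →ₗ[ℂ] X} {k m d : ℤ}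
    {a : V} (ha : a ∈ gr (V := V) k) {x : X} (hx : x ∈ wordDeg Y f d) :
    Y m a x ∈ wordDeg Y f (k - m - 1 + d) := by
  have : wordDeg Y f d ≤ (wordDeg Y f (k - m - 1 + d)).comap (Y m a) :=
    Submodule.span_le.2 fun x hx => Submodule.subset_span (.mode k m d a x ha hx)
  exact this hx

/-- Modes of too negative degree kill words. -/
theorem mode_wordDeg_eq_zero (hY : IsWeakModule Y) (hf : IsTopMap M Y f) {k d : ℤ} {a : V}
    (ha : a ∈ gr (V := V) k) {x : X} (hx : x ∈ wordDeg Y f d) {m : ℤ} (hm : k + d ≤ m) :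
    Y m a x = 0 :=
  wordDeg_neg hY hf (by omega) (mode_mem_wordDeg ha hx)

/-- `M` generates `X` under the modes. -/
def Generates {M : Type v} [AddCommGroup M] [Module ℂ M] (Y : ℤ → V →ₗ[ℂ] X →ₗ[ℂ] X)
    (f : M →ₗ[ℂ] X) : Prop :=
  ∀ N : Submodule ℂ X, (∀ y, f y ∈ N) → (∀ (n : ℤ) (a : V) (x : X), x ∈ N → Y n a x ∈ N) → N = ⊤

theorem Generates.iSup_wordDeg {M : Type v} [AddCommGroup M] [Module ℂ M] {f : M →ₗ[ℂ] X}
    (h : Generates Y f) : ⨆ d, wordDeg Y f d = ⊤ := by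
  refine h _ (fun y => Submodule.mem_iSup_of_mem 0 (Submodule.subset_span (.base y))) ?_
  intro n a x hx
  refine homogeneous_induction (p := fun a => Y n a x ∈ ⨆ d, wordDeg Y f d) (by simp)
    (fun a b ha hb => by simpa using add_mem ha hb) (fun k a ha => ?_) a
  have : ⨆ d, wordDeg Y f d ≤ (⨆ d, wordDeg Y f d).comap (Y n a) :=
    iSup_le fun d x hx => Submodule.mem_iSup_of_mem (k - n - 1 + d) (mode_mem_wordDeg ha hx)
  exact this hx

end Graded


/-! ### Maps out of quotients of `A ⊗ M` -/

section Lift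

section Algebra

variable {A : Type u} [Ring A] [Algebra ℂ A] {X : Type w} [AddCommGroup X] [Module ℂ X]
variable (φ : A →ₐ[ℂ] Module.End ℂ X)

/-- The map `A ⊗ M → X`, `a ⊗ y ↦ a f(y)`, for a representation `φ` of `A` on `X`. -/
def liftTensor {M : Type v} [AddCommGroup M] [Module ℂ M] (f : M →ₗ[ℂ] X) : A ⊗[ℂ] M →ₗ[ℂ] X :=
  TensorProduct.lift ((LinearMap.lcomp ℂ X f) ∘ₗ φ.toLinearMap)

theorem liftTensor_incl {M : Type v} [AddCommGroup M] [Module ℂ M] (f : M →ₗ[ℂ] X) (y : M) :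
    liftTensor φ f (incl A M y) = f y := by
  simp [liftTensor, incl]

theorem liftTensor_smul {M : Type v} [AddCommGroup M] [Module ℂ M] (f : M →ₗ[ℂ] X) (a : A)
    (z : A ⊗[ℂ] M) : liftTensor φ f (a • z) = φ a (liftTensor φ f z) := by
  induction z with
  | zero => simp
  | tmul b y => simp [liftTensor, TensorProduct.smul_tmul']
  | add x y hx hy => simp only [smul_add, map_add, hx, hy]

variable {Z : Type*} [AddCommGroup Z] [Module ℂ Z] [Module A Z] [IsScalarTower ℂ A Z]

/-- A `ℂ`-linear map that vanishes on an `A`-submodule, descended to the quotient. -/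
def liftQuot (N : Submodule A Z) (F : Z →ₗ[ℂ] X) (h : ∀ z ∈ N, F z = 0) : Z ⧸ N →ₗ[ℂ] X :=
  (N.restrictScalars ℂ).liftQ F h ∘ₗ
    (Submodule.Quotient.restrictScalarsEquiv ℂ N).symm.toLinearMap

theorem liftQuot_mk (N : Submodule A Z) (F : Z →ₗ[ℂ] X) (h : ∀ z ∈ N, F z = 0) (z : Z) :
    liftQuot N F h (N.mkQ z) = F z := rfl

variable {φ}

theorem eq_zero_of_mem_span {F : Z →ₗ[ℂ] X} (hF : ∀ (a : A) (z : Z), F (a • z) = φ a (F z))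
    {s : Set Z} (hs : ∀ z ∈ s, F z = 0) : ∀ z ∈ Submodule.span A s, F z = 0 := by
  intro z hz
  induction hz using Submodule.span_induction with
  | mem z hz => exact hs z hz
  | zero => exact map_zero F
  | add x y _ _ hx hy => rw [map_add, hx, hy, add_zero]
  | smul a x _ hx => rw [hF, hx, map_zero]

theorem liftQuot_smul {N : Submodule A Z} {F : Z →ₗ[ℂ] X} {h : ∀ z ∈ N, F z = 0}
    (hF : ∀ (a : A) (z : Z), F (a • z) = φ a (F z)) (a : A) (z : Z ⧸ N) :
    liftQuot N F h (a • z) = φ a (liftQuot N F h z) := by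
  obtain ⟨z, rfl⟩ := N.mkQ_surjective z
  rw [← map_smul, liftQuot_mk, liftQuot_mk, hF]

end Algebra

section TensorAlgebra

variable {V : Type u} [AddCommGroup V] [Module ℂ V] {X : Type w} [AddCommGroup X] [Module ℂ X]

/-- The representation of `T(V[t,t⁻¹])` in which `a(m)` acts as `Y m a`. -/
def liftTV (Y : ℤ → V →ₗ[ℂ] X →ₗ[ℂ] X) : TV V →ₐ[ℂ] Module.End ℂ X :=
  (TensorAlgebra.lift ℂ : _ ≃ (TensorAlgebra ℂ (V ⊗[ℂ] LaurentPolynomial ℂ) →ₐ[ℂ]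
      Module.End ℂ X)) (TensorProduct.lift
    ((Finsupp.lsum ℂ (fun m : ℤ => LinearMap.toSpanSingleton ℂ (V →ₗ[ℂ] Module.End ℂ X) (Y m)) ∘ₗ
      (AddMonoidAlgebra.coeffLinearEquiv ℂ).toLinearMap :
        LaurentPolynomial ℂ →ₗ[ℂ] V →ₗ[ℂ] Module.End ℂ X).flip))

theorem liftTV_gen (Y : ℤ → V →ₗ[ℂ] X →ₗ[ℂ] X) (m : ℤ) (a : V) : liftTV Y (gen m a) = Y m a := by
  have : liftTV Y (gen m a) = TensorProduct.lift
    ((Finsupp.lsum ℂ (fun m : ℤ => LinearMap.toSpanSingleton ℂ (V →ₗ[ℂ] Module.End ℂ X) (Y m)) ∘ₗ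
      (AddMonoidAlgebra.coeffLinearEquiv ℂ).toLinearMap :
        LaurentPolynomial ℂ →ₗ[ℂ] V →ₗ[ℂ] Module.End ℂ X).flip)
        (a ⊗ₜ[ℂ] LaurentPolynomial.T m) :=
    TensorAlgebra.lift_ι_apply _ _
  rw [this]
  rw [TensorProduct.lift.tmul, LinearMap.flip_apply, LinearMap.comp_apply]
  have h2 : (AddMonoidAlgebra.coeffLinearEquiv ℂ).toLinearMap (LaurentPolynomial.T m)
      = Finsupp.single m (1 : ℂ) := rfl
  rw [h2, Finsupp.lsum_single, LinearMap.toSpanSingleton_apply, one_smul]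

theorem TV_induction {C : TV V → Prop} (halg : ∀ r, C (algebraMap ℂ (TV V) r))
    (hgen : ∀ m a, C (gen m a)) (hmul : ∀ x y, C x → C y → C (x * y))
    (hadd : ∀ x y, C x → C y → C (x + y)) (x : TV V) : C x := by
  have hz : ∀ z : V ⊗[ℂ] LaurentPolynomial ℂ, C (TensorAlgebra.ι ℂ z) := by
    intro z
    induction z with
    | zero =>
      have h0 := halg 0
      rw [map_zero] at h0
      rw [map_zero]
      exact h0
    | add x y hx hy => rw [map_add]; exact hadd _ _ hx hy
    | tmul a p =>
      induction p using LaurentPolynomial.induction_on' with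
      | add p q hp hq => rw [TensorProduct.tmul_add, map_add]; exact hadd _ _ hp hq
      | C_mul_T n c =>
        rw [← LaurentPolynomial.smul_eq_C_mul, ← TensorProduct.smul_tmul]
        exact hgen n (c • a)
  exact TensorAlgebra.induction (R := ℂ) (M := V ⊗[ℂ] LaurentPolynomial ℂ) (C := C) halg hz hmul
    hadd x

theorem adjoin_gen : Algebra.adjoin ℂ {x : TV V | ∃ m a, x = gen m a} = ⊤ := by
  rw [eq_top_iff]
  intro x _
  exact TV_induction (C := fun x => x ∈ Algebra.adjoin ℂ {x : TV V | ∃ m a, x = gen m a})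
    (fun r => Subalgebra.algebraMap_mem _ r) (fun m a => Algebra.subset_adjoin ⟨m, a, rfl⟩)
    (fun _ _ => Subalgebra.mul_mem _) (fun _ _ => Subalgebra.add_mem _) x

/-- If the algebra `A` is generated by the elements `g m a`, then a subspace of an `A`-module that
is stable under these elements is stable under `A`. -/
theorem smul_mem_of_adjoin {A : Type u} [Ring A] [Algebra ℂ A] {g : ℤ → V →ₗ[ℂ] A}
    (hg : Algebra.adjoin ℂ {x : A | ∃ m a, x = g m a} = ⊤) {Z : Type*} [AddCommGroup Z] [Module ℂ Z]
    [Module A Z] [IsScalarTower ℂ A Z] {N : Submodule ℂ Z}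
    (hN : ∀ (m : ℤ) (a : V) (z : Z), z ∈ N → g m a • z ∈ N) (t : A) {z : Z} (hz : z ∈ N) :
    t • z ∈ N := by
  have ht : t ∈ Algebra.adjoin ℂ {x : A | ∃ m a, x = g m a} := by rw [hg]; trivial
  induction ht using Algebra.adjoin_induction generalizing z with
  | mem x hx => obtain ⟨m, a, rfl⟩ := hx; exact hN m a z hz
  | algebraMap r => rw [algebraMap_smul]; exact N.smul_mem r hz
  | add x y _ _ hx hy => rw [add_smul]; exact N.add_mem (hx hz) (hy hz)
  | mul x y _ _ hx hy => rw [mul_smul]; exact hx (hy hz)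

theorem eq_top_of_adjoin {A : Type u} [Ring A] [Algebra ℂ A] {g : ℤ → V →ₗ[ℂ] A}
    (hg : Algebra.adjoin ℂ {x : A | ∃ m a, x = g m a} = ⊤) {M : Type v} [AddCommGroup M]
    [Module ℂ M] {N : Submodule ℂ (A ⊗[ℂ] M)} (hi : ∀ y, incl A M y ∈ N)
    (hN : ∀ (m : ℤ) (a : V) z, z ∈ N → g m a • z ∈ N) : N = ⊤ := by
  rw [eq_top_iff]
  intro z _
  induction z with
  | zero => exact N.zero_mem
  | add x y hx hy => exact N.add_mem (hx trivial) (hy trivial)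
  | tmul a y =>
    have := smul_mem_of_adjoin hg hN a (hi y)
    simpa [incl, TensorProduct.smul_tmul'] using this

end TensorAlgebra

/-! ### The universal property of `S(M)` -/

section LiftS

variable {V : Type u} [AddCommGroup V] [Module ℂ V] [NGradedVertexAlgebra V]
variable {X : Type w} [AddCommGroup X] [Module ℂ X] {Y : ℤ → V →ₗ[ℂ] X →ₗ[ℂ] X}
variable {M : ZhuMod.{u, v} V} {f : M →ₗ[ℂ] X}

theorem liftTensor_relI (hY : IsWeakModule Y) (hf : IsTopMap M Y f) {x : TM M} (hx : RelI M x) :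
    liftTensor (liftTV Y) f x = 0 := by
  have hs : ∀ (n : ℤ) (a : V) (z : TM M), liftTensor (liftTV Y) f (gen n a • z)
      = Y n a (liftTensor (liftTV Y) f z) := fun n a z => by rw [liftTensor_smul, liftTV_gen]
  have hd : ∀ d z, z ∈ degTM M d → liftTensor (liftTV Y) f z ∈ wordDeg Y f d :=
    fun d z hz => map_wordDeg (liftTensor (liftTV Y) f) id (liftTensor_incl _ _) hs hz
  cases hx with
  | neg k m d a x ha hx h =>
    rw [hs]
    exact mode_wordDeg_eq_zero hY hf ha (hd d x hx) (by omega)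
  | zhu a y =>
    rw [map_sub, zeroMode_map (Y' := Y) (liftTensor (liftTV Y) f) hs, liftTensor_incl,
      liftTensor_incl, hf.zero, sub_self]
  | assoc k l d p q a b x ha hb hx hq hdeg =>
    simp only [map_sub, map_sum, map_zsmul, hs]
    rcases lt_or_ge k 0 with hk | hk
    · rw [eq_zero_of_mem_gr_neg ha hk]; simp
    rcases lt_or_ge d 0 with h0 | h0
    · rw [wordDeg_neg hY hf h0 (hd d x hx)]; simp
    have hxd := hd d x hx
    rw [product_eq_sum hY.trunc (m := k + d) (N := l + d)
      (fun n hn => mode_wordDeg_eq_zero hY hf ha hxd hn)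
      (fun n hn => mode_wordDeg_eq_zero hY hf hb hxd hn) (fun _ _ => hY.bor _ _ _ _ _ _),
      sub_eq_zero]
    refine Finset.sum_congr rfl fun i _ => ?_
    rw [borL_eq_sum_of_nonneg (by omega), Finset.smul_sum]
    refine Finset.sum_congr rfl fun j _ => ?_
    rw [smul_smul, ← sub_sub p k d, show k + d + (q + i) - (j : ℤ) = q + k + d + i - j by ring]

theorem lift_relJ (hY : IsWeakModule Y) (hf : IsTopMap M Y f) {G : S1 M →ₗ[ℂ] X}
    (hG : ∀ y, G (inclS1 M y) = f y) (hs : ∀ (n : ℤ) (a : V) z, G (gen n a • z) = Y n a (G z))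
    {x : S1 M} (hx : RelJ M x) : G x = 0 := by
  have hd : ∀ d z, z ∈ degS1 M d → G z ∈ wordDeg Y f d :=
    fun d z hz => map_wordDeg G id hG hs hz
  cases hx with
  | mk k l d K m a b x ha hb hx hm =>
    simp only [map_sum, map_zsmul, hs]
    rcases lt_or_ge k 0 with hk | hk
    · rw [eq_zero_of_mem_gr_neg ha hk]; simp
    rcases lt_or_ge d 0 with h0 | h0
    · rw [wordDeg_neg hY hf h0 (hd d x hx)]; simp
    have hxd := hd d x hx
    have hb0 : ∀ p q, l + d ≤ q → Y p a (Y q b (G x)) = 0 := fun p q hq => by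
      rw [mode_wordDeg_eq_zero hY hf hb hxd hq, map_zero]
    have h := hY.bor a b (G x) m (k + d) (K + l - m - 2 - d)
    unfold Bor at h
    rw [borL_eq_sum_of_nonneg (by omega), borR_eq_altSum_of_trunc hY.trunc
      (fun n hn => mode_wordDeg_eq_zero hY hf ha hxd hn),
      altSum_eq_sum hb0 (R := 0) (by push_cast; omega), Finset.sum_range_zero] at h
    rw [← h]
    refine Finset.sum_congr rfl fun j _ => ?_
    rw [add_comm m, show k + d + (K + l - m - 2 - d) - (j : ℤ) = K + k + l - j - m - 2 by ring]

/-- Maps out of `S(M)`; no grading is required on the target. -/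
theorem exists_lift_S (hY : IsWeakModule Y) (hf : IsTopMap M Y f) :
    ∃ g : SM M →ₗ[ℂ] X, (∀ y, g (inclS M y) = f y) ∧
      ∀ (n : ℤ) (a : V) (x : SM M), g (modeS M n a x) = Y n a (g x) := by
  have hF := liftTensor_smul (liftTV Y) f
  have h1 := eq_zero_of_mem_span hF (fun z (hz : z ∈ {x | RelI M x}) => liftTensor_relI hY hf hz)
  have hG := liftQuot_smul (N := subI M) (h := h1) hF
  have hG1 : ∀ y, liftQuot (subI M) _ h1 (inclS1 M y) = f y := fun y =>
    (liftQuot_mk (subI M) _ h1 _).trans (liftTensor_incl _ _ _)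
  have h2 := eq_zero_of_mem_span hG (fun z (hz : z ∈ {x | RelJ M x}) =>
    lift_relJ hY hf hG1 (fun n a z => by rw [hG, liftTV_gen]) hz)
  refine ⟨liftQuot (subJ M) _ h2, fun y => (liftQuot_mk (subJ M) _ h2 _).trans (hG1 y), ?_⟩
  intro n a x
  have := liftQuot_smul (N := subJ M) (h := h2) hG (gen n a) x
  rwa [liftTV_gen] at this

theorem generates_S (M : ZhuMod.{u, v} V) : Generates (modeS M) (inclS M) := by
  intro N hi hN
  have h1 : N.comap ((subJ M).mkQ.restrictScalars ℂ ∘ₗ (subI M).mkQ.restrictScalars ℂ) = ⊤ :=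
    eq_top_of_adjoin adjoin_gen hi fun m a z hz => hN m a _ hz
  rw [eq_top_iff]
  intro x _
  obtain ⟨y, rfl⟩ := (subJ M).mkQ_surjective x
  obtain ⟨z, rfl⟩ := (subI M).mkQ_surjective y
  have : z ∈ N.comap ((subJ M).mkQ.restrictScalars ℂ ∘ₗ (subI M).mkQ.restrictScalars ℂ) := by
    rw [h1]; trivial
  exact this

end LiftS

end Lift


/-! ### `S(M)` is a module for the vertex algebra -/

section WeakAssociativity

variable {V : Type u} [AddCommGroup V] [Module ℂ V] [NGradedVertexAlgebra V]
variable {X : Type w} [AddCommGroup X] [Module ℂ X] {Y : ℤ → V →ₗ[ℂ] X →ₗ[ℂ] X}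

theorem wordDeg_le_map {M : Type v} [AddCommGroup M] [Module ℂ M] {X' : Type*}
    [AddCommGroup X'] [Module ℂ X'] {e : M →ₗ[ℂ] X} {Y' : ℤ → V →ₗ[ℂ] X' →ₗ[ℂ] X'}
    {e' : M →ₗ[ℂ] X'} (F : X →ₗ[ℂ] X') (he : ∀ y, F (e y) = e' y)
    (hY : ∀ n a x, F (Y n a x) = Y' n a (F x)) (d : ℤ) :
    wordDeg Y' e' d ≤ (wordDeg Y e d).map F := by
  have key : ∀ d x', IsWord Y' e' d x' → ∃ x, IsWord Y e d x ∧ F x = x' := by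
    intro d x' h
    induction h with
    | base y => exact ⟨e y, .base y, he y⟩
    | mode k m d a x' ha _ ih =>
      obtain ⟨x, hx, rfl⟩ := ih
      exact ⟨Y m a x, .mode k m d a x ha hx, hY _ _ _⟩
  refine Submodule.span_le.2 fun x' hx' => ?_
  obtain ⟨x, hx, rfl⟩ := key d x' hx'
  exact ⟨x, Submodule.subset_span hx, rfl⟩

theorem iSup_induction_wordDeg {M : Type v} [AddCommGroup M] [Module ℂ M] {e : M →ₗ[ℂ] X}
    (hg : Generates Y e) {p : X → Prop} (h0 : p 0) (hadd : ∀ x y, p x → p y → p (x + y))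
    (h : ∀ d x, x ∈ wordDeg Y e d → p x) (x : X) : p x := by
  have hx : x ∈ ⨆ d, wordDeg Y e d := by rw [hg.iSup_wordDeg]; trivial
  exact Submodule.iSup_induction _ (motive := p) hx h h0 hadd

theorem lowerTruncated_of_words {M : Type v} [AddCommGroup M] [Module ℂ M] {e : M →ₗ[ℂ] X}
    (hg : Generates Y e)
    (h : ∀ (k d : ℤ) (a : V) (x : X), a ∈ gr (V := V) k → x ∈ wordDeg Y e d →
      ∃ N : ℤ, ∀ n ≥ N, Y n a x = 0) : LowerTruncated Y := by
  have hsup : ∀ {F G : ℤ → X}, (∃ N : ℤ, ∀ n ≥ N, F n = 0) → (∃ N : ℤ, ∀ n ≥ N, G n = 0) →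
      ∃ N : ℤ, ∀ n ≥ N, F n + G n = 0 := by
    rintro F G ⟨N, hN⟩ ⟨N', hN'⟩
    exact ⟨max N N', fun n hn => by
      rw [hN n (le_of_max_le_left hn), hN' n (le_of_max_le_right hn), add_zero]⟩
  intro a x
  refine homogeneous_induction (p := fun a => ∃ N : ℤ, ∀ n ≥ N, Y n a x = 0) ⟨0, by simp⟩
    (fun a b ha hb => by simpa using hsup ha hb) (fun k a ha => ?_) a
  exact iSup_induction_wordDeg hg (p := fun x => ∃ N : ℤ, ∀ n ≥ N, Y n a x = 0) ⟨0, by simp⟩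
    (fun x y hx hy => by simpa using hsup hx hy) (fun d x hx => h k d a x ha hx) x

/-- Weak associativity for all words implies Borcherds' identity. -/
theorem isWeakModule_of_weakAssoc {M : Type v} [AddCommGroup M] [Module ℂ M] {e : M →ₗ[ℂ] X}
    (hg : Generates Y e) (hY : LowerTruncated Y)
    (hvac : ∀ (n : ℤ) (x : X), Y n (vac : V) x = if n = -1 then x else 0)
    (h : ∀ (k k' d : ℤ) (a b : V) (x : X), a ∈ gr (V := V) k → b ∈ gr (V := V) k' →
      x ∈ wordDeg Y e d → ∀ l n, Bor Y a b x l (k + d) n) : IsWeakModule Y := by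
  have hD : HasDerivProperty Y := by
    intro a n x
    refine homogeneous_induction
      (p := fun a => Y n (mode (-2) a vac) x = (-n) • Y (n - 1) a x) (by simp)
      (fun a b ha hb => ?_) (fun k a ha => ?_) a
    · rw [map_add, LinearMap.add_apply, map_add, LinearMap.add_apply, ha, hb, map_add,
        LinearMap.add_apply, smul_add]
    · refine iSup_induction_wordDeg hg
        (p := fun x => Y n (mode (-2) a vac) x = (-n) • Y (n - 1) a x) (by simp)
        (fun x y hx hy => by rw [map_add, map_add, hx, hy, smul_add]) (fun d x hx => ?_) x
      exact deriv_of_bor hY hvac (h k 0 d a vac x ha vac_mem_gr hx (-2)) n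
  refine ⟨hY, hvac, fun a b x l m n => ?_⟩
  refine iSup_induction_wordDeg hg (p := fun x => Bor Y a b x l m n) (Bor.zero_right _ _ _ _ _)
    (fun x y => Bor.add_right hY) (fun d x hx => ?_) x
  refine Bor.of_homogeneous hY (fun k k' a b ha hb => ?_) a b
  have h1 : ∀ (k k' : ℤ) (a b : V), a ∈ gr (V := V) k → b ∈ gr (V := V) k' →
      ∀ l m n, k + d ≤ m → Bor Y a b x l m n := by
    intro k k' a b ha hb l m n hm
    obtain ⟨j, rfl⟩ : ∃ j : ℕ, m = k + d + j := ⟨(m - (k + d)).toNat, by omega⟩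
    induction j generalizing l n with
    | zero => simpa using h k k' d a b x ha hb hx l n
    | succ j ih =>
      push_cast
      rw [← add_assoc]
      exact Bor.add_one_middle hY (ih (l + 1) n (by omega)) (ih l (n + 1) (by omega))
  exact Bor.of_large hY (h1 k k' a b ha hb)
    (fun l m n hn => Bor.skew hY hD (h1 k' k b a hb ha l n m hn)) l m n

/-- The vacuum acts on `b_q x` as it should, by weak associativity. -/
theorem vac_of_weakAssoc (hY : LowerTruncated Y) {b : V} {x : X} {d : ℤ} (hd : 0 ≤ d)
    (hv : ∀ n, d ≤ n → Y n vac x = 0) (h : ∀ l n, Bor Y vac b x l d n) (p q : ℤ) :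
    Y p vac (Y q b x) = if p = -1 then Y q b x else 0 := by
  obtain ⟨N, hN⟩ := hY b x
  have hw1 : ∀ p q, N ≤ q → Y p (vac : V) (Y q b x) = 0 := fun p q h => by rw [hN q h, map_zero]
  have hw2 : ∀ p q : ℤ, N ≤ q → (if p = -1 then Y q b x else 0) = 0 := fun p q h => by
    rw [hN q h, ite_self]
  -- Both double sequences have the same alternating sums, which determine them by inversion.
  have hc : ∀ L n, altSum (fun p q => Y p (vac : V) (Y q b x)) L d n
      = altSum (fun p q => if p = -1 then Y q b x else 0) L d n := by
    intro L n
    have h1 := h L n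
    unfold Bor at h1
    rw [borR_eq_altSum_of_trunc hY hv] at h1
    rw [← h1, altSum_vacuum_left, borL]
    split_ifs with h2
    · rcases lt_or_ge L 0 with hL | hL
      · rw [finsum_eq_single _ (-1 - L).toNat]
        · rw [VertexAlgebra.vacuum, if_pos (by omega), intChoose_neg L, ← mul_assoc, ← mul_pow,
            show ((d + L + 1).toNat : ℤ) - L - 1 = d by omega]
          have hd1 : Ring.choose d (-1 - L).toNat = Ring.choose d (d + L + 1).toNat := by
            lift d to ℕ using hd
            have e1 : Ring.choose (d : ℤ) (-1 - L).toNat = (d.choose (-1 - L).toNat : ℤ) :=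
              Ring.choose_natCast _ _
            have e2 : Ring.choose (d : ℤ) (d + L + 1).toNat = (d.choose (d + L + 1).toNat : ℤ) :=
              Ring.choose_natCast _ _
            rw [e1, e2, Nat.choose_symm_of_eq_add
              (by omega : d = (-1 - L).toNat + ((d : ℤ) + L + 1).toNat)]
          rw [hd1, show d + n - ((-1 - L).toNat : ℤ) = n + d + L + 1 by omega]
          simp
        · intro i hi
          rw [VertexAlgebra.vacuum, if_neg (by omega)]
          simp
      · have e1 : Ring.choose L (d + L + 1).toNat * (-1) ^ (d + L + 1).toNat = 0 := by
          rw [mul_comm, intChoose_neg L, ← mul_assoc, ← mul_pow,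
            show ((d + L + 1).toNat : ℤ) - L - 1 = (d.toNat : ℤ) by omega]
          have e2 : Ring.choose (d.toNat : ℤ) (d + L + 1).toNat
              = (d.toNat.choose (d + L + 1).toNat : ℤ) := Ring.choose_natCast _ _
          rw [e2, Nat.choose_eq_zero_of_lt (by omega)]
          simp
        rw [mul_comm, e1, zero_smul]
        refine finsum_eq_zero_of_forall_eq_zero fun i => ?_
        rw [VertexAlgebra.vacuum, if_neg (by omega)]
        simp
    · refine finsum_eq_zero_of_forall_eq_zero fun i => ?_
      rw [VertexAlgebra.vacuum]
      split_ifs with h3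
      · have e2 : Ring.choose (d.toNat : ℤ) i = (d.toNat.choose i : ℤ) := Ring.choose_natCast _ _
        rw [show d = (d.toNat : ℤ) by omega, e2, Nat.choose_eq_zero_of_lt (by omega)]
        simp
      · simp
  have hinv : ∀ w : ℤ → ℤ → X, (∀ p q, N ≤ q → w p q = 0) → w p q
      = ∑ i ∈ Finset.range (N - q).toNat, (Ring.choose (p - d) i : ℤ) •
        altSum w (p - d - i) d (q + i) := by
    intro w hw
    have := binomial_inversion (w := fun L n => w (d + L) n) (c := fun L n => altSum w L d n)
      (N := N) (ε := -1) (fun L n h => hw _ _ h)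
      (fun L n R hR => by
        rw [altSum_eq_sum hw hR]
        refine Finset.sum_congr rfl fun i _ => ?_
        rw [add_sub_assoc]) (p - d) q (N - q).toNat (by omega)
    simpa using this
  rw [hinv _ hw1, hinv _ hw2]
  simp only [hc]

end WeakAssociativity

section ModuleS

variable {V : Type u} [AddCommGroup V] [Module ℂ V] [NGradedVertexAlgebra V]
variable (M : ZhuMod.{u, v} V)

theorem modeS_eq_zero {M : ZhuMod.{u, v} V} {k m d : ℤ} {a : V} {x : SM M}
    (ha : a ∈ gr (V := V) k) (hx : x ∈ gradS M d) (h : k + d ≤ m) : modeS M m a x = 0 := by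
  obtain ⟨y, hy, rfl⟩ := wordDeg_le_map (Y := modeS1 M) (e := inclS1 M)
    ((subJ M).mkQ.restrictScalars ℂ) (fun _ => rfl) (fun _ _ _ => rfl) d hx
  obtain ⟨z, hz, rfl⟩ := wordDeg_le_map (Y := modeTM M) (e := incl (TV V) M)
    ((subI M).mkQ.restrictScalars ℂ) (fun _ => rfl) (fun _ _ _ => rfl) d hy
  have h1 : gen m a • z ∈ subI M :=
    Submodule.subset_span (.neg k m d a z ha hz (by omega))
  have h2 : (subI M).mkQ (gen m a • z) = 0 := (Submodule.Quotient.mk_eq_zero _).2 h1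
  exact (congrArg (subJ M).mkQ h2).trans (map_zero _)

theorem gradS_neg {M : ZhuMod.{u, v} V} {d : ℤ} (hd : d < 0) {x : SM M} (hx : x ∈ gradS M d) :
    x = 0 := by
  have : gradS M d ≤ ⊥ := by
    refine Submodule.span_le.2 fun z hz => ?_
    cases hz with
    | base y => omega
    | mode k m d a z ha hz =>
      simpa using modeS_eq_zero ha (Submodule.subset_span hz) (by omega)
  simpa using this hx

theorem isTopMap_inclS : IsTopMap M (modeS M) (inclS M) where
  neg y k n a ha h := modeS_eq_zero ha (Submodule.subset_span (.base y)) (by omega)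
  zero a y := by
    have h1 : zeroMode (modeTM M) a (incl (TV V) M y) - incl (TV V) M (M.ρ (zhuMk V a) y) ∈ subI M :=
      Submodule.subset_span (.zhu a y)
    have h2 : (subI M).mkQ (zeroMode (modeTM M) a (incl (TV V) M y)
      - incl (TV V) M (M.ρ (zhuMk V a) y)) = 0 := (Submodule.Quotient.mk_eq_zero _).2 h1
    rw [map_sub, sub_eq_zero] at h2
    have h3 := congrArg (subJ M).mkQ h2
    have h4 := zeroMode_map (Y := modeTM M) (Y' := modeS M)
      ((subJ M).mkQ.restrictScalars ℂ ∘ₗ (subI M).mkQ.restrictScalars ℂ) (fun _ _ _ => rfl) a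
      (incl (TV V) M y)
    exact h3.symm.trans h4

theorem lowerTruncated_modeS : LowerTruncated (modeS M) :=
  lowerTruncated_of_words (generates_S M) fun k d _ _ ha hx =>
    ⟨k + d, fun _ hn => modeS_eq_zero ha hx hn⟩

/-- The relations defining `S(M)` are equivalent to weak associativity. -/
theorem weakAssoc_modeS {k l d : ℤ} {a b : V} {x : SM M} (ha : a ∈ gr (V := V) k)
    (hb : b ∈ gr (V := V) l) (hx : x ∈ gradS M d) (L n : ℤ) :
    Bor (modeS M) a b x L (k + d) n := by
  rcases lt_or_ge k 0 with hk | hk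
  · rw [eq_zero_of_mem_gr_neg ha hk]; exact Bor.zero_left _ _ _ _ _
  rcases lt_or_ge d 0 with h0 | h0
  · rw [gradS_neg h0 hx]; exact Bor.zero_right _ _ _ _ _
  refine bor_of_product_eq_sum (N := l + d) (lowerTruncated_modeS M)
    (fun n hn => modeS_eq_zero ha hx hn) (fun n hn => modeS_eq_zero hb hx hn) ?_ ?_ L n
  · intro L n hn
    obtain ⟨y, hy, rfl⟩ := wordDeg_le_map (Y := modeS1 M) (e := inclS1 M)
      ((subJ M).mkQ.restrictScalars ℂ) (fun _ => rfl) (fun _ _ _ => rfl) d hx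
    have h1 := Submodule.subset_span (s := {x | RelJ M x}) (R := TV V)
      (RelJ.mk k l d (n - l + L + 2 + d) L a b y ha hb hy (by omega))
    have h2 := (Submodule.Quotient.mk_eq_zero (subJ M)).2 h1
    rw [borL_eq_sum_of_nonneg (by omega)]
    refine Eq.trans ?_ h2
    change _ = (subJ M).mkQ _
    simp only [map_sum, map_zsmul]
    refine Finset.sum_congr rfl fun j _ => ?_
    rw [show n - l + L + 2 + d + k + l - (j : ℤ) - L - 2 = k + d + n - j by ring, add_comm (j : ℤ)]
    rfl
  · intro p q hq
    rcases lt_or_ge (k - p - 1 + (l - q - 1) + d) 0 with hneg | hnn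
    · have h1 : modeS M p a (modeS M q b x) = 0 :=
        gradS_neg hneg (by
          have := mode_mem_wordDeg (m := p) ha (mode_mem_wordDeg (m := q) hb hx)
          rwa [← add_assoc] at this)
      rw [h1]
      refine (Finset.sum_eq_zero fun i _ => ?_).symm
      rw [borL_eq_sum_of_nonneg (by omega), Finset.sum_eq_zero, smul_zero]
      intro j _
      rw [modeS_eq_zero (mode_mem _ _ _ _ _ ha hb) hx (by omega), smul_zero]
    · obtain ⟨y, hy, rfl⟩ := wordDeg_le_map (Y := modeS1 M) (e := inclS1 M)
        ((subJ M).mkQ.restrictScalars ℂ) (fun _ => rfl) (fun _ _ _ => rfl) d hx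
      obtain ⟨z, hz, rfl⟩ := wordDeg_le_map (Y := modeTM M) (e := incl (TV V) M)
        ((subI M).mkQ.restrictScalars ℂ) (fun _ => rfl) (fun _ _ _ => rfl) d hy
      have h1 := Submodule.subset_span (s := {x | RelI M x}) (R := TV V)
        (RelI.assoc k l d p q a b z ha hb hz hq hnn)
      have h2 := (Submodule.Quotient.mk_eq_zero (subI M)).2 h1
      change (subI M).mkQ _ = 0 at h2
      rw [map_sub, sub_eq_zero] at h2
      have h3 := congrArg (subJ M).mkQ h2
      refine h3.trans ?_
      simp only [map_sum, map_zsmul]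
      refine Finset.sum_congr rfl fun i _ => ?_
      rw [borL_eq_sum_of_nonneg (by omega), Finset.smul_sum]
      refine Finset.sum_congr rfl fun j _ => ?_
      rw [smul_smul, ← sub_sub p k d, show k + d + (q + i) - (j : ℤ) = q + k + d + i - j by ring]
      rfl

theorem vacuum_modeS (n : ℤ) (x : SM M) :
    modeS M n (vac : V) x = if n = -1 then x else 0 := by
  have hmode : ∀ (k d m : ℤ) (b : V) (x : SM M), b ∈ gr (V := V) k → x ∈ gradS M d →
      modeS M n (vac : V) (modeS M m b x) = if n = -1 then modeS M m b x else 0 := by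
    intro k d m b x hb hx
    rcases lt_or_ge d 0 with h0 | h0
    · rw [gradS_neg h0 hx]; simp
    · refine vac_of_weakAssoc (lowerTruncated_modeS M) h0
        (fun n hn => modeS_eq_zero vac_mem_gr hx (by omega)) (fun l n => ?_) n m
      simpa using weakAssoc_modeS M vac_mem_gr hb hx l n
  refine iSup_induction_wordDeg (generates_S M)
    (p := fun x => modeS M n (vac : V) x = if n = -1 then x else 0) (by simp)
    (fun x y hx hy => by rw [map_add, hx, hy]; split_ifs <;> simp) (fun d x hx => ?_) x
  induction hx using Submodule.span_induction with
  | zero => simp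
  | add x y _ _ hx hy => rw [map_add, hx, hy]; split_ifs <;> simp
  | smul c x _ hx => rw [map_smul, hx]; split_ifs <;> simp
  | mem x hx =>
    cases hx with
    | base y =>
      have h1 := (isTopMap_inclS M).zero vac y
      rw [M.map_one, zeroMode, byWeight_of_mem _ vac_mem_gr, zero_sub] at h1
      have h2 := hmode 0 0 (-1) vac _ vac_mem_gr (Submodule.subset_span (.base y))
      rw [← h1] at h2
      exact h2
    | mode k m d a x ha hx => exact hmode k d m a x ha (Submodule.subset_span hx)

theorem isWeakModule_modeS : IsWeakModule (modeS M) :=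
  isWeakModule_of_weakAssoc (generates_S M) (lowerTruncated_modeS M) (vacuum_modeS M)
    fun _ _ _ _ _ _ ha hb hx => weakAssoc_modeS M ha hb hx

end ModuleS


/-! ### The universal property of `M̄₀(M)` -/

section LiftMbar

variable {V : Type u} [AddCommGroup V] [Module ℂ V] [NGradedVertexAlgebra V]
variable {X : Type w} [AddCommGroup X] [Module ℂ X] {Y : ℤ → V →ₗ[ℂ] X →ₗ[ℂ] X}

theorem borR_zero_left (a b : V) (x : X) (m n : ℤ) :
    borR Y a b x 0 m n = Y m a (Y n b x) - Y n b (Y m a x) := by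
  rw [borR, finsum_eq_sum_range (N := 1)]
  · simp
  · intro i hi
    rw [Ring.choose_zero_pos ℤ (by omega : 0 < i)]; simp

theorem liftTV_hatRel (hD : HasDerivProperty Y) (hC : ∀ a b x m n, Bor Y a b x 0 m n)
    {s t : TV V} (h : HatRel s t) : liftTV Y s = liftTV Y t := by
  cases h with
  | deriv a m =>
    rw [map_zsmul, liftTV_gen, liftTV_gen]
    exact LinearMap.ext fun x => hD a m x
  | bracket a b m n =>
    obtain ⟨N, hN⟩ := exists_mode_eq_zero a b 0
    have hN' : ∀ i : ℕ, N ≤ i → mode (i : ℤ) a b = 0 := fun i hi => by simpa using hN i hi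
    rw [finsum_eq_sum_range (N := N) (fun i hi => by rw [hN' i hi, map_zero, smul_zero])]
    simp only [map_mul, map_add, map_sum, map_zsmul, liftTV_gen]
    refine LinearMap.ext fun x => ?_
    have h1 := hC a b x m n
    unfold Bor at h1
    rw [borL_eq_sum hN, borR_zero_left] at h1
    simp only [zero_add] at h1
    simp only [Module.End.mul_apply, LinearMap.add_apply, LinearMap.sum_apply, LinearMap.smul_apply]
    rw [h1]
    abel

/-- The representation of `U(V̂)` in which `a(m)` acts as `Y m a`. -/
def liftUHat (hD : HasDerivProperty Y) (hC : ∀ a b x m n, Bor Y a b x 0 m n) :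
    UHat V →ₐ[ℂ] Module.End ℂ X :=
  (RingQuot.liftAlgHom ℂ ⟨liftTV Y, fun _ _ h => liftTV_hatRel hD hC h⟩ :
    RingQuot (HatRel (V := V)) →ₐ[ℂ] Module.End ℂ X)

theorem liftUHat_hatGen (hD : HasDerivProperty Y) (hC : ∀ a b x m n, Bor Y a b x 0 m n) (m : ℤ)
    (a : V) : liftUHat hD hC (hatGen m a) = Y m a :=
  (RingQuot.liftAlgHom_mkAlgHom_apply ℂ (liftTV Y)
    (fun _ _ h => liftTV_hatRel hD hC h) (gen m a)).trans (liftTV_gen Y m a)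

/-- The relations defining `M̄₀(M)` are Borcherds' identity for indices `(l, wt a, n)`. -/
theorem relW_eq_borR_sub_borL (hY : LowerTruncated Y) {a b : V} {x : X} {k l : ℤ} (hk : 0 ≤ k)
    (ha : ∀ n, k ≤ n → Y n a x = 0) (hb : ∀ n, l ≤ n → Y n b x = 0) (r s : ℤ) :
    ∑ i ∈ Finset.range (l + s + 1).toNat, (Ring.choose (r + i) i : ℤ) •
        Y (k - 1 - i - r) a (Y (i - s - 1) b x)
      - ∑ j ∈ Finset.range (k.toNat + 1), (Ring.choose k j : ℤ) •
          Y (k - j - s - 1) (mode (j - r - 1) a b) x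
      = borR Y a b x (-r - 1) k (-s - 1) - borL Y a b x (-r - 1) k (-s - 1) := by
  have hw : ∀ p q, l ≤ q → Y p a (Y q b x) = 0 := fun p q h => by rw [hb q h, map_zero]
  rw [borR_eq_altSum_of_trunc hY ha, borL_eq_sum_of_nonneg hk,
    altSum_eq_sum hw (R := (l + s + 1).toNat) (by omega),
    show (k + 1).toNat = k.toNat + 1 by omega]
  congr 1
  · refine Finset.sum_congr rfl fun i _ => ?_
    rw [intChoose_neg (-r - 1), ← mul_assoc, ← mul_pow,
      show (i : ℤ) - (-r - 1) - 1 = r + i by ring, show k + (-r - 1) - (i : ℤ) = k - 1 - i - r by ring,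
      show -s - 1 + (i : ℤ) = i - s - 1 by ring]
    simp
  · refine Finset.sum_congr rfl fun j _ => ?_
    rw [show k + (-s - 1) - (j : ℤ) = k - j - s - 1 by ring,
      show -r - 1 + (j : ℤ) = j - r - 1 by ring]

variable {M : ZhuMod.{u, v} V} {f : M →ₗ[ℂ] X}

/-- Maps out of `M̄₀(M)`: the target has to be a module for the Lie algebra `V̂`, and weak
associativity is only needed on the image of `M`. -/
theorem exists_lift_Mbar (hY : LowerTruncated Y) (hD : HasDerivProperty Y)
    (hC : ∀ a b x m n, Bor Y a b x 0 m n) (hf : IsTopMap M Y f)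
    (hB : ∀ (k l : ℤ) (a b : V) (y : M), a ∈ gr (V := V) k → b ∈ gr (V := V) l →
      ∀ p q, Bor Y a b (f y) p k q) :
    ∃ g : MbarM M →ₗ[ℂ] X, (∀ y, g (inclMbar M y) = f y) ∧
      ∀ (n : ℤ) (a : V) (x : MbarM M), g (modeMbar M n a x) = Y n a (g x) := by
  have hF := liftTensor_smul (liftUHat hD hC) f
  have hs : ∀ (n : ℤ) (a : V) (z : UHat V ⊗[ℂ] M), liftTensor (liftUHat hD hC) f (hatGen n a • z)
      = Y n a (liftTensor (liftUHat hD hC) f z) := fun n a z => by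
    rw [liftTensor_smul, liftUHat_hatGen]
  have h0 : ∀ z ∈ {x | RelInd M x}, liftTensor (liftUHat hD hC) f z = 0 := by
    intro z hz
    cases hz with
    | neg k m a y ha h => rw [hs, liftTensor_incl, hf.neg y k m a ha (by omega)]
    | zero a y =>
      rw [map_sub, zeroMode_map (Y' := Y) (liftTensor (liftUHat hD hC) f) hs, liftTensor_incl,
        liftTensor_incl, hf.zero, sub_self]
  have h1 := eq_zero_of_mem_span hF h0
  have hG := liftQuot_smul (N := subInd M) (h := h1) hF
  have hG1 : ∀ y, liftQuot (subInd M) _ h1 (inclInd M y) = f y := fun y =>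
    (liftQuot_mk (subInd M) _ h1 _).trans (liftTensor_incl _ _ _)
  have h3 : ∀ z ∈ {x | RelW M x}, liftQuot (subInd M) _ h1 z = 0 := by
    intro z hz
    cases hz with
    | mk k l r s a b y ha hb =>
      simp only [map_sub, map_sum, map_zsmul, hG, hG1, liftUHat_hatGen]
      rcases lt_or_ge k 0 with hk | hk
      · rw [eq_zero_of_mem_gr_neg ha hk]; simp
      rw [relW_eq_borR_sub_borL hY hk (fun n hn => hf.neg y k n a ha hn)
        (fun n hn => hf.neg y l n b hb hn), sub_eq_zero]
      exact (hB k l a b y ha hb _ _).symm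
  have h2 := eq_zero_of_mem_span hG h3
  refine ⟨liftQuot (subW M) _ h2, fun y => (liftQuot_mk (subW M) _ h2 _).trans (hG1 y), ?_⟩
  intro n a x
  have := liftQuot_smul (N := subW M) (h := h2) hG (hatGen n a) x
  rwa [liftUHat_hatGen] at this

theorem IsWeakModule.exists_lift_Mbar (hY : IsWeakModule Y) (hf : IsTopMap M Y f) :
    ∃ g : MbarM M →ₗ[ℂ] X, (∀ y, g (inclMbar M y) = f y) ∧
      ∀ (n : ℤ) (a : V) (x : MbarM M), g (modeMbar M n a x) = Y n a (g x) :=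
  ZhuInduction.exists_lift_Mbar hY.trunc hY.deriv (fun _ _ _ _ _ => hY.bor _ _ _ _ _ _) hf
    fun _ _ _ _ _ _ _ _ _ => hY.bor _ _ _ _ _ _

variable (V) in
/-- The projection of the tensor algebra onto `U(V̂)`. -/
def mkUHat : TV V →ₐ[ℂ] UHat V :=
  (RingQuot.mkAlgHom ℂ (HatRel (V := V)) : TV V →ₐ[ℂ] RingQuot (HatRel (V := V)))

variable (V) in
theorem mkUHat_surjective : Function.Surjective (mkUHat V) :=
  RingQuot.mkAlgHom_surjective ℂ (HatRel (V := V))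

theorem mkUHat_gen (m : ℤ) (a : V) : mkUHat V (gen m a) = hatGen m a := rfl

theorem adjoin_hatGen : Algebra.adjoin ℂ {x : UHat V | ∃ m a, x = hatGen m a} = ⊤ := by
  rw [eq_top_iff]
  intro x _
  obtain ⟨t, rfl⟩ := mkUHat_surjective V x
  exact TV_induction (C := fun t => mkUHat V t
      ∈ Algebra.adjoin ℂ {x : UHat V | ∃ m a, x = hatGen m a})
    (fun r => by rw [AlgHom.commutes]; exact Subalgebra.algebraMap_mem _ r)
    (fun m a => Algebra.subset_adjoin ⟨m, a, rfl⟩)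
    (fun _ _ hx hy => by rw [map_mul]; exact Subalgebra.mul_mem _ hx hy)
    (fun _ _ hx hy => by rw [map_add]; exact Subalgebra.add_mem _ hx hy) t

theorem generates_Mbar (M : ZhuMod.{u, v} V) : Generates (modeMbar M) (inclMbar M) := by
  intro N hi hN
  have h1 : N.comap ((subW M).mkQ.restrictScalars ℂ ∘ₗ (subInd M).mkQ.restrictScalars ℂ) = ⊤ :=
    eq_top_of_adjoin adjoin_hatGen hi fun m a z hz => hN m a _ hz
  rw [eq_top_iff]
  intro x _
  obtain ⟨y, rfl⟩ := (subW M).mkQ_surjective x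
  obtain ⟨z, rfl⟩ := (subInd M).mkQ_surjective y
  have : z ∈ N.comap ((subW M).mkQ.restrictScalars ℂ ∘ₗ (subInd M).mkQ.restrictScalars ℂ) := by
    rw [h1]; trivial
  exact this

end LiftMbar

/-! ### `M̄₀(M)` is a module for the vertex algebra -/

section Extension

variable {V : Type*} [AddCommGroup V] [Module ℂ V] [VertexAlgebra V]
variable {X : Type*} [AddCommGroup X] [Module ℂ X] {Y : ℤ → V →ₗ[ℂ] X →ₗ[ℂ] X}

theorem commutator_eq_sum (hC : ∀ a b x m n, Bor Y a b x 0 m n) {a b : V} {N : ℕ}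
    (hN : ∀ i : ℕ, N ≤ i → mode (i : ℤ) a b = 0) (m n : ℤ) (x : X) :
    Y m a (Y n b x) = Y n b (Y m a x)
      + ∑ i ∈ Finset.range N, (Ring.choose m i : ℤ) • Y (m + n - i) (mode (i : ℤ) a b) x := by
  have h1 := hC a b x m n
  have hN' : ∀ i : ℕ, N ≤ i → mode (0 + i : ℤ) a b = 0 := fun i hi => by simpa using hN i hi
  unfold Bor at h1
  rw [borL_eq_sum hN', borR, finsum_eq_sum_range (N := 1)] at h1
  · simp only [zero_add] at h1
    rw [h1]
    simp
  · intro i hi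
    rw [Ring.choose_zero_pos ℤ (by omega : 0 < i)]; simp

theorem eventually_borR_eq_sum (hY : LowerTruncated Y) (a b : V) (x : X) (m n : ℤ) :
    ∀ᶠ R : ℕ in Filter.atTop, ∀ l, borR Y a b x l m n
      = ∑ i ∈ Finset.range R, ((-1 : ℤ) ^ i * Ring.choose l i) •
          (Y (m + l - i) a (Y (n + i) b x)
            - (l.negOnePow : ℤ) • Y (n + l - i) b (Y (m + i) a x)) := by
  obtain ⟨R₁, h1⟩ := exists_nat_forall_eq_zero (hY a x) m
  obtain ⟨R₂, h2⟩ := exists_nat_forall_eq_zero (hY b x) n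
  filter_upwards [Filter.eventually_ge_atTop (max R₁ R₂)] with R hR l
  refine finsum_eq_sum_range fun i hi => ?_
  rw [h1 i (by omega), h2 i (by omega)]
  simp

theorem eventually_mode_eq_zero (a b : V) (l : ℤ) :
    ∀ᶠ R : ℕ in Filter.atTop, ∀ i : ℕ, R ≤ i → mode (l + i) a b = 0 := by
  obtain ⟨N, hN⟩ := exists_mode_eq_zero a b l
  filter_upwards [Filter.eventually_ge_atTop N] with R hR i hi using hN i (hR.trans hi)

theorem commutator_mode_mode (hC : ∀ a b x m n, Bor Y a b x 0 m n) {a b c : V} {J : ℕ}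
    (ha : ∀ j : ℕ, J ≤ j → mode (j : ℤ) c a = 0) (hb : ∀ j : ℕ, J ≤ j → mode (j : ℤ) c b = 0)
    (x : X) (p q r : ℤ) :
    Y p c (Y r a (Y q b x)) = Y r a (Y q b (Y p c x))
      + ∑ j ∈ Finset.range J, (Ring.choose p j : ℤ) •
        (Y (p + r - j) (mode (j : ℤ) c a) (Y q b x)
          + Y r a (Y (p + q - j) (mode (j : ℤ) c b) x)) := by
  rw [commutator_eq_sum hC ha, commutator_eq_sum hC hb, map_add, map_sum, add_assoc,
    ← Finset.sum_add_distrib]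
  congr 1
  refine Finset.sum_congr rfl fun j _ => ?_
  rw [map_zsmul, smul_add, add_comm]

/-- The commutator of a mode with the product side of Borcherds' identity. -/
theorem mode_borR (hY : LowerTruncated Y) (hC : ∀ a b x m n, Bor Y a b x 0 m n) {a b c : V} {J : ℕ}
    (ha : ∀ j : ℕ, J ≤ j → mode (j : ℤ) c a = 0) (hb : ∀ j : ℕ, J ≤ j → mode (j : ℤ) c b = 0)
    (x : X) (l m n p : ℤ) :
    Y p c (borR Y a b x l m n) = borR Y a b (Y p c x) l m n
      + ∑ j ∈ Finset.range J, (Ring.choose p j : ℤ) •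
        (borR Y (mode (j : ℤ) c a) b x l (m + p - j) n
          + borR Y a (mode (j : ℤ) c b) x l m (n + p - j)) := by
  obtain ⟨R, h1, h2, h3, h4⟩ := ((eventually_borR_eq_sum hY a b x m n).and
    ((eventually_borR_eq_sum hY a b (Y p c x) m n).and
    (((Filter.eventually_all_finset (Finset.range J)).2 fun j _ =>
      eventually_borR_eq_sum hY (mode (j : ℤ) c a) b x (m + p - j) n).and
    ((Filter.eventually_all_finset (Finset.range J)).2 fun j _ =>
      eventually_borR_eq_sum hY a (mode (j : ℤ) c b) x m (n + p - j))))).exists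
  rw [h1, h2, Finset.sum_congr (s₁ := Finset.range J) rfl fun j hj => by
    rw [h3 j hj l, h4 j hj l]]
  simp only [← Finset.sum_add_distrib, Finset.smul_sum, map_sum]
  rw [Finset.sum_comm, ← Finset.sum_add_distrib]
  refine Finset.sum_congr rfl fun i _ => ?_
  rw [map_zsmul, map_sub, map_zsmul, commutator_mode_mode hC ha hb, commutator_mode_mode hC hb ha]
  have e : ∀ (κ r : ℤ) (y z : X), r • (κ • y + κ • z) = κ • r • (y + z) := fun κ r y z => by
    rw [← smul_add, smul_comm]
  simp only [e]
  rw [← Finset.smul_sum, ← smul_add]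
  congr 1
  rw [smul_add, Finset.smul_sum, add_sub_add_comm,
    ← Finset.sum_sub_distrib]
  congr 1
  refine Finset.sum_congr rfl fun j _ => ?_
  rw [show p + (m + l - i) - (j : ℤ) = m + p - j + l - i by ring,
    show p + (n + i) - (j : ℤ) = n + p - j + i by ring,
    show p + (n + l - i) - (j : ℤ) = n + p - j + l - i by ring,
    show p + (m + i) - (j : ℤ) = m + p - j + i by ring, smul_comm (l.negOnePow : ℤ), ← smul_sub,
    smul_add (l.negOnePow : ℤ)]
  congr 1
  abel

theorem sum_range_eq_sum_range_sub {g : ℕ → X} {j S : ℕ} (h : j ≤ S) (hg : ∀ s, s < j → g s = 0) :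
    ∑ s ∈ Finset.range S, g s = ∑ t ∈ Finset.range (S - j), g (j + t) := by
  obtain ⟨T, rfl⟩ := Nat.exists_eq_add_of_le h
  rw [Finset.sum_range_add, Finset.sum_eq_zero fun s hs => hg s (Finset.mem_range.1 hs), zero_add,
    Nat.add_sub_cancel_left]

/-- The commutator of a mode with the iterate side of Borcherds' identity. -/
theorem mode_borL (hC : ∀ a b x m n, Bor Y a b x 0 m n) {a b c : V} {J : ℕ}
    (ha : ∀ j : ℕ, J ≤ j → mode (j : ℤ) c a = 0) (hb : ∀ j : ℕ, J ≤ j → mode (j : ℤ) c b = 0)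
    (x : X) (l m n p : ℤ) :
    Y p c (borL Y a b x l m n) = borL Y a b (Y p c x) l m n
      + ∑ j ∈ Finset.range J, (Ring.choose p j : ℤ) •
        (borL Y (mode (j : ℤ) c a) b x l (m + p - j) n
          + borL Y a (mode (j : ℤ) c b) x l m (n + p - j)) := by
  obtain ⟨R, hR⟩ := ((Filter.eventually_all_finset (Finset.range J)).2 fun j _ =>
      eventually_mode_eq_zero (mode (j : ℤ) c a) b l).exists
  obtain ⟨I, hI1, hI2, hIR⟩ := ((eventually_mode_eq_zero a b l).and
    (((Filter.eventually_all_finset (Finset.range J)).2 fun j _ =>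
      eventually_mode_eq_zero a (mode (j : ℤ) c b) l).and (Filter.eventually_ge_atTop R))).exists
  obtain ⟨S, hS1, hS2⟩ := (((Filter.eventually_all_finset (Finset.range I)).2 fun i _ =>
      eventually_mode_eq_zero c (mode (l + i) a b) 0).and
        (Filter.eventually_ge_atTop (J + R))).exists
  -- The part of the double sum in which `c` has been commuted past `a`
  have hfst : ∀ j ∈ Finset.range J, borL Y (mode (j : ℤ) c a) b x l (m + p - j) n
      = ∑ i ∈ Finset.range I, ∑ t ∈ Finset.range (S - j),
        (Ring.choose m i * Ring.choose (p - j) t : ℤ) •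
          Y (m + p + n - j - (i + t : ℕ)) (mode (l + (i + t : ℕ)) (mode (j : ℤ) c a) b) x := by
    intro j hj
    have hj' := Finset.mem_range.1 hj
    rw [sum_choose_sum_choose m (p - j) (fun r : ℕ =>
      Y (m + p + n - j - r) (mode (l + r) (mode (j : ℤ) c a) b) x) (R := R)
      (fun r hr => by rw [hR j hj r hr, map_zero, LinearMap.zero_apply]) hIR (by omega),
      borL_eq_sum (hR j hj)]
    refine Finset.sum_congr rfl fun r _ => ?_
    rw [add_sub_assoc m p, show m + (p - j) + n - (r : ℤ) = m + p + n - j - r by ring]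
  have hsnd : ∀ j ∈ Finset.range J, borL Y a (mode (j : ℤ) c b) x l m (n + p - j)
      = ∑ i ∈ Finset.range I, (Ring.choose m i : ℤ) •
          Y (m + (n + p - j) - i) (mode (l + i) a (mode (j : ℤ) c b)) x :=
    fun j hj => borL_eq_sum (hI2 j hj) _ _ _
  rw [Finset.sum_congr rfl fun j hj => by rw [hfst j hj, hsnd j hj],
    borL_eq_sum hI1, borL_eq_sum hI1]
  simp only [← Finset.sum_add_distrib, Finset.smul_sum, map_sum]
  rw [Finset.sum_comm, ← Finset.sum_add_distrib]
  refine Finset.sum_congr rfl fun i hi => ?_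
  have hS' : ∀ s : ℕ, S ≤ s → mode (s : ℤ) c (mode (l + i) a b) = 0 := fun s hs => by
    simpa using hS1 i hi s hs
  rw [map_zsmul, commutator_eq_sum hC hS', smul_add, Finset.smul_sum]
  congr 1
  have hV : ∀ s : ℕ, mode (s : ℤ) c (mode (l + i) a b) = mode (l + i) a (mode (s : ℤ) c b)
      + ∑ j ∈ Finset.range J, (Ring.choose (s : ℤ) j : ℤ) •
        mode (s + (l + i) - j) (mode (j : ℤ) c a) b := fun s =>
    commutator_eq_sum (fun a b x m n => (isWeakModule_mode V).bor a b x 0 m n) ha _ _ _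
  simp only [hV, map_add, LinearMap.add_apply, map_sum, LinearMap.sum_apply, map_zsmul,
    LinearMap.smul_apply, smul_add, Finset.sum_add_distrib, Finset.smul_sum]
  rw [add_comm]
  congr 1
  · rw [Finset.sum_comm]
    refine Finset.sum_congr rfl fun j hj => ?_
    have hj' := Finset.mem_range.1 hj
    rw [sum_range_eq_sum_range_sub (j := j) (by omega)]
    · refine Finset.sum_congr rfl fun t _ => ?_
      rw [smul_smul, smul_smul, smul_smul,
        show p + (m + n - i) - ((j + t : ℕ) : ℤ) = m + p + n - j - (i + t : ℕ) by push_cast; ring,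
        show ((j + t : ℕ) : ℤ) + (l + i) - j = l + (i + t : ℕ) by push_cast; ring]
      congr 1
      have e1 : Ring.choose ((j + t : ℕ) : ℤ) j = ((j + t).choose j : ℤ) := Ring.choose_natCast _ _
      have e2 := choose_mul_choose_sub p j t
      rw [e1]
      linear_combination (-Ring.choose m i) * e2
    · intro s hs
      have e1 : Ring.choose (s : ℤ) j = (s.choose j : ℤ) := Ring.choose_natCast _ _
      rw [e1, Nat.choose_eq_zero_of_lt hs]
      simp
  · symm
    refine Finset.sum_subset_zero_on_sdiff (Finset.range_mono (by omega)) ?_ ?_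
    · intro s hs
      simp only [Finset.mem_sdiff, Finset.mem_range] at hs
      rw [hb s (by omega)]
      simp
    · intro s _
      rw [smul_comm, show p + (m + n - i) - (s : ℤ) = m + (n + p - s) - i by ring]

/-- Given the commutator formula, the vectors for which Borcherds' identity holds are stable under
all modes. -/
theorem Bor.mode (hY : LowerTruncated Y) (hC : ∀ a b x m n, Bor Y a b x 0 m n) {x : X}
    (hx : ∀ a b l m n, Bor Y a b x l m n) (p : ℤ) (c a b : V) (l m n : ℤ) :
    Bor Y a b (Y p c x) l m n := by
  obtain ⟨J₁, h1⟩ := exists_mode_eq_zero c a 0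
  obtain ⟨J₂, h2⟩ := exists_mode_eq_zero c b 0
  have ha : ∀ j : ℕ, max J₁ J₂ ≤ j → VertexAlgebra.mode (j : ℤ) c a = 0 := fun j hj => by
    simpa using h1 j (by omega)
  have hb : ∀ j : ℕ, max J₁ J₂ ≤ j → VertexAlgebra.mode (j : ℤ) c b = 0 := fun j hj => by
    simpa using h2 j (by omega)
  have e1 := mode_borL hC ha hb x l m n p
  have e2 := mode_borR hY hC ha hb x l m n p
  unfold Bor at *
  rw [hx] at e1
  simp only [hx] at e1
  rw [e1] at e2
  exact add_right_cancel e2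

end Extension


section ModuleMbar

variable {V : Type u} [AddCommGroup V] [Module ℂ V] [NGradedVertexAlgebra V]
variable (M : ZhuMod.{u, v} V)

theorem mkUHat_eq_of_hatRel {s t : TV V} (h : HatRel s t) : mkUHat V s = mkUHat V t :=
  RingQuot.mkAlgHom_rel ℂ h

theorem hasDerivProperty_modeMbar : HasDerivProperty (modeMbar M) := by
  intro a n x
  have h := mkUHat_eq_of_hatRel (HatRel.deriv a n)
  rw [map_zsmul, mkUHat_gen, mkUHat_gen] at h
  simp only [modeMbar, act_apply]
  rw [h, smul_assoc]

theorem commutator_modeMbar (a b : V) (x : MbarM M) (m n : ℤ) :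
    Bor (modeMbar M) a b x 0 m n := by
  obtain ⟨N, hN⟩ := exists_mode_eq_zero a b 0
  have hN' : ∀ i : ℕ, N ≤ i → mode (i : ℤ) a b = 0 := fun i hi => by simpa using hN i hi
  have h := mkUHat_eq_of_hatRel (HatRel.bracket a b m n)
  rw [finsum_eq_sum_range (N := N) (fun i hi => by rw [hN' i hi, map_zero, smul_zero])] at h
  simp only [map_mul, map_add, map_sum, map_zsmul, mkUHat_gen] at h
  unfold Bor
  rw [borL_eq_sum hN, borR_zero_left]
  simp only [modeMbar, act_apply, zero_add]
  rw [← mul_smul, ← mul_smul, h, add_smul, Finset.sum_smul, add_sub_cancel_left]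
  simp only [smul_assoc]

theorem isTopMap_inclMbar : IsTopMap M (modeMbar M) (inclMbar M) where
  neg y k n a ha h := by
    have h1 : hatGen n a • incl (UHat V) M y ∈ subInd M :=
      Submodule.subset_span (.neg k n a y ha (by omega))
    have h2 : (subInd M).mkQ (hatGen n a • incl (UHat V) M y) = 0 :=
      (Submodule.Quotient.mk_eq_zero _).2 h1
    exact (congrArg (subW M).mkQ h2).trans (map_zero _)
  zero a y := by
    have h1 : zeroMode (act hatGen (UHat V ⊗[ℂ] M)) a (incl (UHat V) M y)
        - incl (UHat V) M (M.ρ (zhuMk V a) y) ∈ subInd M :=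
      Submodule.subset_span (.zero a y)
    have h2 : (subInd M).mkQ (zeroMode (act hatGen (UHat V ⊗[ℂ] M)) a (incl (UHat V) M y)
        - incl (UHat V) M (M.ρ (zhuMk V a) y)) = 0 := (Submodule.Quotient.mk_eq_zero _).2 h1
    rw [map_sub, sub_eq_zero] at h2
    have h3 := congrArg (subW M).mkQ h2
    have h4 := zeroMode_map (Y := act hatGen (UHat V ⊗[ℂ] M)) (Y' := modeMbar M)
      ((subW M).mkQ.restrictScalars ℂ ∘ₗ (subInd M).mkQ.restrictScalars ℂ) (fun _ _ _ => rfl) a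
      (incl (UHat V) M y)
    exact h3.symm.trans h4

/-- The vectors killed by all high modes contain the image of `M` and, by the commutator formula,
are stable under all modes. -/
theorem lowerTruncated_modeMbar : LowerTruncated (modeMbar M) := by
  have hsup : ∀ {F G : ℤ → MbarM M}, (∀ᶠ n in Filter.atTop, F n = 0) →
      (∀ᶠ n in Filter.atTop, G n = 0) → ∀ᶠ n in Filter.atTop, F n + G n = 0 := by
    intro F G hF hG
    filter_upwards [hF, hG] with n h1 h2
    rw [h1, h2, add_zero]
  let N : Submodule ℂ (MbarM M) :=
    { carrier := {x | ∀ a : V, ∀ᶠ n in Filter.atTop, modeMbar M n a x = 0}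
      zero_mem' := fun a => by simp
      add_mem' := fun hx hy a => by simpa using hsup (hx a) (hy a)
      smul_mem' := fun c x hx a => by
        filter_upwards [hx a] with n hn
        rw [map_smul, hn, smul_zero] }
  have hN : N = ⊤ := by
    refine generates_Mbar M N (fun y a => ?_) (fun m b x hx a => ?_)
    · refine homogeneous_induction
        (p := fun a => ∀ᶠ n in Filter.atTop, modeMbar M n a (inclMbar M y) = 0) (by simp)
        (fun a b ha hb => by simpa using hsup ha hb) (fun k a ha => ?_) a
      filter_upwards [Filter.eventually_ge_atTop k] with n hn
      exact (isTopMap_inclMbar M).neg y k n a ha hn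
    · obtain ⟨R, hR⟩ := exists_mode_eq_zero a b 0
      have h1 : ∀ i ∈ Finset.range R,
          ∀ᶠ n : ℤ in Filter.atTop, modeMbar M (n + m - i) (mode (i : ℤ) a b) x = 0 := by
        intro i _
        have h2 := (Filter.tendsto_atTop_add_const_right Filter.atTop (m - i : ℤ)
          Filter.tendsto_id).eventually (hx (mode (i : ℤ) a b))
        simpa [add_sub_assoc] using h2
      filter_upwards [(Filter.eventually_all_finset (Finset.range R)).2 h1, hx a] with n hn hn'
      rw [commutator_eq_sum (commutator_modeMbar M) (N := R) (fun i hi => by simpa using hR i hi),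
        hn', map_zero, zero_add]
      exact Finset.sum_eq_zero fun i hi => by rw [hn i hi, smul_zero]
  intro a x
  have hx : x ∈ N := by rw [hN]; trivial
  exact Filter.eventually_atTop.1 (hx a)

theorem vacuum_modeMbar (n : ℤ) (x : MbarM M) :
    modeMbar M n (vac : V) x = if n = -1 then x else 0 := by
  split_ifs with hn
  · subst hn
    have hN : LinearMap.ker (modeMbar M (-1) (vac : V) - LinearMap.id) = ⊤ := by
      refine generates_Mbar M _ (fun y => ?_) (fun m b x hx => ?_)
      · have h := (isTopMap_inclMbar M).zero vac y
        rw [M.map_one, zeroMode, byWeight_of_mem _ vac_mem_gr] at h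
        rw [LinearMap.mem_ker, LinearMap.sub_apply, sub_eq_zero]
        exact h.symm
      · rw [LinearMap.mem_ker, LinearMap.sub_apply, sub_eq_zero, LinearMap.id_apply] at hx ⊢
        rw [commutator_eq_sum (commutator_modeMbar M) (N := 0) (fun i _ => by
          rw [VertexAlgebra.vacuum, if_neg (by omega)]), hx]
        simp
    have hx : x ∈ LinearMap.ker (modeMbar M (-1) (vac : V) - LinearMap.id) := by
      rw [hN]; trivial
    rwa [LinearMap.mem_ker, LinearMap.sub_apply, sub_eq_zero] at hx
  -- As `L(-1) 𝟏 = 0`, the derivative property gives `(n + 1) 𝟏ₙ = 0`.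
  · have h := hasDerivProperty_modeMbar M vac (n + 1) x
    rw [VertexAlgebra.vacuum, if_neg (by norm_num), map_zero, LinearMap.zero_apply,
      add_sub_cancel_right, ← Int.cast_smul_eq_zsmul ℂ] at h
    refine (smul_eq_zero.1 h.symm).resolve_left ?_
    exact_mod_cast (by omega : -(n + 1) ≠ 0)

/-- The commutator formula and weak associativity, which is Borcherds' identity for a single value
`k` of the middle index, imply Borcherds' identity for all indices. -/
theorem Bor.of_weakAssoc {X : Type w} [AddCommGroup X] [Module ℂ X] {Y : ℤ → V →ₗ[ℂ] X →ₗ[ℂ] X}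
    (hY : LowerTruncated Y) {a b : V} {x : X} (hC : ∀ m n, Bor Y a b x 0 m n) {k : ℤ}
    (h : ∀ l n, l < 0 → Bor Y a b x l k n) (l m n : ℤ) : Bor Y a b x l m n := by
  rcases le_or_gt 0 l with hl | hl
  · exact Bor.of_nonneg hY hC hl m n
  · obtain ⟨j, rfl⟩ : ∃ j : ℕ, l = -(j : ℤ) := ⟨(-l).toNat, by omega⟩
    clear hl
    induction j generalizing m n with
    | zero => simpa using hC m n
    | succ j ih =>
      refine Bor.of_succ_of_middle hY (fun m n => ?_) (fun n => h _ _ (by push_cast; omega)) m n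
      have := ih m n
      push_cast
      rwa [show -((j : ℤ) + 1) + 1 = -j by ring]

theorem bor_inclMbar (y : M) (a b : V) (l m n : ℤ) : Bor (modeMbar M) a b (inclMbar M y) l m n := by
  have hY := lowerTruncated_modeMbar M
  refine Bor.of_homogeneous hY (fun k k' a b ha hb => ?_) a b
  rcases lt_or_ge k 0 with hk | hk
  · rw [eq_zero_of_mem_gr_neg ha hk]; exact Bor.zero_left _ _ _ _ _
  refine Bor.of_weakAssoc hY (k := k) (fun m n => commutator_modeMbar M a b _ m n)
    (fun l n _ => ?_) l m n
  have h1 := Submodule.subset_span (s := {x | RelW M x}) (R := UHat V)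
    (RelW.mk k k' (-l - 1) (-n - 1) a b y ha hb)
  have h2 := (Submodule.Quotient.mk_eq_zero (subW M)).2 h1
  change (subW M).mkQ _ = 0 at h2
  rw [map_sub, map_sum, map_sum] at h2
  simp only [map_zsmul] at h2
  have h3 := relW_eq_borR_sub_borL hY (x := inclMbar M y) hk
    (fun n hn => (isTopMap_inclMbar M).neg y k n a ha hn)
    (fun n hn => (isTopMap_inclMbar M).neg y k' n b hb hn) (-l - 1) (-n - 1)
  have h4 := h3.symm.trans h2
  rw [sub_eq_zero, show -(-l - 1) - 1 = l by ring, show -(-n - 1) - 1 = n by ring] at h4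
  exact h4.symm

theorem isWeakModule_modeMbar : IsWeakModule (modeMbar M) := by
  have hY := lowerTruncated_modeMbar M
  refine ⟨hY, vacuum_modeMbar M, ?_⟩
  let N : Submodule ℂ (MbarM M) :=
    { carrier := {x | ∀ (a b : V) (l m n : ℤ), Bor (modeMbar M) a b x l m n}
      zero_mem' := fun a b l m n => Bor.zero_right _ _ _ _ _
      add_mem' := fun hx hy a b l m n => Bor.add_right hY (hx a b l m n) (hy a b l m n)
      smul_mem' := fun c x hx a b l m n => Bor.smul_right c (hx a b l m n) }
  have hN : N = ⊤ := generates_Mbar M N (fun y => bor_inclMbar M y)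
    (fun p c x hx => fun a b => Bor.mode hY (commutator_modeMbar M) hx p c a b)
  intro a b x
  have hx : x ∈ N := by rw [hN]; trivial
  exact hx a b

end ModuleMbar

/-! ### The grading -/

section Grading

variable {V : Type u} [AddCommGroup V] [Module ℂ V] [NGradedVertexAlgebra V]
variable {X : Type w} [AddCommGroup X] [Module ℂ X]

/-- The vertex operators twisted by `2^deg`: `aₙ` acts as `2^(wt a - n - 1) aₙ`. -/
def scaleMode (Y : ℤ → V →ₗ[ℂ] X →ₗ[ℂ] X) (n : ℤ) : V →ₗ[ℂ] X →ₗ[ℂ] X :=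
  byWeight fun k => (2 : ℂ) ^ (k - n - 1) • Y n

variable {Y : ℤ → V →ₗ[ℂ] X →ₗ[ℂ] X}

theorem scaleMode_of_mem {k : ℤ} {a : V} (ha : a ∈ gr (V := V) k) (n : ℤ) (x : X) :
    scaleMode Y n a x = (2 : ℂ) ^ (k - n - 1) • Y n a x := by
  rw [scaleMode, byWeight_of_mem _ ha, LinearMap.smul_apply, LinearMap.smul_apply]

theorem isWeakModule_scaleMode (hY : IsWeakModule Y) : IsWeakModule (scaleMode Y) := by
  have ht : LowerTruncated (scaleMode Y) := by
    intro a x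
    refine homogeneous_induction (p := fun a => ∃ N : ℤ, ∀ n ≥ N, scaleMode Y n a x = 0)
      ⟨0, by simp⟩ ?_ (fun k a ha => ?_) a
    · rintro a b ⟨N, hN⟩ ⟨N', hN'⟩
      exact ⟨max N N', fun n hn => by
        rw [map_add, LinearMap.add_apply, hN n (le_of_max_le_left hn),
          hN' n (le_of_max_le_right hn), add_zero]⟩
    · obtain ⟨N, hN⟩ := hY.trunc a x
      exact ⟨N, fun n hn => by rw [scaleMode_of_mem ha, hN n hn, smul_zero]⟩
  refine ⟨ht, fun n x => ?_, fun a b x l m n => ?_⟩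
  · rw [scaleMode_of_mem vac_mem_gr, hY.vacuum]
    split_ifs with h
    · subst h; simp
    · simp
  · refine Bor.of_homogeneous ht (fun k k' a b ha hb => ?_) a b
    have h2 : (2 : ℂ) ≠ 0 := two_ne_zero
    have hL : borL (scaleMode Y) a b x l m n
        = (2 : ℂ) ^ (k + k' - l - m - n - 2) • borL Y a b x l m n := by
      rw [borL, borL, smul_finsum]
      refine finsum_congr fun i => ?_
      rw [scaleMode_of_mem (mode_mem _ _ _ _ _ ha hb), smul_comm]
      congr 2
      ring
    have hR : borR (scaleMode Y) a b x l m n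
        = (2 : ℂ) ^ (k + k' - l - m - n - 2) • borR Y a b x l m n := by
      rw [borR, borR, smul_finsum]
      refine finsum_congr fun i => ?_
      rw [scaleMode_of_mem ha, scaleMode_of_mem hb, scaleMode_of_mem ha, scaleMode_of_mem hb,
        map_smul, map_smul, smul_smul, smul_smul, ← zpow_add₀ h2, ← zpow_add₀ h2,
        smul_comm _ ((-1 : ℤ) ^ i * Ring.choose l i), smul_sub (_ ^ _ : ℂ),
        smul_comm (_ ^ _ : ℂ) (l.negOnePow : ℤ)]
      congr 4 <;> ring_nf
    have := hY.bor a b x l m n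
    unfold Bor at *
    rw [hL, hR, this]

variable {M : ZhuMod.{u, v} V} {e : M →ₗ[ℂ] X}

theorem IsTopMap.scaleMode (h : IsTopMap M Y e) : IsTopMap M (scaleMode Y) e where
  neg y k n a ha hn := by rw [scaleMode_of_mem ha, h.neg y k n a ha hn, smul_zero]
  zero a y := by
    rw [h.zero]
    refine homogeneous_induction (p := fun a => zeroMode Y a (e y)
      = zeroMode (ZhuInduction.scaleMode Y) a (e y)) (by simp) (fun a b ha hb => by simp [ha, hb])
      (fun k a ha => ?_) a
    rw [zeroMode, zeroMode, byWeight_of_mem _ ha, byWeight_of_mem _ ha, scaleMode_of_mem ha]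
    simp

/-- A weak module that is generated by a copy of `M` in its top level and that maps to its twist
by `2^deg` is graded by the degrees of words, because words of degree `d` are eigenvectors with
eigenvalue `2^d` of this map. -/
theorem isNGradableWeakModule_of_scale (hY : IsWeakModule Y) (he : IsTopMap M Y e)
    (hg : Generates Y e)
    (hθ : ∃ θ : X →ₗ[ℂ] X, (∀ y, θ (e y) = e y) ∧ ∀ n a x, θ (Y n a x) = scaleMode Y n a (θ x)) :
    IsNGradableWeakModule Y (wordDeg Y e) where
  truncation := hY.trunc
  vacuum := hY.vacuum
  jacobi := hY.bor
  internal := by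
    -- `2^deg` separates degrees, so words of different degrees lie in different eigenspaces of `θ`.
    obtain ⟨θ, hθe, hθ⟩ := hθ
    have h2 : (2 : ℂ) ≠ 0 := two_ne_zero
    have hword : ∀ d x, IsWord Y e d x → θ x = (2 : ℂ) ^ d • x := by
      intro d x hx
      induction hx with
      | base y => simp [hθe]
      | mode k m d a x ha _ ih =>
        rw [hθ, scaleMode_of_mem ha, ih, map_smul, smul_smul, ← zpow_add₀ h2]
    have hle : ∀ d, wordDeg Y e d ≤ Module.End.eigenspace θ ((2 : ℂ) ^ d) := fun d =>
      Submodule.span_le.2 fun x hx => Module.End.mem_eigenspace_iff.2 (hword d x hx)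
    have hinj : Function.Injective fun d : ℤ => (2 : ℂ) ^ d := by
      intro d d' h
      have h : (2 : ℂ) ^ d = 2 ^ d' := h
      have h' : ((2 : ℝ) ^ d : ℝ) = 2 ^ d' := Complex.ofReal_injective (by push_cast; exact h)
      exact zpow_right_injective₀ (by norm_num) (by norm_num) h'
    exact DirectSum.isInternal_submodule_of_iSupIndep_of_iSup_eq_top
      (((Module.End.eigenspaces_iSupIndep θ).comp hinj).mono hle) hg.iSup_wordDeg
  mode_mem m k n a x ha hx := by
    have := mode_mem_wordDeg (m := n) ha hx
    rwa [show m - n - 1 + k = m + k - n - 1 by ring] at this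
  gr_neg n hn := by
    rw [eq_bot_iff]
    intro x hx
    simpa using wordDeg_neg hY he hn hx

theorem isNGradableWeakModule_S (M : ZhuMod.{u, v} V) :
    IsNGradableWeakModule (modeS M) (gradS M) :=
  isNGradableWeakModule_of_scale (isWeakModule_modeS M) (isTopMap_inclS M) (generates_S M)
    (exists_lift_S (isWeakModule_scaleMode (isWeakModule_modeS M)) (isTopMap_inclS M).scaleMode)

theorem isNGradableWeakModule_Mbar (M : ZhuMod.{u, v} V) :
    IsNGradableWeakModule (modeMbar M) (gradMbar M) :=
  isNGradableWeakModule_of_scale (isWeakModule_modeMbar M) (isTopMap_inclMbar M) (generates_Mbar M)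
    ((isWeakModule_scaleMode (isWeakModule_modeMbar M)).exists_lift_Mbar
      (isTopMap_inclMbar M).scaleMode)

end Grading


/-! ### Lowering the first index with the derivation -/

section Derivation

variable {V : Type*} [AddCommGroup V] [Module ℂ V] [VertexAlgebra V]
variable {X : Type*} [AddCommGroup X] [Module ℂ X] {Y : ℤ → V →ₗ[ℂ] X →ₗ[ℂ] X}

theorem altSum_deriv_left {w : ℤ → ℤ → X} {N : ℤ} (hw : ∀ p q, N ≤ q → w p q = 0) (l m n : ℤ) :
    altSum (fun p q => (-p) • w (p - 1) q) l m n
      = -(m • altSum w l (m - 1) n) - l • altSum w (l - 1) m n := by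
  have hR : N ≤ n + ((N - n).toNat : ℕ) := by omega
  rw [altSum_eq_sum hw hR, altSum_eq_sum hw hR,
    altSum_eq_sum (fun p q h => by rw [hw _ _ h, smul_zero]) hR, Finset.smul_sum, Finset.smul_sum,
    ← Finset.sum_neg_distrib, ← Finset.sum_sub_distrib]
  refine Finset.sum_congr rfl fun i _ => ?_
  rw [show m + l - (i : ℤ) - 1 = m - 1 + l - i by ring,
    show m + (l - 1) - (i : ℤ) = m - 1 + l - i by ring, smul_smul, smul_smul, smul_smul, ← neg_smul,
    ← sub_smul]
  congr 1
  linear_combination (-(-1 : ℤ) ^ i) * sub_mul_choose l i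

theorem altSum_deriv_right {w : ℤ → ℤ → X} {N : ℤ} (hw : ∀ p q, N ≤ q → w p q = 0) (l m n : ℤ) :
    altSum (fun p q => (-q) • w p (q - 1)) l m n
      = -(n • altSum w l m (n - 1)) + l • altSum w (l - 1) m n := by
  obtain ⟨R, hR⟩ : ∃ R : ℕ, N ≤ n - 1 + R := ⟨(N - n + 1).toNat, by omega⟩
  rw [altSum_eq_sum hw (R := R + 1) (by push_cast; omega), altSum_eq_sum hw (R := R) (by omega),
    altSum_eq_sum (N := N + 1) (R := R + 1) (fun p q h => by rw [hw _ _ (by omega), smul_zero])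
      (by push_cast; omega), Finset.smul_sum, Finset.smul_sum]
  have h : ∀ i : ℕ, ((-1 : ℤ) ^ i * Ring.choose l i) • (-(n + i)) • w (m + l - i) (n + i - 1)
      = -(n • ((-1 : ℤ) ^ i * Ring.choose l i) • w (m + l - i) (n - 1 + i))
        - ((-1 : ℤ) ^ i * (i * Ring.choose l i)) • w (m + l - i) (n - 1 + i) := by
    intro i
    rw [show n + (i : ℤ) - 1 = n - 1 + i by ring, smul_smul, smul_smul, ← neg_smul, ← sub_smul]
    congr 1
    ring
  simp only [h, Finset.sum_sub_distrib, Finset.sum_neg_distrib]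
  rw [sub_eq_add_neg, Finset.sum_range_succ' (fun i : ℕ => ((-1 : ℤ) ^ i * (i * Ring.choose l i)) • _)]
  congr 1
  simp only [Nat.cast_zero, zero_mul, mul_zero, zero_smul, add_zero]
  rw [← Finset.sum_neg_distrib]
  refine Finset.sum_congr rfl fun i _ => ?_
  push_cast
  rw [show m + l - ((i : ℤ) + 1) = m + (l - 1) - i by ring,
    show n - 1 + ((i : ℤ) + 1) = n + i by ring, smul_smul, ← neg_smul]
  congr 1
  have := add_one_mul_choose l i
  rw [pow_succ]
  linear_combination ((-1 : ℤ) ^ i) * this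

theorem borR_deriv (hY : LowerTruncated Y) (hD : HasDerivProperty Y) (a b : V) (x : X)
    (l m n : ℤ) :
    borR Y (mode (-2) a vac) b x l m n
      = -(m • borR Y a b x l (m - 1) n) - l • borR Y a b x (l - 1) m n := by
  obtain ⟨A, hA⟩ := hY a x
  obtain ⟨B, hB⟩ := hY b x
  have h1 : ∀ p q, B ≤ q → Y p a (Y q b x) = 0 := fun p q h => by rw [hB q h, map_zero]
  have h2 : ∀ p q, A ≤ q → Y p b (Y q a x) = 0 := fun p q h => by rw [hA q h, map_zero]
  simp only [borR_eq_altSum hY]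
  simp only [hD a, map_zsmul]
  rw [altSum_deriv_left h1, altSum_deriv_right h2, Int.negOnePow_sub, Int.negOnePow_one]
  simp only [mul_neg, mul_one, Units.val_neg, neg_smul, smul_sub, smul_add, smul_neg,
    smul_comm (l.negOnePow : ℤ)]
  abel

theorem borL_deriv (a b : V) (x : X) (l m n : ℤ) :
    borL Y (mode (-2) a vac) b x l m n
      = -(m • borL Y a b x l (m - 1) n) - l • borL Y a b x (l - 1) m n := by
  obtain ⟨N, hN⟩ := exists_mode_eq_zero a b (l - 1)
  have hD : ∀ i : ℕ, mode (l + i) (mode (-2) a vac) b = (-(l + i)) • mode (l - 1 + i) a b :=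
    fun i => by
      rw [(isWeakModule_mode V).deriv a (l + i) b, show l + (i : ℤ) - 1 = l - 1 + i by ring]
  rw [borL_eq_sum (N := N + 1) (fun i hi => by rw [hD, hN i (by omega), smul_zero]),
    borL_eq_sum (N := N) (fun i hi => ?_), borL_eq_sum (N := N + 1) (fun i hi => hN i (by omega)),
    Finset.smul_sum, Finset.smul_sum]
  · have h : ∀ i : ℕ, (Ring.choose m i : ℤ) • Y (m + n - i) (mode (l + i) (mode (-2) a vac) b) x
        = -((i * Ring.choose m i : ℤ) • Y (m + n - i) (mode (l - 1 + i) a b) x)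
          - l • (Ring.choose m i : ℤ) • Y (m + n - i) (mode (l - 1 + i) a b) x := by
      intro i
      rw [hD, map_zsmul, LinearMap.smul_apply, smul_smul, smul_smul, ← neg_smul, ← sub_smul]
      congr 1
      ring
    simp only [h, Finset.sum_sub_distrib, Finset.sum_neg_distrib]
    rw [Finset.sum_range_succ' (fun i : ℕ => (i * Ring.choose m i : ℤ) • _)]
    congr 2
    simp only [Nat.cast_zero, zero_mul, zero_smul, add_zero]
    refine Finset.sum_congr rfl fun i _ => ?_
    push_cast
    rw [show m + n - ((i : ℤ) + 1) = m - 1 + n - i by ring,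
      show l - 1 + ((i : ℤ) + 1) = l + i by ring, smul_smul]
    congr 1
    exact add_one_mul_choose m i
  · have := hN (i + 1) (by omega)
    push_cast at this
    rwa [show l - 1 + ((i : ℤ) + 1) = l + i by ring] at this

/-- Borcherds' identity for all elements and the first index `-1` gives it for all indices: the
first index is raised by the recurrence and lowered by the derivation. -/
theorem bor_of_neg_one (hY : LowerTruncated Y) (hD : HasDerivProperty Y) {x : X}
    (h : ∀ a b m n, Bor Y a b x (-1) m n) (a b : V) (l m n : ℤ) : Bor Y a b x l m n := by
  have hpos : ∀ (t : ℕ) (a b : V) (m n : ℤ), Bor Y a b x (-1 + t) m n := by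
    intro t
    induction t with
    | zero => simpa using h
    | succ t ih =>
      intro a b m n
      push_cast
      rw [← add_assoc]
      exact (ih a b _ _).succ hY (ih a b _ _)
  have hneg : ∀ (t : ℕ) (a b : V) (m n : ℤ), Bor Y a b x (-1 - t) m n := by
    intro t
    induction t with
    | zero => simpa using h
    | succ t ih =>
      intro a b m n
      have h1 := ih (mode (-2) a vac) b m n
      have h2 := ih a b (m - 1) n
      unfold Bor at h1 h2 ⊢
      rw [borL_deriv, borR_deriv hY hD, h2] at h1
      have h3 := sub_right_injective h1
      push_cast
      rw [show (-1 - ((t : ℤ) + 1)) = -1 - t - 1 by ring]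
      rw [← Int.cast_smul_eq_zsmul ℂ, ← Int.cast_smul_eq_zsmul ℂ (-1 - (t : ℤ))] at h3
      refine smul_right_injective X (r := ((-1 - t : ℤ) : ℂ)) ?_ h3
      exact Int.cast_ne_zero.2 (by omega)
  rcases le_total (-1) l with hl | hl
  · obtain ⟨t, ht⟩ := Int.le.dest hl
    exact ht ▸ hpos t a b m n
  · obtain ⟨t, ht⟩ := Int.le.dest hl
    have : l = -1 - t := by omega
    exact this ▸ hneg t a b m n

end Derivation

/-! ### Test functions -/

section TestFunctions

/-- The scalar multiplication of the module structure of `ℂ((x))`. Instance search alone ends in a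
different term, with which lemmas about modules do not unify. -/
instance : SMul ℂ (LaurentSeries ℂ) :=
  (HahnSeries.instModule : Module ℂ (LaurentSeries ℂ)).toDistribMulAction.toDistribSMul.toSMul

instance : IsScalarTower ℂ (LaurentSeries ℂ) (LaurentSeries ℂ) :=
  ⟨fun c g h => by simp only [smul_eq_mul, ← HahnSeries.C_mul_eq_smul, mul_assoc]⟩

instance : SMulCommClass ℂ (LaurentSeries ℂ) (LaurentSeries ℂ) :=
  ⟨fun c g h => by simp only [smul_eq_mul, ← HahnSeries.C_mul_eq_smul, mul_left_comm]⟩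

/-- The variable `x` of `ℂ((x))`. -/
def lx : LaurentSeries ℂ := HahnSeries.single 1 1

/-- The element `z = 1 + x` of `ℂ((x))`. -/
def lz : LaurentSeries ℂ := 1 + lx

/-- `zⁱ xʲ`, an element of `ℂ[x, x⁻¹, z, z⁻¹] ⊆ ℂ((x))`. -/
def mono (i j : ℤ) : LaurentSeries ℂ := lz ^ i * lx ^ j

theorem lx_zpow (n : ℤ) : lx ^ n = HahnSeries.single n (1 : ℂ) :=
  (RatFunc.single_zpow n).symm

theorem lx_ne_zero : lx ≠ 0 := HahnSeries.single_ne_zero one_ne_zero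

theorem lz_ne_zero : lz ≠ 0 := by
  intro h
  have := congrArg (fun g : LaurentSeries ℂ => g.coeff 0) h
  simp [lz, lx] at this

theorem mono_mul (i j i' j' : ℤ) : mono i j * mono i' j' = mono (i + i') (j + j') := by
  rw [mono, mono, mono, zpow_add₀ lz_ne_zero, zpow_add₀ lx_ne_zero]
  ring

theorem lx_zpow_eq_mono (j : ℤ) : lx ^ j = mono 0 j := by rw [mono, zpow_zero, one_mul]

theorem lz_zpow_eq_mono (i : ℤ) : lz ^ i = mono i 0 := by rw [mono, zpow_zero, mul_one]

theorem lx_mul_mono (i j : ℤ) : lx * mono i j = mono i (j + 1) := by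
  conv_lhs => rw [← zpow_one lx, lx_zpow_eq_mono, mono_mul]
  congr 1 <;> ring

theorem lz_mul_mono (i j : ℤ) : lz * mono i j = mono (i + 1) j := by
  conv_lhs => rw [← zpow_one lz, lz_zpow_eq_mono, mono_mul]
  congr 1 <;> ring

theorem mono_add_one (i j : ℤ) : mono (i + 1) j = mono i j + mono i (j + 1) := by
  rw [← lz_mul_mono, ← lx_mul_mono, lz]
  ring

/-- The span of the `zⁱ xʲ` with `(i, j) ∈ S`. -/
def monoSpan (S : Set (ℤ × ℤ)) : Submodule ℂ (LaurentSeries ℂ) :=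
  Submodule.span ℂ ((fun p : ℤ × ℤ => mono p.1 p.2) '' S)

/-- The elements of `ℂ[x, x⁻¹, z, z⁻¹]` of order at least `N` at `z = 0`. -/
abbrev zAdic (N : ℤ) : Submodule ℂ (LaurentSeries ℂ) := monoSpan {p | N ≤ p.1}

/-- The elements of `ℂ[x, x⁻¹, z, z⁻¹]` of degree at most `q` at infinity. -/
abbrev degLE (q : ℤ) : Submodule ℂ (LaurentSeries ℂ) := monoSpan {p | p.1 + p.2 ≤ q}

/-- The span of the `zⁱ xʲ` with `N ≤ i` and `i + j ≤ q`; it is `zAdic N ⊓ degLE q`. -/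
abbrev zAdicLE (N q : ℤ) : Submodule ℂ (LaurentSeries ℂ) :=
  monoSpan {p | N ≤ p.1 ∧ p.1 + p.2 ≤ q}

variable {S T U : Set (ℤ × ℤ)} {g h : LaurentSeries ℂ}

theorem mono_mem {i j : ℤ} (h : (i, j) ∈ S) : mono i j ∈ monoSpan S :=
  Submodule.subset_span ⟨(i, j), h, rfl⟩

theorem monoSpan_le {P : Submodule ℂ (LaurentSeries ℂ)} (h : ∀ i j, (i, j) ∈ S → mono i j ∈ P) :
    monoSpan S ≤ P := by
  refine Submodule.span_le.2 ?_
  rintro _ ⟨⟨i, j⟩, hp, rfl⟩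
  exact h i j hp

theorem monoSpan_mono (h : S ⊆ T) : monoSpan S ≤ monoSpan T :=
  monoSpan_le fun _ _ hp => mono_mem (h hp)

theorem zAdic_anti {N N' : ℤ} (h : N ≤ N') : zAdic N' ≤ zAdic N :=
  monoSpan_mono fun _ hp => le_trans h hp

theorem degLE_mono {q q' : ℤ} (h : q ≤ q') : degLE q ≤ degLE q' :=
  monoSpan_mono fun _ hp => le_trans hp h

/-- Products of test functions, where `S + T ⊆ U`. -/
theorem mul_mem_monoSpan (hST : ∀ p ∈ S, ∀ p' ∈ T, p + p' ∈ U) (hg : g ∈ monoSpan S)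
    (hh : h ∈ monoSpan T) : g * h ∈ monoSpan U := by
  have h1 : monoSpan S ≤ (monoSpan U).comap (LinearMap.mulRight ℂ h) := by
    refine monoSpan_le fun i j hp => ?_
    have h2 : monoSpan T ≤ (monoSpan U).comap (LinearMap.mulLeft ℂ (mono i j)) := by
      refine monoSpan_le fun i' j' hp' => ?_
      change mono i j * mono i' j' ∈ monoSpan U
      rw [mono_mul]
      exact mono_mem (hST _ hp _ hp')
    exact h2 hh
  exact h1 hg

theorem mul_mem_zAdic {N N' N'' : ℤ} (hN : N'' ≤ N + N') (hg : g ∈ zAdic N) (hh : h ∈ zAdic N') :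
    g * h ∈ zAdic N'' :=
  mul_mem_monoSpan (fun _ hp _ hp' => hN.trans (add_le_add hp hp')) hg hh

theorem mul_mem_degLE {q q' q'' : ℤ} (hq : q + q' ≤ q'') (hg : g ∈ degLE q) (hh : h ∈ degLE q') :
    g * h ∈ degLE q'' :=
  mul_mem_monoSpan (fun p hp p' hp' => by
    simp only [Set.mem_ofPred_eq, Prod.fst_add, Prod.snd_add] at hp hp' ⊢; omega) hg hh

theorem mono_mem_zAdic {N i : ℤ} (j : ℤ) (h : N ≤ i) : mono i j ∈ zAdic N := mono_mem h

theorem mono_mem_degLE {q i j : ℤ} (h : i + j ≤ q) : mono i j ∈ degLE q := mono_mem h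

/-- For `θ = (1 - (z/x)^A)^B`, both `θ` and `1 - θ` are small: `θ` at infinity because
`1 - z/x = -1/x`, and `1 - θ` at `z = 0`. -/
theorem exists_cutoff (A B : ℕ) :
    ∃ θ : LaurentSeries ℂ, θ ∈ zAdicLE 0 (-B) ∧ 1 - θ ∈ zAdicLE A 0 := by
  set u := mono A (-A) with hu
  have hu1 : u ∈ zAdicLE A 0 := mono_mem (by simp)
  have hu0 : u ∈ zAdicLE 0 0 := mono_mem (by simp)
  have hone : (1 : LaurentSeries ℂ) ∈ zAdicLE 0 0 := by
    have : mono 0 0 ∈ zAdicLE 0 0 := mono_mem (by simp)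
    simpa [mono] using this
  have hmul : ∀ {N q N' q' : ℤ} {g h : LaurentSeries ℂ}, g ∈ zAdicLE N q → h ∈ zAdicLE N' q' →
      g * h ∈ zAdicLE (N + N') (q + q') := fun hg hh =>
    mul_mem_monoSpan (fun p hp p' hp' => by
      simp only [Set.mem_ofPred_eq, Prod.fst_add, Prod.snd_add] at hp hp' ⊢; omega) hg hh
  have hsub : ∀ A : ℕ, 1 - mono A (-A) ∈ zAdicLE 0 (-1) := by
    intro A
    induction A with
    | zero => simp [mono]
    | succ A ih =>
      have h1 : (1 - mono (A + 1 : ℕ) (-(A + 1 : ℕ)) : LaurentSeries ℂ)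
          = (1 - mono A (-A)) - mono A (-A - 1) := by
        push_cast
        rw [mono_add_one, show -((A : ℤ) + 1) = -A - 1 by ring, show -(A : ℤ) - 1 + 1 = -A by ring]
        ring
      rw [h1]
      exact Submodule.sub_mem _ ih (mono_mem ⟨by simp, by simp only; omega⟩)
  refine ⟨(1 - u) ^ B, ?_, ?_⟩
  · induction B with
    | zero => simpa using hone
    | succ B ih =>
      rw [pow_succ]
      have := hmul ih (hsub A)
      rwa [add_zero, show -(B : ℤ) + -1 = -(B + 1 : ℕ) by push_cast; ring] at this
  · have : (1 - u) ^ B ∈ zAdicLE 0 0 ∧ 1 - (1 - u) ^ B ∈ zAdicLE A 0 := by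
      induction B with
      | zero => exact ⟨by simpa using hone, by simp⟩
      | succ B ih =>
        have h1 := hmul ih.1 (Submodule.sub_mem _ hone hu0)
        have h2 := hmul ih.1 hu1
        rw [zero_add, zero_add] at h2
        rw [zero_add] at h1
        refine ⟨by rw [pow_succ]; exact h1, ?_⟩
        rw [show 1 - (1 - u) ^ (B + 1) = (1 - (1 - u) ^ B) + (1 - u) ^ B * u by ring]
        exact Submodule.add_mem _ ih.2 h2
    exact this.2

/-- Elements of small degree at infinity approximate `zⁿ` at `z = 0`. -/
theorem exists_approx (n N q : ℤ) : ∃ g ∈ degLE q, g - lz ^ n ∈ zAdic N := by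
  obtain ⟨θ, h1, h2⟩ := exists_cutoff (N - n).toNat (n - q).toNat
  refine ⟨lz ^ n * θ, ?_, ?_⟩
  · rw [lz_zpow_eq_mono]
    exact mul_mem_degLE (q := n) (by omega) (mono_mem_degLE (by simp))
      (monoSpan_mono (fun p hp => hp.2) h1)
  · rw [show lz ^ n * θ - lz ^ n = -(lz ^ n * (1 - θ)) by ring, lz_zpow_eq_mono]
    exact Submodule.neg_mem _ (mul_mem_zAdic (N := n) (by omega) (mono_mem_zAdic _ le_rfl)
      (monoSpan_mono (fun p hp => hp.1) h2))

/-- An element of order at least `N` at `z = 0` and of degree at most `q` at infinity is a combination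
of monomials `zⁱ xʲ` that satisfy both bounds: split it by a cutoff function. -/
theorem zAdic_inf_degLE {N q : ℤ} (h1 : g ∈ zAdic N) (h2 : g ∈ degLE q) : g ∈ zAdicLE N q := by
  have hA : ∃ A : ℕ, ∀ h, h ∈ zAdicLE A 0 → g * h ∈ zAdicLE N q := by
    refine Submodule.span_induction (p := fun g _ => ∃ A : ℕ, ∀ h, h ∈ zAdicLE A 0 →
      g * h ∈ zAdicLE N q) ?_ ⟨0, by simp⟩ ?_ ?_ h2
    · rintro _ ⟨⟨i, j⟩, hp, rfl⟩
      refine ⟨(N - i).toNat, fun h hh => mul_mem_monoSpan ?_ (mono_mem (Set.mem_singleton (i, j))) hh⟩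
      rintro _ rfl p' hp'
      simp only [Set.mem_ofPred_eq, Prod.fst_add, Prod.snd_add] at hp hp' ⊢
      omega
    · rintro g g' _ _ ⟨A, hA⟩ ⟨A', hA'⟩
      refine ⟨max A A', fun h hh => ?_⟩
      rw [add_mul]
      refine Submodule.add_mem _ (hA h (monoSpan_mono ?_ hh)) (hA' h (monoSpan_mono ?_ hh)) <;>
      · intro p hp
        simp only [Set.mem_ofPred_eq] at hp ⊢
        push_cast at hp
        omega
    · rintro c g _ ⟨A, hA⟩
      exact ⟨A, fun h hh => by rw [smul_mul_assoc]; exact Submodule.smul_mem _ _ (hA h hh)⟩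
  have hB : ∃ B : ℕ, ∀ h, h ∈ zAdicLE 0 (-B) → g * h ∈ zAdicLE N q := by
    refine Submodule.span_induction (p := fun g _ => ∃ B : ℕ, ∀ h, h ∈ zAdicLE 0 (-B) →
      g * h ∈ zAdicLE N q) ?_ ⟨0, by simp⟩ ?_ ?_ h1
    · rintro _ ⟨⟨i, j⟩, hp, rfl⟩
      refine ⟨(i + j - q).toNat, fun h hh => mul_mem_monoSpan ?_ (mono_mem (Set.mem_singleton (i, j))) hh⟩
      rintro _ rfl p' hp'
      simp only [Set.mem_ofPred_eq, Prod.fst_add, Prod.snd_add] at hp hp' ⊢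
      omega
    · rintro g g' _ _ ⟨A, hA⟩ ⟨A', hA'⟩
      refine ⟨max A A', fun h hh => ?_⟩
      rw [add_mul]
      refine Submodule.add_mem _ (hA h (monoSpan_mono ?_ hh)) (hA' h (monoSpan_mono ?_ hh)) <;>
      · intro p hp
        simp only [Set.mem_ofPred_eq] at hp ⊢
        push_cast at hp
        omega
    · rintro c g _ ⟨A, hA⟩
      exact ⟨A, fun h hh => by rw [smul_mul_assoc]; exact Submodule.smul_mem _ _ (hA h hh)⟩
  obtain ⟨A, hA⟩ := hA
  obtain ⟨B, hB⟩ := hB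
  obtain ⟨θ, hθ, hθ'⟩ := exists_cutoff A B
  rw [show g = g * θ + g * (1 - θ) by ring]
  exact Submodule.add_mem _ (hB _ hθ) (hA _ hθ')

/-- The divided derivatives of Laurent series. -/
abbrev dd (s : ℕ) : LaurentSeries ℂ →ₗ[ℂ] LaurentSeries ℂ := LaurentSeries.hasseDeriv ℂ s

theorem dd_lx_zpow (s : ℕ) (n : ℤ) :
    dd s (lx ^ n) = ((Ring.choose n s : ℤ) : ℂ) • lx ^ (n - s) := by
  rw [lx_zpow, lx_zpow, LaurentSeries.hasseDeriv_single]
  ext m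
  simp [HahnSeries.coeff_single]

theorem dd_lx_mul (s : ℕ) (g : LaurentSeries ℂ) :
    dd (s + 1) (lx * g) = lx * dd (s + 1) g + dd s g := by
  ext n
  simp only [lx, HahnSeries.coeff_add, LaurentSeries.hasseDeriv_coeff, HahnSeries.coeff_single_mul,
    one_mul, Nat.cast_add, Nat.cast_one]
  rw [show n - 1 + ((s : ℤ) + 1) = n + s by ring, show n + ((s : ℤ) + 1) - 1 = n + s by ring,
    ← add_assoc, Ring.choose_succ_succ, add_smul, add_comm]

theorem dd_lz_mul (s : ℕ) (g : LaurentSeries ℂ) :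
    dd (s + 1) (lz * g) = lz * dd (s + 1) g + dd s g := by
  rw [lz, add_mul, one_mul, map_add, dd_lx_mul]
  ring

theorem dd_zero (g : LaurentSeries ℂ) : dd 0 g = g := by
  ext n
  simp

/-- `∂⁽ˢ⁾ zⁿ = (n choose s) z^(n-s)`. -/
theorem dd_lz_zpow (s : ℕ) (n : ℤ) :
    dd s (lz ^ n) = ((Ring.choose n s : ℤ) : ℂ) • lz ^ (n - s) := by
  induction s generalizing n with
  | zero => simp
  | succ s ih =>
    have step : ∀ n : ℤ, dd (s + 1) (lz ^ (n + 1)) = lz * dd (s + 1) (lz ^ n)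
        + ((Ring.choose n s : ℤ) : ℂ) • lz ^ (n - s) := fun n => by
      rw [zpow_add_one₀ lz_ne_zero, mul_comm, dd_lz_mul, ih]
    have hz : ∀ n : ℤ, lz * lz ^ (n - (s + 1 : ℕ)) = lz ^ (n - s) := fun n => by
      rw [mul_comm, ← zpow_add_one₀ lz_ne_zero]
      congr 1
      push_cast
      ring
    have up : ∀ n : ℤ, lz * (((Ring.choose n (s + 1) : ℤ) : ℂ) • lz ^ (n - (s + 1 : ℕ)))
        + ((Ring.choose n s : ℤ) : ℂ) • lz ^ (n - s)
        = ((Ring.choose (n + 1) (s + 1) : ℤ) : ℂ) • lz ^ (n + 1 - (s + 1 : ℕ)) := fun n => by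
      rw [mul_smul_comm, hz, Ring.choose_succ_succ, Int.cast_add, add_smul, add_comm]
      push_cast
      rw [add_sub_add_right_eq_sub]
    induction n using Int.induction_on with
    | zero =>
      rw [zpow_zero, Ring.choose_zero_succ, Int.cast_zero, zero_smul]
      have := dd_lx_zpow (s + 1) 0
      rwa [zpow_zero, Ring.choose_zero_succ, Int.cast_zero, zero_smul] at this
    | succ n hn => rw [step, hn, up]
    | pred n hn =>
      have h1 := step (-n - 1)
      rw [sub_add_cancel, hn, ← sub_add_cancel (-(n : ℤ)) 1, ← up, sub_add_cancel] at h1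
      exact (mul_left_cancel₀ lz_ne_zero (add_right_cancel h1)).symm

/-- A divided derivative of order `s` lowers the order at `z = 0` by at most `s`, and it lowers the
degree at infinity by `s`. -/
theorem dd_mono_mem (s : ℕ) (i j : ℤ) :
    dd s (mono i j) ∈ monoSpan {p | i - s ≤ p.1 ∧ p.1 + p.2 = i + j - s} := by
  have mulz : ∀ {N N' q q' : ℤ} (m : ℤ) {g : LaurentSeries ℂ},
      g ∈ monoSpan {p | N ≤ p.1 ∧ p.1 + p.2 = q} → N' = N + m → q' = q + m →
      lz ^ m * g ∈ monoSpan {p | N' ≤ p.1 ∧ p.1 + p.2 = q'} := fun m g hg hN hq => by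
    rw [lz_zpow_eq_mono]
    refine mul_mem_monoSpan ?_ (mono_mem (Set.mem_singleton (m, 0))) hg
    rintro _ rfl p' hp'
    simp only [Set.mem_ofPred_eq, Prod.fst_add, Prod.snd_add] at hp' ⊢
    omega
  induction s generalizing i with
  | zero => rw [dd_zero]; exact mono_mem (by simp)
  | succ s ih =>
    have step : ∀ i : ℤ, dd (s + 1) (mono (i + 1) j)
        = lz ^ (1 : ℤ) * dd (s + 1) (mono i j) + lz ^ (0 : ℤ) * dd s (mono i j) := fun i => by
      rw [← lz_mul_mono, dd_lz_mul, zpow_one, zpow_zero, one_mul]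
    have step' : ∀ i : ℤ, dd (s + 1) (mono i j)
        = lz ^ (-1 : ℤ) * dd (s + 1) (mono (i + 1) j) - lz ^ (-1 : ℤ) * dd s (mono i j) := fun i => by
      rw [step, zpow_one, zpow_zero, one_mul, zpow_neg_one, mul_add,
        inv_mul_cancel_left₀ lz_ne_zero]
      ring
    induction i using Int.induction_on with
    | zero =>
      rw [← lx_zpow_eq_mono, dd_lx_zpow, lx_zpow_eq_mono]
      exact Submodule.smul_mem _ _ (mono_mem (by simp))
    | succ i hi =>
      rw [step]
      exact Submodule.add_mem _ (mulz _ hi (by push_cast; ring) (by push_cast; ring))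
        (mulz _ (ih i) (by push_cast; ring) (by push_cast; ring))
    | pred i hi =>
      rw [step']
      refine Submodule.sub_mem _ (mulz _ (by rw [sub_add_cancel]; exact hi) (by push_cast; ring)
        (by push_cast; ring)) (mulz _ (ih _) (by push_cast; ring) (by push_cast; ring))

theorem dd_mem_zAdic {N : ℤ} (s : ℕ) (hg : g ∈ zAdic N) : dd s g ∈ zAdic (N - s) := by
  suffices H : zAdic N ≤ (zAdic (N - s)).comap (dd s) from H hg
  refine monoSpan_le fun i j hp => monoSpan_mono ?_ (dd_mono_mem s i j)
  intro p hp'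
  simp only [Set.mem_ofPred_eq] at hp hp' ⊢
  omega

theorem dd_mem_degLE {q : ℤ} (s : ℕ) (hg : g ∈ degLE q) : dd s g ∈ degLE (q - s) := by
  suffices H : degLE q ≤ (degLE (q - s)).comap (dd s) from H hg
  refine monoSpan_le fun i j hp => monoSpan_mono ?_ (dd_mono_mem s i j)
  intro p hp'
  simp only [Set.mem_ofPred_eq] at hp hp' ⊢
  omega

end TestFunctions

/-! ### The Jacobi identity for test functions -/

section LaurentInduction

theorem exists_coeff_eq_zero (g : LaurentSeries ℂ) : ∃ L : ℤ, ∀ n < L, g.coeff n = 0 :=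
  ⟨g.order, fun _ h => HahnSeries.coeff_eq_zero_of_lt_order h⟩

theorem coeff_mul_eq_zero {g h : LaurentSeries ℂ} {U L : ℤ} (hg : ∀ n < U, g.coeff n = 0)
    (hh : ∀ n < L, h.coeff n = 0) : ∀ n < U + L, (g * h).coeff n = 0 := by
  intro n hn
  rw [HahnSeries.coeff_mul]
  refine Finset.sum_eq_zero fun p hp => ?_
  have := (Finset.mem_antidiagonal.1 hp).2.2
  rcases lt_or_ge p.1 U with h1 | h1
  · rw [hg _ h1, zero_mul]
  · rw [hh _ (by omega), mul_zero]

theorem coeff_mul_lx_zpow (g : LaurentSeries ℂ) (p n : ℤ) :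
    (g * lx ^ p).coeff n = g.coeff (n - p) := by
  rw [lx_zpow, HahnSeries.coeff_mul_single, mul_one]

/-- Induction for properties that hold for all Laurent series of sufficiently high order. -/
theorem laurentSeries_induction {P : LaurentSeries ℂ → Prop}
    (hadd : ∀ g h, P g → P h → P (g + h)) (hsmul : ∀ (c : ℂ) g, P g → P (c • g))
    (hmon : ∀ n : ℤ, P (lx ^ n))
    (htail : ∃ U : ℤ, ∀ g : LaurentSeries ℂ, (∀ n < U, g.coeff n = 0) → P g)
    (g : LaurentSeries ℂ) : P g := by
  obtain ⟨U, hU⟩ := htail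
  have key : ∀ (d : ℕ) (g : LaurentSeries ℂ), (∀ n < U - d, g.coeff n = 0) → P g := by
    intro d
    induction d with
    | zero => simpa using hU
    | succ d ih =>
      intro g hg
      rw [← add_sub_cancel (g.coeff (U - (d + 1 : ℕ)) • lx ^ (U - (d + 1 : ℕ))) g]
      refine hadd _ _ (hsmul _ _ (hmon _)) (ih _ fun n hn => ?_)
      rw [HahnSeries.coeff_sub, HahnSeries.coeff_smul, lx_zpow, smul_eq_mul]
      rcases eq_or_ne n (U - (d + 1 : ℕ)) with rfl | h
      · simp
      · rw [hg n (by push_cast at h ⊢; omega), HahnSeries.coeff_single_of_ne h, mul_zero, sub_zero]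
  obtain ⟨L, hL⟩ := exists_coeff_eq_zero g
  exact key (U - L).toNat g fun n hn => hL n (by omega)

end LaurentInduction

section Smear

variable {V : Type u} [AddCommGroup V] [Module ℂ V] [VertexAlgebra V]

theorem finite_support_smear (g : LaurentSeries ℂ) (a v : V) :
    (Function.support fun n : ℤ => g.coeff n • mode n a v).Finite := by
  obtain ⟨L, hL⟩ := exists_coeff_eq_zero g
  obtain ⟨U, hU⟩ := VertexAlgebra.truncation a v
  refine (Set.finite_Ico L U).subset fun n hn => ?_
  by_contra hc
  rw [Set.mem_Ico, not_and_or, not_le, not_lt] at hc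
  refine hn ?_
  rcases hc with h | h
  · simp only [hL n h, zero_smul]
  · simp only [hU n h, smul_zero]

/-- `a[g] = Res_x g(x) Y(a, x)`, for which `a[xⁿ] = aₙ`. -/
def smear : LaurentSeries ℂ →ₗ[ℂ] V →ₗ[ℂ] V →ₗ[ℂ] V :=
  LinearMap.mk₂ ℂ (fun g a =>
    { toFun := fun v => ∑ᶠ n : ℤ, g.coeff n • mode n a v
      map_add' := fun v v' => by
        rw [← finsum_add_distrib (finite_support_smear g a v) (finite_support_smear g a v')]
        simp only [map_add, smul_add]
      map_smul' := fun c v => by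
        rw [RingHom.id_apply, smul_finsum]
        simp only [map_smul, smul_comm c] })
    (fun g g' a => by
      ext v
      simp only [LinearMap.add_apply, LinearMap.coe_mk, AddHom.coe_mk]
      rw [← finsum_add_distrib (finite_support_smear g a v) (finite_support_smear g' a v)]
      simp only [HahnSeries.coeff_add, add_smul])
    (fun c g a => by
      ext v
      simp only [LinearMap.smul_apply, LinearMap.coe_mk, AddHom.coe_mk]
      rw [smul_finsum]
      simp only [HahnSeries.coeff_smul, smul_assoc])
    (fun g a a' => by
      ext v
      simp only [LinearMap.add_apply, LinearMap.coe_mk, AddHom.coe_mk]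
      rw [← finsum_add_distrib (finite_support_smear g a v) (finite_support_smear g a' v)]
      simp only [map_add, LinearMap.add_apply, smul_add])
    (fun c g a => by
      ext v
      simp only [LinearMap.smul_apply, LinearMap.coe_mk, AddHom.coe_mk]
      rw [smul_finsum]
      simp only [map_smul, LinearMap.smul_apply, smul_comm c])

theorem smear_apply (g : LaurentSeries ℂ) (a v : V) :
    smear g a v = ∑ᶠ n : ℤ, g.coeff n • mode n a v := rfl

theorem smear_lx_zpow (n : ℤ) (a v : V) : smear (lx ^ n) a v = mode n a v := by
  rw [smear_apply, finsum_eq_single _ n, lx_zpow]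
  · simp
  · intro m hm
    rw [lx_zpow, HahnSeries.coeff_single_of_ne hm, zero_smul]

theorem exists_smear_eq_zero (a v : V) :
    ∃ U : ℤ, ∀ g : LaurentSeries ℂ, (∀ n < U, g.coeff n = 0) → smear g a v = 0 := by
  obtain ⟨U, hU⟩ := VertexAlgebra.truncation a v
  refine ⟨U, fun g hg => ?_⟩
  rw [smear_apply, ← finsum_zero (α := ℤ)]
  refine finsum_congr fun n => ?_
  rcases lt_or_ge n U with h | h
  · rw [hg n h, zero_smul]
  · rw [hU n h, smul_zero]

theorem exists_smear_mul_lx_eq_zero (g : LaurentSeries ℂ) (a v : V) :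
    ∃ I : ℕ, ∀ i : ℤ, I ≤ i → smear (g * lx ^ i) a v = 0 := by
  obtain ⟨U, hU⟩ := exists_smear_eq_zero a v
  obtain ⟨L, hL⟩ := exists_coeff_eq_zero g
  refine ⟨(U - L).toNat, fun i hi => hU _ fun n hn => ?_⟩
  rw [coeff_mul_lx_zpow]
  exact hL _ (by omega)

/-- Integration by parts: `(L(-1) a)[g] = -a[g']`. -/
theorem smear_deriv (g : LaurentSeries ℂ) (a v : V) :
    smear g (mode (-2) a vac) v = -smear (dd 1 g) a v := by
  have h : ∀ n : ℤ, g.coeff n • mode n (mode (-2) a vac) v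
      = -((dd 1 g).coeff (n - 1) • mode (n - 1) a v) := fun n => by
    rw [(isWeakModule_mode V).deriv a n v, LaurentSeries.hasseDeriv_coeff, Nat.cast_one,
      sub_add_cancel, Ring.choose_one_right, neg_smul, smul_neg, smul_assoc, smul_comm]
  rw [smear_apply, smear_apply, finsum_congr h, ← finsum_neg_distrib]
  exact finsum_comp_equiv (Equiv.subRight (1 : ℤ)) (f := fun n => -((dd 1 g).coeff n • mode n a v))

/-- The `i`-th term on the product side of the Jacobi identity with test functions `g` and `h`. -/
def smearTerm (a b v : V) (l : ℤ) (i : ℕ) (g h : LaurentSeries ℂ) : V :=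
  ((-1 : ℤ) ^ i * Ring.choose l i) • (smear (g * lx ^ (l - i)) a (smear (h * lx ^ (i : ℤ)) b v)
    - (l.negOnePow : ℤ) • smear (h * lx ^ (l - i)) b (smear (g * lx ^ (i : ℤ)) a v))

theorem smearTerm_add_left (a b v : V) (l : ℤ) (i : ℕ) (g g' h : LaurentSeries ℂ) :
    smearTerm a b v l i (g + g') h = smearTerm a b v l i g h + smearTerm a b v l i g' h := by
  simp only [smearTerm, add_mul, map_add, LinearMap.add_apply, ← smul_add]
  congr 1
  rw [smul_add]
  abel

theorem smearTerm_add_right (a b v : V) (l : ℤ) (i : ℕ) (g h h' : LaurentSeries ℂ) :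
    smearTerm a b v l i g (h + h') = smearTerm a b v l i g h + smearTerm a b v l i g h' := by
  simp only [smearTerm, add_mul, map_add, LinearMap.add_apply, ← smul_add]
  congr 1
  rw [smul_add]
  abel

theorem smearTerm_smul_left (a b v : V) (l : ℤ) (i : ℕ) (c : ℂ) (g h : LaurentSeries ℂ) :
    smearTerm a b v l i (c • g) h = c • smearTerm a b v l i g h := by
  simp only [smearTerm, smul_mul_assoc, map_smul, LinearMap.smul_apply, smul_comm _ c, ← smul_sub]

theorem smearTerm_smul_right (a b v : V) (l : ℤ) (i : ℕ) (c : ℂ) (g h : LaurentSeries ℂ) :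
    smearTerm a b v l i g (c • h) = c • smearTerm a b v l i g h := by
  simp only [smearTerm, smul_mul_assoc, map_smul, LinearMap.smul_apply, smul_comm _ c, ← smul_sub]

theorem exists_smearTerm_eq_zero (a b v : V) (l : ℤ) (g h : LaurentSeries ℂ) :
    ∃ I : ℕ, ∀ i, I ≤ i → smearTerm a b v l i g h = 0 := by
  obtain ⟨I, hI⟩ := exists_smear_mul_lx_eq_zero g a v
  obtain ⟨I', hI'⟩ := exists_smear_mul_lx_eq_zero h b v
  refine ⟨max I I', fun i hi => ?_⟩
  rw [smearTerm, hI i (by omega), hI' i (by omega)]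
  simp

theorem exists_forall_smear_smear_eq_zero (a b v : V) (l : ℤ) (h : LaurentSeries ℂ) :
    ∃ U : ℤ, ∀ g : LaurentSeries ℂ, (∀ n < U, g.coeff n = 0) → ∀ i : ℕ,
      smear (g * lx ^ (l - i)) a (smear (h * lx ^ (i : ℤ)) b v) = 0 ∧
      smear (h * lx ^ (l - i)) b (smear (g * lx ^ (i : ℤ)) a v) = 0 := by
  obtain ⟨I, hI⟩ := exists_smear_mul_lx_eq_zero h b v
  obtain ⟨U', hU'⟩ := exists_smear_eq_zero a v
  choose F hF using fun i : ℕ => exists_smear_eq_zero a (smear (h * lx ^ (i : ℤ)) b v)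
  obtain ⟨U, hU⟩ := ((Finset.range I).image fun i : ℕ => F i - l + i).exists_le
  refine ⟨max U U', fun g hg i => ⟨?_, ?_⟩⟩
  · rcases lt_or_ge i I with hi | hi
    · have := hU _ (Finset.mem_image_of_mem _ (Finset.mem_range.2 hi))
      refine hF i _ fun n hn => ?_
      rw [coeff_mul_lx_zpow]
      exact hg _ (lt_max_of_lt_left (by omega))
    · rw [hI _ (by omega), map_zero]
  · rw [hU', map_zero]
    intro n hn
    rw [coeff_mul_lx_zpow]
    exact hg _ (lt_max_of_lt_right (by omega))

/-- If `g` has high order, all terms of the product side vanish. -/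
theorem exists_forall_smearTerm_eq_zero (a b v : V) (l : ℤ) (h : LaurentSeries ℂ) :
    ∃ U : ℤ, ∀ g : LaurentSeries ℂ, (∀ n < U, g.coeff n = 0) →
      ∀ i, smearTerm a b v l i g h = 0 ∧ smearTerm a b v l i h g = 0 := by
  obtain ⟨U, hU⟩ := exists_forall_smear_smear_eq_zero a b v l h
  obtain ⟨U', hU'⟩ := exists_forall_smear_smear_eq_zero b a v l h
  refine ⟨max U U', fun g hg i => ⟨?_, ?_⟩⟩
  · obtain ⟨h1, h2⟩ := hU g (fun n hn => hg n (lt_max_of_lt_left hn)) i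
    rw [smearTerm, h1, h2, smul_zero, sub_zero, smul_zero]
  · obtain ⟨h1, h2⟩ := hU' g (fun n hn => hg n (lt_max_of_lt_right hn)) i
    rw [smearTerm, h1, h2, smul_zero, sub_zero, smul_zero]

/-- If `g` has high order, the iterate side of the Jacobi identity vanishes. -/
theorem exists_sum_smear_eq_zero (a b v : V) (l : ℤ) (S : ℕ) (h : LaurentSeries ℂ) :
    ∃ U : ℤ, ∀ g : LaurentSeries ℂ, (∀ n < U, g.coeff n = 0) →
      ∑ s ∈ Finset.range S, smear (dd s g * h) (mode (l + s) a b) v = 0 ∧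
      ∑ s ∈ Finset.range S, smear (dd s h * g) (mode (l + s) a b) v = 0 := by
  obtain ⟨L, hL⟩ := exists_coeff_eq_zero h
  choose F hF using fun s : ℕ => exists_smear_eq_zero (mode (l + s) a b) v
  obtain ⟨U, hU⟩ := ((Finset.range S).image fun s : ℕ => F s + s - L).exists_le
  have hdd : ∀ (g : LaurentSeries ℂ) (U : ℤ), (∀ n < U, g.coeff n = 0) → ∀ s : ℕ,
      ∀ n < U - s, (dd s g).coeff n = 0 := fun g U hg s n hn => by
    rw [LaurentSeries.hasseDeriv_coeff, hg _ (by omega), smul_zero]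
  refine ⟨U, fun g hg => ⟨Finset.sum_eq_zero fun s hs => hF s _ fun n hn => ?_,
    Finset.sum_eq_zero fun s hs => hF s _ fun n hn => ?_⟩⟩
  · have := hU _ (Finset.mem_image_of_mem _ hs)
    exact coeff_mul_eq_zero (hdd g U hg s) hL n (by omega)
  · have := hU _ (Finset.mem_image_of_mem _ hs)
    exact coeff_mul_eq_zero (hdd h L hL s) hg n (by omega)

/-- Borcherds' identity with test functions `g` and `h` in place of `xᵐ` and `xⁿ`. -/
theorem smear_jacobi {a b : V} {l : ℤ} {S : ℕ} (hS : ∀ i : ℕ, S ≤ i → mode (l + i) a b = 0) (v : V)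
    (g h : LaurentSeries ℂ) :
    ∑ᶠ i : ℕ, smearTerm a b v l i g h
      = ∑ s ∈ Finset.range S, smear (dd s g * h) (mode (l + s) a b) v := by
  have fin : ∀ g h, (Function.support fun i => smearTerm a b v l i g h).Finite := fun g h => by
    obtain ⟨I, hI⟩ := exists_smearTerm_eq_zero a b v l g h
    refine (Set.finite_Iio I).subset fun i hi => ?_
    by_contra hc
    exact hi (hI i (not_lt.1 hc))
  induction g using laurentSeries_induction with
  | hadd g g' hg hg' =>
    simp only [smearTerm_add_left, map_add, add_mul, LinearMap.add_apply, Finset.sum_add_distrib]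
    rw [finsum_add_distrib (fin _ _) (fin _ _), hg, hg']
  | hsmul c g hg =>
    simp only [smearTerm_smul_left, map_smul, smul_mul_assoc, LinearMap.smul_apply,
      ← Finset.smul_sum, ← smul_finsum, hg]
  | htail =>
    obtain ⟨U, hU⟩ := exists_forall_smearTerm_eq_zero a b v l h
    obtain ⟨U', hU'⟩ := exists_sum_smear_eq_zero a b v l S h
    refine ⟨max U U', fun g hg => ?_⟩
    rw [(hU' g fun n hn => hg n (lt_max_of_lt_right hn)).1, finsum_congr fun i =>
      (hU g (fun n hn => hg n (lt_max_of_lt_left hn)) i).1, finsum_zero]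
  | hmon m =>
    induction h using laurentSeries_induction with
    | hadd h h' hg hg' =>
      simp only [smearTerm_add_right, map_add, mul_add, LinearMap.add_apply, Finset.sum_add_distrib]
      rw [finsum_add_distrib (fin _ _) (fin _ _), hg, hg']
    | hsmul c g hg =>
      simp only [smearTerm_smul_right, map_smul, mul_smul_comm, LinearMap.smul_apply,
        ← Finset.smul_sum, ← smul_finsum, hg]
    | htail =>
      obtain ⟨U, hU⟩ := exists_forall_smearTerm_eq_zero a b v l (lx ^ m)
      obtain ⟨U', hU'⟩ := exists_sum_smear_eq_zero a b v l S (lx ^ m)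
      refine ⟨max U U', fun g hg => ?_⟩
      rw [(hU' g fun n hn => hg n (lt_max_of_lt_right hn)).2, finsum_congr fun i =>
        (hU g (fun n hn => hg n (lt_max_of_lt_left hn)) i).2, finsum_zero]
    | hmon n =>
      have h1 := VertexAlgebra.jacobi a b v l m n
      have h2 := borL_eq_sum (Y := mode) hS v m n
      rw [borL, h1] at h2
      refine Eq.trans (finsum_congr fun i => ?_) (h2.trans (Finset.sum_congr rfl fun s _ => ?_))
      · simp only [smearTerm, ← zpow_add₀ lx_ne_zero, smear_lx_zpow]
        rw [show m + (l - (i : ℤ)) = m + l - i by ring, show n + (l - (i : ℤ)) = n + l - i by ring]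
      · rw [dd_lx_zpow, smul_mul_assoc, ← zpow_add₀ lx_ne_zero, map_smul, LinearMap.smul_apply,
          LinearMap.smul_apply, smear_lx_zpow, Int.cast_smul_eq_zsmul,
          show m - (s : ℤ) + n = m + n - s by ring]

end Smear

/-! ### The coinduced module -/

section Coinduced

variable {V : Type u} [AddCommGroup V] [Module ℂ V] [VertexAlgebra V]
variable {M : Type v} [AddCommGroup M] [Module ℂ M]

theorem smear_commutator (a b v : V) {S : ℕ} (hS : ∀ i : ℕ, S ≤ i → mode (0 + i) a b = 0)
    (g h : LaurentSeries ℂ) :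
    smear g a (smear h b v) = smear h b (smear g a v)
      + ∑ s ∈ Finset.range S, smear (dd s g * h) (mode (0 + s) a b) v := by
  rw [← smear_jacobi hS v g h, finsum_eq_single _ 0]
  · simp [smearTerm]
  · intro i hi
    rw [smearTerm, Ring.choose_zero_pos ℤ (Nat.pos_of_ne_zero hi)]
    simp

theorem smearTerm_neg_one (a b v : V) (i : ℕ) (g h : LaurentSeries ℂ) :
    smearTerm a b v (-1) i g h
      = smear (g * lx ^ (-1 - i : ℤ)) a (smear (h * lx ^ (i : ℤ)) b v)
        + smear (h * lx ^ (-1 - i : ℤ)) b (smear (g * lx ^ (i : ℤ)) a v) := by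
  rw [smearTerm, choose_neg_one, ← mul_pow]
  simp

/-- The functional `f` on `V` vanishes on the image of `a` smeared with any test function of order
at least `N` at `z = 0` and of degree at most `q` at infinity. -/
def Kills (f : V →ₗ[ℂ] M) (a : V) (N q : ℤ) : Prop :=
  ∀ g ∈ zAdic N, g ∈ degLE q → ∀ v, f (smear g a v) = 0

theorem Kills.mono {f : V →ₗ[ℂ] M} {a : V} {N N' q q' : ℤ} (h : Kills f a N q) (hN : N ≤ N')
    (hq : q' ≤ q) : Kills f a N' q' :=
  fun g hg hg' => h g (zAdic_anti hN hg) (degLE_mono hq hg')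

theorem Kills.add {f : V →ₗ[ℂ] M} {a a' : V} {N q : ℤ} (h : Kills f a N q) (h' : Kills f a' N q) :
    Kills f (a + a') N q := fun g hg hg' v => by
  rw [map_add, LinearMap.add_apply, map_add, h g hg hg', h' g hg hg', add_zero]

theorem Kills.smul {f : V →ₗ[ℂ] M} {a : V} {N q : ℤ} (c : ℂ) (h : Kills f a N q) :
    Kills f (c • a) N q := fun g hg hg' v => by
  rw [map_smul, LinearMap.smul_apply, map_smul, h g hg hg', smul_zero]

theorem Kills.add_fun {f f' : V →ₗ[ℂ] M} {a : V} {N q : ℤ} (h : Kills f a N q)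
    (h' : Kills f' a N q) : Kills (f + f') a N q := fun g hg hg' v => by
  rw [LinearMap.add_apply, h g hg hg', h' g hg hg', add_zero]

theorem Kills.smul_fun {f : V →ₗ[ℂ] M} {a : V} {N q : ℤ} (c : ℂ) (h : Kills f a N q) :
    Kills (c • f) a N q := fun g hg hg' v => by
  rw [LinearMap.smul_apply, h g hg hg', smul_zero]

variable (V M) in
/-- The functionals `V → M` for which `g ↦ f ∘ a[g]`, on test functions `g` of degree at most `-2`
at infinity, is continuous at `z = 0` for every `a`. -/
def coind : Submodule ℂ (V →ₗ[ℂ] M) where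
  carrier := {f | ∀ a, ∃ N, Kills f a N (-2)}
  zero_mem' a := ⟨0, fun _ _ _ _ => rfl⟩
  add_mem' := by
    intro f f' h h' a
    obtain ⟨N, hN⟩ := h a
    obtain ⟨N', hN'⟩ := h' a
    exact ⟨max N N', (hN.mono (le_max_left _ _) le_rfl).add_fun (hN'.mono (le_max_right _ _) le_rfl)⟩
  smul_mem' c f h a := by
    obtain ⟨N, hN⟩ := h a
    exact ⟨N, hN.smul_fun c⟩

/-- The operator `aₙ` on the coinduced module: minus the transpose of `a` smeared with a test
function of degree at most `-2` at infinity that approximates `zⁿ` at `z = 0` well enough. -/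
def coindFun (n : ℤ) (a : V) (f : coind V M) : V →ₗ[ℂ] M :=
  -(f.1 ∘ₗ smear (exists_approx n (f.2 a).choose (-2)).choose a)

/-- The value of `coindFun` does not depend on the approximation. -/
theorem apply_smear_eq {f : coind V M} {a : V} {N q n : ℤ} (hf : Kills f.1 a N q) (hq : -2 ≤ q)
    {g : LaurentSeries ℂ} (hg : g ∈ degLE q) {c : ℂ} (hgc : g - c • lz ^ n ∈ zAdic N) (v : V) :
    f.1 (smear g a v) = -(c • coindFun n a f v) := by
  have h0 := (f.2 a).choose_spec
  obtain ⟨hd, hz⟩ := (exists_approx n (f.2 a).choose (-2)).choose_spec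
  set N0 := (f.2 a).choose
  set g0 := (exists_approx n N0 (-2)).choose
  obtain ⟨g1, hd1, hz1⟩ := exists_approx n (max N N0) (-2)
  have e0 : f.1 (smear g0 a v) = f.1 (smear g1 a v) := by
    rw [← sub_eq_zero, ← map_sub, ← LinearMap.sub_apply, ← LinearMap.sub_apply, ← map_sub]
    refine h0 _ ?_ (Submodule.sub_mem _ hd hd1) v
    rw [show g0 - g1 = (g0 - lz ^ n) - (g1 - lz ^ n) by ring]
    exact Submodule.sub_mem _ hz (zAdic_anti (le_max_right _ _) hz1)
  have e1 : f.1 (smear g a v) = c • f.1 (smear g1 a v) := by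
    rw [← sub_eq_zero, ← map_smul, ← map_sub, ← LinearMap.smul_apply, ← LinearMap.sub_apply,
      ← LinearMap.smul_apply, ← LinearMap.sub_apply, ← map_smul, ← map_sub]
    refine hf _ ?_ (Submodule.sub_mem _ hg (Submodule.smul_mem _ _ (degLE_mono hq hd1))) v
    rw [show g - c • g1 = (g - c • lz ^ n) - c • (g1 - lz ^ n) by rw [smul_sub]; ring]
    exact Submodule.sub_mem _ hgc (Submodule.smul_mem _ _ (zAdic_anti (le_max_left _ _) hz1))
  have e2 : coindFun n a f v = -f.1 (smear g0 a v) := rfl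
  rw [e2, e1, e0, smul_neg, neg_neg]

theorem coindFun_apply {f : coind V M} {a : V} {N q n : ℤ} (hf : Kills f.1 a N q) (hq : -2 ≤ q)
    {g : LaurentSeries ℂ} (hg : g ∈ degLE q) (hgc : g - lz ^ n ∈ zAdic N) (v : V) :
    coindFun n a f v = -f.1 (smear g a v) := by
  rw [apply_smear_eq hf hq hg (c := 1) (n := n) (by rwa [one_smul]), one_smul, neg_neg]

theorem mem_zAdic_of_approx {g : LaurentSeries ℂ} {n N : ℤ} (hg : g - lz ^ n ∈ zAdic N) {N' : ℤ}
    (hN : N' ≤ N) (hn : N' ≤ n) : g ∈ zAdic N' := by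
  rw [← sub_add_cancel g (lz ^ n)]
  exact Submodule.add_mem _ (zAdic_anti hN hg) (lz_zpow_eq_mono n ▸ mono_mem_zAdic _ hn)

theorem coindFun_mem (n : ℤ) (a : V) (f : coind V M) : coindFun n a f ∈ coind V M := by
  intro b
  obtain ⟨N, hN⟩ := f.2 a
  obtain ⟨g, hgd, hgz⟩ := exists_approx n (max N n) (-2)
  obtain ⟨S, hS⟩ := exists_mode_eq_zero a b 0
  obtain ⟨Nb, hNb⟩ := f.2 b
  choose F hF using fun s : ℕ => f.2 (mode (0 + s) a b)
  obtain ⟨U, hU⟩ := ((Finset.range S).image fun s : ℕ => F s + s - n).exists_le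
  refine ⟨max Nb U, fun h hhz hhd v => ?_⟩
  rw [coindFun_apply hN le_rfl hgd (zAdic_anti (le_max_left _ _) hgz), smear_commutator a b v hS,
    map_add, map_sum, hNb h (zAdic_anti (le_max_left _ _) hhz) hhd, zero_add,
    Finset.sum_eq_zero, neg_zero]
  intro s hs
  have := hU _ (Finset.mem_image_of_mem _ hs)
  refine hF s _ (mul_mem_zAdic ?_ (dd_mem_zAdic s
    (mem_zAdic_of_approx hgz (le_max_right _ _) le_rfl)) hhz)
    (mul_mem_degLE (by omega) (dd_mem_degLE s hgd) hhd) v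
  have := le_max_right Nb U
  omega

/-- The vertex operators on the coinduced module. -/
def coindMode (n : ℤ) : V →ₗ[ℂ] coind V M →ₗ[ℂ] coind V M :=
  LinearMap.mk₂ ℂ (fun a f => ⟨coindFun n a f, coindFun_mem n a f⟩)
    (fun a a' f => by
      obtain ⟨N, hN⟩ := f.2 a
      obtain ⟨N', hN'⟩ := f.2 a'
      replace hN := hN.mono (le_max_left N N') le_rfl
      replace hN' := hN'.mono (le_max_right N N') le_rfl
      obtain ⟨g, hgd, hgz⟩ := exists_approx n (max N N') (-2)
      refine Subtype.ext (LinearMap.ext fun v => ?_)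
      change coindFun n (a + a') f v = coindFun n a f v + coindFun n a' f v
      rw [coindFun_apply (hN.add hN') le_rfl hgd hgz, coindFun_apply hN le_rfl hgd hgz,
        coindFun_apply hN' le_rfl hgd hgz, map_add, LinearMap.add_apply, map_add, neg_add])
    (fun c a f => by
      obtain ⟨N, hN⟩ := f.2 a
      obtain ⟨g, hgd, hgz⟩ := exists_approx n N (-2)
      refine Subtype.ext (LinearMap.ext fun v => ?_)
      change coindFun n (c • a) f v = c • coindFun n a f v
      rw [coindFun_apply (hN.smul c) le_rfl hgd hgz, coindFun_apply hN le_rfl hgd hgz, map_smul,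
        LinearMap.smul_apply, map_smul, smul_neg])
    (fun a f f' => by
      obtain ⟨N, hN⟩ := f.2 a
      obtain ⟨N', hN'⟩ := f'.2 a
      replace hN := hN.mono (le_max_left N N') le_rfl
      replace hN' := hN'.mono (le_max_right N N') le_rfl
      obtain ⟨g, hgd, hgz⟩ := exists_approx n (max N N') (-2)
      refine Subtype.ext (LinearMap.ext fun v => ?_)
      change coindFun n a (f + f') v = coindFun n a f v + coindFun n a f' v
      rw [coindFun_apply (hN.add_fun hN') le_rfl hgd hgz, coindFun_apply hN le_rfl hgd hgz,
        coindFun_apply hN' le_rfl hgd hgz, ← neg_add]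
      rfl)
    (fun c a f => by
      obtain ⟨N, hN⟩ := f.2 a
      obtain ⟨g, hgd, hgz⟩ := exists_approx n N (-2)
      refine Subtype.ext (LinearMap.ext fun v => ?_)
      change coindFun n a (c • f) v = c • coindFun n a f v
      rw [coindFun_apply (hN.smul_fun c) le_rfl hgd hgz, coindFun_apply hN le_rfl hgd hgz, smul_neg]
      rfl)

theorem coindMode_apply (n : ℤ) (a : V) (f : coind V M) (v : V) :
    (coindMode n a f).1 v = coindFun n a f v := rfl

theorem coindMode_eq_zero {f : coind V M} {a : V} {N q : ℤ} (hf : Kills f.1 a N q) (hq : -2 ≤ q)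
    {n : ℤ} (hn : N ≤ n) : coindMode n a f = 0 := by
  refine Subtype.ext (LinearMap.ext fun v => ?_)
  rw [coindMode_apply, coindFun_apply hf hq (Submodule.zero_mem _)]
  · simp
  · rw [zero_sub, lz_zpow_eq_mono]
    exact Submodule.neg_mem _ (mono_mem_zAdic _ hn)

theorem lowerTruncated_coindMode :
    LowerTruncated (coindMode : ℤ → V →ₗ[ℂ] coind V M →ₗ[ℂ] coind V M) := by
  intro a f
  obtain ⟨N, hN⟩ := f.2 a
  exact ⟨N, fun n hn => coindMode_eq_zero hN le_rfl hn⟩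

theorem hasDerivProperty_coindMode :
    HasDerivProperty (coindMode : ℤ → V →ₗ[ℂ] coind V M →ₗ[ℂ] coind V M) := by
  intro a n f
  obtain ⟨N, hN⟩ := f.2 a
  obtain ⟨N', hN'⟩ := f.2 (mode (-2) a vac)
  obtain ⟨g, hgd, hgz⟩ := exists_approx n (max (N + 1) N') (-2)
  refine Subtype.ext (LinearMap.ext fun v => ?_)
  have h1 : dd 1 g - ((n : ℤ) : ℂ) • lz ^ (n - 1) ∈ zAdic N := by
    have := dd_mem_zAdic 1 hgz
    rw [map_sub, dd_lz_zpow, Ring.choose_one_right, Nat.cast_one] at this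
    exact zAdic_anti (by have := le_max_left (N + 1) N'; omega) this
  have h2 := apply_smear_eq hN le_rfl (degLE_mono (by omega) (dd_mem_degLE 1 hgd)) h1 v
  rw [coindMode_apply, coindFun_apply hN' le_rfl hgd (zAdic_anti (le_max_right _ _) hgz),
    smear_deriv, map_neg, neg_neg, h2, Int.cast_smul_eq_zsmul, ← neg_smul]
  rfl

/-- A discrete form of Green's formula on the rectangle `I × J`, with vanishing contributions of two
of the four sides. -/
theorem sum_eq_neg_sum_of_telescope {p q : ℕ → ℕ → M} {I J : ℕ}
    (h : ∀ i j, p i j - p i (j + 1) = q (i + 1) j - q i j) (hp : ∀ i, p i J = 0)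
    (hq : ∀ j < J, q I j = 0) :
    ∑ j ∈ Finset.range J, q 0 j = -∑ i ∈ Finset.range I, p i 0 := by
  have h1 : ∑ i ∈ Finset.range I, ∑ j ∈ Finset.range J, (p i j - p i (j + 1))
      = ∑ i ∈ Finset.range I, p i 0 :=
    Finset.sum_congr rfl fun i _ => by rw [Finset.sum_range_sub', hp, sub_zero]
  have h2 : ∑ j ∈ Finset.range J, ∑ i ∈ Finset.range I, (q (i + 1) j - q i j)
      = -∑ j ∈ Finset.range J, q 0 j := by
    rw [← Finset.sum_neg_distrib]
    refine Finset.sum_congr rfl fun j hj => ?_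
    rw [Finset.sum_range_sub (fun i => q i j), hq j (Finset.mem_range.1 hj), zero_sub]
  rw [← h1, ← neg_eq_iff_eq_neg, ← h2, Finset.sum_comm]
  simp only [h]

/-- The expansions of `1 / (x₁ - x₂) = 1 / (z₁ - z₂)` in powers of `x₁ / x₂` and in powers of
`z₂ / z₁` have the same effect on `f(b[h(x₂)] a[g(x₁)] v)`. -/
theorem sum_apply_smear_smear {f : V →ₗ[ℂ] M} {a b v : V} {g h : LaurentSeries ℂ} {J : ℕ}
    (hJ : ∀ (i : ℕ) (w : V), f (smear (h * mono J (-i - 1)) b w) = 0) :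
    ∃ I₀ : ℕ, ∀ I, I₀ ≤ I →
      ∑ j ∈ Finset.range J, f (smear (h * lz ^ (j : ℤ)) b (smear (g * lz ^ (-1 - j : ℤ)) a v))
        = -∑ i ∈ Finset.range I,
            f (smear (h * lx ^ (-1 - i : ℤ)) b (smear (g * lx ^ (i : ℤ)) a v)) := by
  choose F hF using fun j : ℕ => exists_smear_mul_lx_eq_zero (g * lz ^ (-1 - j : ℤ)) a v
  obtain ⟨I₀, hI₀⟩ := ((Finset.range J).image F).exists_le
  refine ⟨I₀, fun I hI => ?_⟩
  -- `x₁ / x₂` and `z₂ / z₁` are the steps in `i` and `j`; since `z = 1 + x`, the difference in `i` of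
  -- one family of terms is the difference in `j` of the other.
  have key := sum_eq_neg_sum_of_telescope (I := I) (J := J)
    (p := fun i j => f (smear (h * mono j (-i - 1)) b (smear (g * mono (-j) i) a v)))
    (q := fun i j => f (smear (h * mono j (-i)) b (smear (g * mono (-1 - j) i) a v)))
    (fun i j => ?_) (fun i => hJ i _) (fun j hj => ?_)
  · simp only [Nat.cast_zero, neg_zero, ← lz_zpow_eq_mono, ← lx_zpow_eq_mono] at key
    rw [key]
    refine congrArg _ (Finset.sum_congr rfl fun i _ => ?_)
    rw [show -(i : ℤ) - 1 = -1 - i by ring]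
  · push_cast
    have e1 : mono (-(j : ℤ)) i = mono (-1 - j) i + mono (-1 - j) (i + 1) := by
      rw [← mono_add_one]; congr 1; ring
    have e2 : mono ((j : ℤ) + 1) (-i - 1) = mono j (-i - 1) + mono j (-i) := by
      rw [mono_add_one]; congr 2; ring
    rw [e1, e2, show -((j : ℤ) + 1) = -1 - j by ring, show -((i : ℤ) + 1) = -i - 1 by ring]
    simp only [mul_add, map_add, LinearMap.add_apply]
    abel
  · have hjI := hI₀ _ (Finset.mem_image_of_mem F (Finset.mem_range.2 hj))
    have := hF j I (by exact_mod_cast hjI.trans hI)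
    rw [mul_assoc] at this
    change f (smear _ b (smear (g * (lz ^ (-1 - j : ℤ) * lx ^ (I : ℤ))) a v)) = 0
    rw [this, map_zero, map_zero]

theorem mul_lz_zpow_approx {g : LaurentSeries ℂ} {m N : ℤ} (hg : g - lz ^ m ∈ zAdic N) (j : ℤ) :
    g * lz ^ j - lz ^ (m + j) ∈ zAdic (N + j) := by
  rw [zpow_add₀ lz_ne_zero, ← sub_mul, lz_zpow_eq_mono j]
  exact mul_mem_zAdic le_rfl hg (mono_mem_zAdic _ le_rfl)

theorem mul_lz_zpow_mem_degLE {g : LaurentSeries ℂ} {q : ℤ} (hg : g ∈ degLE q) (j : ℤ) :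
    g * lz ^ j ∈ degLE (q + j) := by
  rw [lz_zpow_eq_mono j]
  exact mul_mem_degLE le_rfl hg (mono_mem_degLE (by simp))

/-- Products of two modes with indices `m - 1 - j` and `n + j` on the coinduced module, for all
`j < J`, computed from the same pair of approximations `g` of `z^m` and `h` of `z^n`. -/
theorem coindMode_coindMode_apply {f : coind V M} {a b : V} {m n N N' N'' : ℤ} {j J : ℕ}
    (hj : j < J) (hb : Kills f.1 b N' (-2)) (ha : Kills (coindMode (n + j) b f).1 a N'' (-2))
    {g h : LaurentSeries ℂ} (hgd : g ∈ degLE (-2 - J)) (hgz : g - lz ^ m ∈ zAdic N)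
    (hhd : h ∈ degLE (-2 - J)) (hhz : h - lz ^ n ∈ zAdic N) (hN' : N' ≤ N) (hN'' : N'' + J ≤ N)
    (v : V) :
    (coindMode (m + -1 - j) a (coindMode (n + j) b f)).1 v
      = f.1 (smear (h * lz ^ (j : ℤ)) b (smear (g * lz ^ (-1 - j : ℤ)) a v)) := by
  have h1 := mul_lz_zpow_approx hgz (-1 - j)
  rw [show m + (-1 - (j : ℤ)) = m + -1 - j by ring] at h1
  rw [coindMode_apply, coindFun_apply ha le_rfl (degLE_mono (by omega) (mul_lz_zpow_mem_degLE hgd _))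
      (zAdic_anti (by omega) h1), coindMode_apply,
    coindFun_apply hb le_rfl (degLE_mono (by omega) (mul_lz_zpow_mem_degLE hhd _))
      (zAdic_anti (by omega) (mul_lz_zpow_approx hhz _)), neg_neg]

/-- Borcherds' identity with first index `-1` on the coinduced module, from the identity for test
functions on `V`. -/
theorem bor_neg_one_coindMode (a b : V) (f : coind V M) (m n : ℤ) :
    Bor coindMode a b f (-1) m n := by
  obtain ⟨Na, hNa⟩ := f.2 a
  obtain ⟨Nb, hNb⟩ := f.2 b
  obtain ⟨S, hS⟩ := exists_mode_eq_zero a b (-1)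
  choose Ns hNs using fun s : ℕ => f.2 (mode (-1 + s) a b)
  choose Nab hNab using fun j : ℕ => (coindMode (n + j) b f).2 a
  choose Nba hNba using fun j : ℕ => (coindMode (m + j) a f).2 b
  obtain ⟨J, hJa, hJb⟩ : ∃ J : ℕ, Na ≤ m + J ∧ Nb ≤ n + J :=
    ⟨(Na - m).toNat + (Nb - n).toNat, by omega, by omega⟩
  obtain ⟨Us, hUs⟩ := ((Finset.range S).image fun s : ℕ => Ns s + s).exists_le
  obtain ⟨Uab, hUab⟩ := ((Finset.range J).image Nab).exists_le
  obtain ⟨Uba, hUba⟩ := ((Finset.range J).image Nba).exists_le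
  obtain ⟨N, hN⟩ :=
    ({m, n, Na, Nb, Us - m, Us - n, Uab + J, Uba + J} : Finset ℤ).exists_le
  simp only [Finset.mem_insert, Finset.mem_singleton, forall_eq_or_imp, forall_eq] at hN
  obtain ⟨hm, hn, ha, hb, hsm, hsn, hab, hba⟩ := hN
  -- One pair of approximations serves all terms: multiplication by `zʲ` with `j < J` keeps the degree
  -- at most `-2`, and `N` exceeds all orders that occur.
  obtain ⟨g, hgd, hgz⟩ := exists_approx m N (-2 - J)
  obtain ⟨h, hhd, hhz⟩ := exists_approx n N (-2 - J)
  have hgm := mem_zAdic_of_approx hgz hm le_rfl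
  have hhn := mem_zAdic_of_approx hhz hn le_rfl
  refine Subtype.ext (LinearMap.ext fun v => ?_)
  have hL : (borL coindMode a b f (-1) m n).1 v
      = -∑ s ∈ Finset.range S, f.1 (smear (dd s g * h) (mode (-1 + s) a b) v) := by
    rw [borL_eq_sum hS, AddSubmonoidClass.coe_finsetSum, LinearMap.sum_apply,
      ← Finset.sum_neg_distrib]
    refine Finset.sum_congr rfl fun s hs => ?_
    have hs' := hUs _ (Finset.mem_image_of_mem _ hs)
    rw [apply_smear_eq (n := m + n - s) (c := ((Ring.choose m s : ℤ) : ℂ)) (hNs s) le_rfl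
      (mul_mem_degLE (by omega) (dd_mem_degLE s hgd) hhd) ?_, neg_neg, Int.cast_smul_eq_zsmul]
    · rfl
    · have e : dd s g * h - ((Ring.choose m s : ℤ) : ℂ) • lz ^ (m + n - s)
          = dd s (g - lz ^ m) * h + ((Ring.choose m s : ℤ) : ℂ) • (lz ^ (m - s) * (h - lz ^ n)) := by
        rw [map_sub, dd_lz_zpow, mul_sub, ← zpow_add₀ lz_ne_zero, smul_sub, sub_mul, smul_mul_assoc,
          show m - (s : ℤ) + n = m + n - s by ring]
        ring
      rw [e, lz_zpow_eq_mono (m - s)]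
      exact Submodule.add_mem _ (mul_mem_zAdic (by omega) (dd_mem_zAdic s hgz) hhn)
        (Submodule.smul_mem _ _ (mul_mem_zAdic (by omega) (mono_mem_zAdic _ le_rfl) hhz))
  have hR : (borR coindMode a b f (-1) m n).1 v
      = ∑ j ∈ Finset.range J, f.1 (smear (h * lz ^ (j : ℤ)) b (smear (g * lz ^ (-1 - j : ℤ)) a v))
        + ∑ j ∈ Finset.range J,
            f.1 (smear (g * lz ^ (j : ℤ)) a (smear (h * lz ^ (-1 - j : ℤ)) b v)) := by
    rw [borR, finsum_eq_sum_range (N := J), AddSubmonoidClass.coe_finsetSum, LinearMap.sum_apply,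
      ← Finset.sum_add_distrib]
    · refine Finset.sum_congr rfl fun j hj => ?_
      have hj' := Finset.mem_range.1 hj
      have h1 := hUab _ (Finset.mem_image_of_mem _ hj)
      have h2 := hUba _ (Finset.mem_image_of_mem _ hj)
      rw [← coindMode_coindMode_apply hj' hNb (hNab j) hgd hgz hhd hhz hb (by omega),
        ← coindMode_coindMode_apply hj' hNa (hNba j) hhd hhz hgd hgz ha (by omega),
        choose_neg_one, ← mul_pow]
      simp
    · intro i hi
      rw [coindMode_eq_zero hNb le_rfl (by omega), coindMode_eq_zero hNa le_rfl (by omega)]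
      simp
  -- Replacing the expansions in `z` by those in `x` gives the product side for test functions on `V`.
  obtain ⟨I₁, hI₁⟩ := sum_apply_smear_smear (f := f.1) (a := a) (b := b) (v := v) (g := g) (h := h)
    (J := J) fun i w => hNb _ (mul_mem_zAdic hJb hhn (mono_mem_zAdic _ le_rfl))
      (mul_mem_degLE (q' := J + (-i - 1)) (by omega) hhd (mono_mem_degLE le_rfl)) w
  obtain ⟨I₂, hI₂⟩ := sum_apply_smear_smear (f := f.1) (a := b) (b := a) (v := v) (g := h) (h := g)
    (J := J) fun i w => hNa _ (mul_mem_zAdic hJa hgm (mono_mem_zAdic _ le_rfl))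
      (mul_mem_degLE (q' := J + (-i - 1)) (by omega) hgd (mono_mem_degLE le_rfl)) w
  obtain ⟨I₃, hI₃⟩ := exists_smearTerm_eq_zero a b v (-1) g h
  have hJac := smear_jacobi hS v g h
  rw [finsum_eq_sum_range (N := I₁ + I₂ + I₃) fun i hi => hI₃ i (by omega)] at hJac
  rw [hL, hR, hI₁ (I₁ + I₂ + I₃) (by omega), hI₂ (I₁ + I₂ + I₃) (by omega), ← map_sum, ← hJac]
  simp only [smearTerm_neg_one, map_sum, map_add, Finset.sum_add_distrib]
  abel

theorem bor_coindMode (a b : V) (f : coind V M) (l m n : ℤ) : Bor coindMode a b f l m n :=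
  bor_of_neg_one lowerTruncated_coindMode hasDerivProperty_coindMode
    (fun a b => bor_neg_one_coindMode a b f) a b l m n

end Coinduced

/-! ### The top level of the coinduced module -/

section Zhu

variable {V : Type u} [AddCommGroup V] [Module ℂ V]

/-- The case of `smear_mono` without terms on the right side. A negative power of `z` is removed by
descending induction on `n`, since `zⁱ xⁿ` has high order for large `n`. -/
theorem smear_mono_eq_zero [VertexAlgebra V] {a v : V} {N : ℤ} (hN : ∀ n ≥ N, mode n a v = 0)
    (i : ℤ) {n : ℤ} (hn : N ≤ n) : smear (mono i n) a v = 0 := by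
  induction i using Int.induction_on generalizing n with
  | zero => rw [← lx_zpow_eq_mono, smear_lx_zpow, hN n hn]
  | succ i ih => rw [mono_add_one, map_add, LinearMap.add_apply, LinearMap.add_apply, ih hn,
      ih (by omega), add_zero]
  | pred i ih =>
    have step : ∀ n, N ≤ n → smear (mono (-i - 1) n) a v = -smear (mono (-i - 1) (n + 1)) a v :=
      fun n hn => by
        have := ih hn
        rw [← sub_add_cancel (-(i : ℤ)) 1, mono_add_one, map_add, LinearMap.add_apply,
          LinearMap.add_apply] at this
        exact eq_neg_of_add_eq_zero_left this
    obtain ⟨I, hI⟩ := exists_smear_mul_lx_eq_zero (lz ^ (-(i : ℤ) - 1)) a v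
    have key : ∀ (d : ℕ) (n : ℤ), N ≤ n → I ≤ n + d → smear (mono (-i - 1) n) a v = 0 := by
      intro d
      induction d with
      | zero => exact fun n _ h => hI n (by simpa using h)
      | succ d ihd =>
        intro n hn h
        rw [step n hn, ihd (n + 1) (by omega) (by push_cast at h; omega), neg_zero]
    exact key (I - n).toNat n hn (by omega)

/-- The binomial expansion of `zⁱ = (1 + x)ⁱ` in `Res_x zⁱ xⁿ Y(a, x) v`. -/
theorem smear_mono [VertexAlgebra V] {a v : V} {N : ℤ} (hN : ∀ n ≥ N, mode n a v = 0) (i : ℤ)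
    {n : ℤ} {R : ℕ} (hR : N ≤ n + R) :
    smear (mono i n) a v = ∑ s ∈ Finset.range R, (Ring.choose i s : ℤ) • mode (n + s) a v := by
  induction R generalizing i n with
  | zero => rw [smear_mono_eq_zero hN i (by simpa using hR), Finset.range_zero, Finset.sum_empty]
  | succ R ihR =>
    have h1 : ∀ i : ℤ, smear (mono i (n + 1)) a v
        = ∑ s ∈ Finset.range R, (Ring.choose i s : ℤ) • mode (n + (s + 1 : ℕ)) a v := fun i => by
      rw [ihR i (n := n + 1) (by push_cast at hR; omega)]
      refine Finset.sum_congr rfl fun s _ => ?_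
      rw [show n + 1 + (s : ℤ) = n + (s + 1 : ℕ) by push_cast; ring]
    have h2 : ∀ i : ℤ, smear (mono (i + 1) n) a v
        = smear (mono i n) a v + smear (mono i (n + 1)) a v := fun i => by rw [mono_add_one, map_add, LinearMap.add_apply, LinearMap.add_apply]
    have h3 := fun i => sum_choose_add_one i (fun s : ℕ => mode (n + s) a v) R
    induction i using Int.induction_on with
    | zero =>
      rw [← lx_zpow_eq_mono, smear_lx_zpow, Finset.sum_range_succ']
      simp
    | succ i ih => rw [h2, h3, ih, h1]
    | pred i ih =>
      have e2 := h2 (-i - 1)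
      have e3 := h3 (-i - 1)
      rw [sub_add_cancel] at e2 e3
      rw [ih, e3, h1] at e2
      exact (add_right_cancel e2).symm

variable [NGradedVertexAlgebra V]

theorem zhuRes_eq_smear {k : ℤ} {a : V} (ha : a ∈ gr (V := V) k) (n : ℤ) (v : V) :
    zhuRes n a v = smear (mono k n) a v := by
  rcases lt_or_ge k 0 with hk | hk
  · rw [eq_zero_of_mem_gr_neg ha hk]; simp
  obtain ⟨t, rfl⟩ := Int.eq_ofNat_of_zero_le hk
  obtain ⟨N, hN⟩ := VertexAlgebra.truncation a v
  rw [zhuRes, byWeight_of_mem _ ha, smear_mono hN t (R := (N - n).toNat + (t + 1)) (by omega),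
    LinearMap.sum_apply, LinearMap.sum_apply, Int.toNat_natCast]
  have h : ∀ s : ℕ, (Ring.choose (t : ℤ) s : ℤ) • mode (n + s) a v
      = (t.choose s) • mode (n + s) a v := fun s => by
    have e : Ring.choose (t : ℤ) s = (t.choose s : ℤ) := Ring.choose_natCast _ _
    rw [e, natCast_zsmul]
  simp only [h, LinearMap.smul_apply]
  refine Finset.sum_subset (Finset.range_subset_range.2 (by omega)) fun s _ hs => ?_
  rw [Nat.choose_eq_zero_of_lt (by simpa using hs), zero_smul]

/-- `a[g] v ∈ O(V)` for `a` of weight `k` and any test function `g` of order at least `k` at `z = 0`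
and of degree at most `k - 2` at infinity. -/
theorem smear_mem_zhuO {k : ℤ} {a : V} (ha : a ∈ gr (V := V) k) {g : LaurentSeries ℂ}
    (hg : g ∈ zAdicLE k (k - 2)) (v : V) : smear g a v ∈ zhuO V := by
  have key : ∀ (t : ℕ) (j : ℤ), t + j ≤ -2 → smear (mono (k + t) j) a v ∈ zhuO V := by
    intro t
    induction t with
    | zero =>
      intro j hj
      refine Submodule.subset_span ⟨a, v, j, by simpa using hj, ?_⟩
      rw [zhuRes_eq_smear ha, Nat.cast_zero, add_zero]
    | succ t ih =>
      intro j hj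
      push_cast at hj ⊢
      rw [← add_assoc, mono_add_one, map_add, LinearMap.add_apply, LinearMap.add_apply]
      exact Submodule.add_mem _ (ih _ (by omega)) (ih _ (by omega))
  suffices H : zAdicLE k (k - 2) ≤ (zhuO V).comap ((smear.flip a).flip v) from H hg
  refine monoSpan_le fun i j hp => ?_
  have hi : k ≤ i := hp.1
  have hij : i + j ≤ k - 2 := hp.2
  have := key (i - k).toNat j (by omega)
  rwa [show k + ((i - k).toNat : ℤ) = i by omega] at this

theorem sum_choose_mul_choose (r s : ℤ) (t : ℕ) :
    ∑ i ∈ Finset.range (t + 1), (Ring.choose r i : ℤ) * Ring.choose s (t - i)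
      = Ring.choose (r + s) t := by
  rw [Ring.add_choose_eq t (Commute.all _ _), Finset.Nat.sum_antidiagonal_eq_sum_range_succ_mk]

/-- Modulo `O(V)`, the divided powers of the derivation act on an element of weight `w` as
`(-w choose s)`. -/
theorem divided_deriv_sub_mem_zhuO {w : ℤ} {u : V} (hu : u ∈ gr (V := V) w) (s : ℕ) :
    mode (-1 - s) u vac - (Ring.choose (-w) s : ℤ) • u ∈ zhuO V := by
  induction s using Nat.strong_induction_on with
  | _ s ih =>
    cases s with
    | zero => simp [creation]
    | succ s =>
      -- `Res_x x^(-2-s) Y((1+x)^w u, x) 𝟏` lies in `O(V)` and expresses `D⁽ˢ⁺¹⁾u` by lower powers.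
      have h1 := smear_mem_zhuO hu (g := mono w (-2 - s))
        (mono_mem ⟨le_rfl, by simp only; omega⟩) vac
      rw [smear_mono (fun n hn => creation_nonneg u n hn) w (R := s + 1 + 1) (by push_cast; omega)]
        at h1
      have h2 := sum_choose_mul_choose w (-w) (s + 1)
      rw [add_neg_cancel, Ring.choose_zero_succ] at h2
      have h3 : ∑ t ∈ Finset.range (s + 1 + 1), (Ring.choose w t : ℤ) •
          (mode (-1 - (s + 1 - t : ℕ)) u vac - (Ring.choose (-w) (s + 1 - t) : ℤ) • u) ∈ zhuO V := by
        simp only [smul_sub, Finset.sum_sub_distrib, smul_smul, ← Finset.sum_smul]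
        rw [h2, zero_smul, sub_zero]
        convert h1 using 1
        refine Finset.sum_congr rfl fun t ht => ?_
        have := Finset.mem_range.1 ht
        rw [show -1 - ((s + 1 - t : ℕ) : ℤ) = -2 - s + t by omega]
      rw [Finset.sum_range_succ', Ring.choose_zero_right, one_smul, Nat.sub_zero] at h3
      refine (Submodule.add_mem_iff_right _ (Submodule.sum_mem _ fun t _ => ?_)).1 h3
      exact zsmul_mem (ih _ (by omega)) _

/-- Zhu's formula for the product with the factors exchanged:
`v * a ≡ Res_x x⁻¹ Y((1+x)^(L(0)-1) a, x) v` modulo `O(V)`. -/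
theorem zhuMul_sub_smear_mem_zhuO {k : ℤ} {a : V} (ha : a ∈ gr (V := V) k) (v : V) :
    zhuMul v a - smear (mono (k - 1) (-1)) a v ∈ zhuO V := by
  refine homogeneous_induction
    (p := fun v => zhuMul v a - smear (mono (k - 1) (-1)) a v ∈ zhuO V) (by simp [zhuMul])
    (fun v v' hv hv' => ?_) (fun p v hv => ?_) v
  · have := Submodule.add_mem _ hv hv'
    rw [zhuMul, map_add, LinearMap.add_apply, map_add, add_sub_add_comm]
    exact this
  obtain ⟨N, hN⟩ := VertexAlgebra.truncation a v
  obtain ⟨N', hN'⟩ := VertexAlgebra.truncation v a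
  obtain ⟨R, hR, hR'⟩ : ∃ R : ℕ, N ≤ -1 + R ∧ N' ≤ -1 + R :=
    ⟨(N + 1).toNat + (N' + 1).toNat, by omega, by omega⟩
  rw [zhuMul, zhuRes_eq_smear hv, smear_mono hN' p hR', smear_mono hN (k - 1) hR]
  -- Skew symmetry writes `v_{j-1} a` by divided powers of the derivation applied to elements
  -- `a_{t-1} v`; modulo `O(V)` these are binomial multiples, which add up by Chu–Vandermonde.
  have hsk : ∀ j : ℕ, mode (-1 + j) v a = ∑ s ∈ Finset.range R,
      ((-1 : ℤ) ^ (j + s)) • mode (-1 - s) (mode (-1 + (j + s : ℕ)) a v) vac := fun j => by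
    rw [skew_symmetry (N := R) fun i hi => hN _ (by omega), Finset.smul_sum,
      ← Finset.sum_neg_distrib]
    refine Finset.sum_congr rfl fun s _ => ?_
    rw [smul_smul, ← neg_smul, show -1 + (j : ℤ) + s = -1 + (j + s : ℕ) by push_cast; ring,
      add_comm (-1 : ℤ) j, ← sub_eq_add_neg, Int.negOnePow_sub, Int.negOnePow_one, pow_add]
    simp [Int.negOnePow_def]
  have hu : ∀ t : ℕ, mode (-1 + t) a v ∈ gr (V := V) (k + p - t) := fun t => by
    have := mode_mem k p (-1 + t) a v ha hv
    rwa [show k + p - (-1 + (t : ℤ)) - 1 = k + p - t by ring] at this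
  have h1 : ∑ t ∈ Finset.range R, (Ring.choose (k - 1) t : ℤ) • mode (-1 + t) a v
      = ∑ j ∈ Finset.range R, ∑ s ∈ Finset.range R, ((Ring.choose p j : ℤ) * (-1) ^ (j + s)
          * Ring.choose (-(k + p - (j + s : ℕ))) s) • mode (-1 + (j + s : ℕ)) a v := by
    rw [sum_range_sum_range_eq_sum_antidiagonal (fun j s => ((Ring.choose p j : ℤ) * (-1) ^ (j + s)
          * Ring.choose (-(k + p - (j + s : ℕ))) s) • mode (-1 + (j + s : ℕ)) a v)
      (fun j s hjs => by rw [hN _ (by omega), smul_zero]) le_rfl le_rfl]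
    refine Finset.sum_congr rfl fun t _ => ?_
    rw [Finset.sum_congr rfl (g := fun q => ((-1) ^ t * ((Ring.choose p q.1 : ℤ)
      * Ring.choose (t - k - p) q.2)) • mode (-1 + t) a v), ← Finset.sum_smul, ← Finset.mul_sum,
      ← Ring.add_choose_eq t (Commute.all _ _), intChoose_neg (k - 1) t]
    · congr 3
      ring
    · intro q hq
      rw [Finset.HasAntidiagonal.mem_antidiagonal.1 hq,
        show -(k + p - (t : ℤ)) = t - k - p by ring]
      congr 1
      ring
  rw [h1, ← Finset.sum_sub_distrib]
  refine Submodule.sum_mem _ fun j _ => ?_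
  rw [hsk, Finset.smul_sum, ← Finset.sum_sub_distrib]
  refine Submodule.sum_mem _ fun s _ => ?_
  rw [smul_smul, mul_smul _ (Ring.choose _ s : ℤ), ← smul_sub]
  exact zsmul_mem (divided_deriv_sub_mem_zhuO (hu _) s) _

end Zhu

section TopLevel

variable {V : Type u} [AddCommGroup V] [Module ℂ V] [NGradedVertexAlgebra V]
variable (M : ZhuMod.{u, v} V)

/-- The functional `v ↦ ρ(v + O(V)) y`. -/
def zhuFun (y : M) : V →ₗ[ℂ] M := LinearMap.applyₗ y ∘ₗ M.ρ ∘ₗ zhuMk V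

variable {M}

theorem zhuFun_apply (y : M) (v : V) : zhuFun M y v = M.ρ (zhuMk V v) y := rfl

theorem zhuFun_eq_of_sub_mem (y : M) {u v : V} (h : u - v ∈ zhuO V) :
    zhuFun M y u = zhuFun M y v := by
  have e : zhuMk V u = zhuMk V v := (Submodule.Quotient.eq (zhuO V)).2 h
  rw [zhuFun_apply, zhuFun_apply, e]

theorem kills_zhuFun (y : M) {k : ℤ} {a : V} (ha : a ∈ gr (V := V) k) :
    Kills (zhuFun M y) a k (k - 2) := fun g hg hg' v => by
  rw [zhuFun_eq_of_sub_mem y (v := 0) (by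
    rw [sub_zero]; exact smear_mem_zhuO ha (zAdic_inf_degLE hg hg') v), map_zero]

theorem zhuFun_mem_coind (y : M) : zhuFun M y ∈ coind V M := by
  intro a
  refine homogeneous_induction (p := fun a => ∃ N, Kills (zhuFun M y) a N (-2)) ?_ ?_ ?_ a
  · exact ⟨0, fun g _ _ v => by simp⟩
  · rintro a b ⟨N, hN⟩ ⟨N', hN'⟩
    exact ⟨max N N', (hN.mono (le_max_left _ _) le_rfl).add (hN'.mono (le_max_right _ _) le_rfl)⟩
  · intro k a ha
    rcases lt_or_ge k 0 with hk | hk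
    · exact ⟨0, fun g _ _ v => by simp [eq_zero_of_mem_gr_neg ha hk]⟩
    · exact ⟨k, (kills_zhuFun y ha).mono le_rfl (by omega)⟩

variable (M) in
/-- The map from `M` to the coinduced module that sends `y` to `v ↦ ρ(v + O(V)) y`. -/
def zhuIncl : M →ₗ[ℂ] coind V M where
  toFun y := ⟨zhuFun M y, zhuFun_mem_coind y⟩
  map_add' y y' := Subtype.ext (LinearMap.ext fun v => by
    change zhuFun M (y + y') v = zhuFun M y v + zhuFun M y' v
    simp only [zhuFun_apply, map_add])
  map_smul' c y := Subtype.ext (LinearMap.ext fun v => by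
    change zhuFun M (c • y) v = c • zhuFun M y v
    simp only [zhuFun_apply, map_smul])

theorem zhuIncl_apply (y : M) (v : V) : (zhuIncl M y).1 v = M.ρ (zhuMk V v) y := rfl

/-- `zhuIncl` maps to the top level: `O(V)` gives the vanishing of the modes of negative degree, and
the formula for `v * a` modulo `O(V)` gives the action of the zero modes. -/
theorem isTopMap_zhuIncl : IsTopMap M coindMode (zhuIncl M) where
  neg y k n a ha hn := by
    rcases lt_or_ge k 0 with hk | hk
    · rw [eq_zero_of_mem_gr_neg ha hk]; simp
    · exact coindMode_eq_zero (f := zhuIncl M y) (kills_zhuFun y ha) (by omega) hn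
  zero a y := by
    refine homogeneous_induction (p := fun a => zhuIncl M (M.ρ (zhuMk V a) y)
      = zeroMode coindMode a (zhuIncl M y)) (by simp)
      (fun a b ha hb => by simp only [map_add, LinearMap.add_apply, ha, hb]) (fun k a ha => ?_) a
    rcases lt_or_ge k 0 with hk | hk
    · rw [eq_zero_of_mem_gr_neg ha hk]; simp
    rw [zeroMode, byWeight_of_mem _ ha]
    refine Subtype.ext (LinearMap.ext fun v => ?_)
    -- Near `z = 0`, `z^(k-1) = -z^(k-1) x⁻¹ + z^k x⁻¹`, where the last term does not contribute.
    have hg : -mono (k - 1) (-1) - lz ^ (k - 1) ∈ zAdic k := by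
      have := mono_add_one (k - 1) (-1)
      rw [sub_add_cancel, neg_add_cancel, ← lz_zpow_eq_mono] at this
      rw [show -mono (k - 1) (-1) - lz ^ (k - 1) = -mono k (-1) by rw [this]; ring]
      exact Submodule.neg_mem _ (mono_mem_zAdic _ le_rfl)
    rw [coindMode_apply, coindFun_apply (f := zhuIncl M y) (kills_zhuFun y ha) (by omega)
      (Submodule.neg_mem _ (mono_mem_degLE (by omega))) hg, map_neg, LinearMap.neg_apply,
      LinearMap.neg_apply, map_neg, neg_neg]
    refine Eq.trans ?_ (zhuFun_eq_of_sub_mem y (zhuMul_sub_smear_mem_zhuO ha v))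
    rw [zhuIncl_apply, zhuFun_apply, M.map_mul, Module.End.mul_apply]

/-- The canonical map `M → M̄₀(M)` is injective: the map from `M` to the coinduced module factors
through it, and evaluation at the vacuum is a left inverse. -/
theorem injective_inclMbar (M : ZhuMod.{u, v} V) : Function.Injective (inclMbar M) := by
  obtain ⟨g, hg, -⟩ := exists_lift_Mbar lowerTruncated_coindMode hasDerivProperty_coindMode
    (fun a b f m n => bor_coindMode a b f 0 m n) (isTopMap_zhuIncl (M := M))
    fun k _ a b y _ _ p q => bor_coindMode a b _ p k q
  have hvac : ∀ y, (g (inclMbar M y)).1 vac = y := fun y => by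
    rw [hg, zhuIncl_apply, M.map_one, Module.End.one_apply]
  intro y y' h
  rw [← hvac y, h, hvac]

end TopLevel

/-! ### The universal properties and the comparison -/

section Universal

variable {V : Type u} [AddCommGroup V] [Module ℂ V] [NGradedVertexAlgebra V]

theorem isTopHom_iff {M : ZhuMod.{u, v} V} {W : WeakMod.{u, w} V} {f : M →ₗ[ℂ] W} :
    IsTopHom M W f ↔ IsTopMap M W.Y f :=
  ⟨fun h => ⟨fun y k n a ha hn => h.1 y k n a ha (by omega), h.2⟩,
    fun h => ⟨fun y k n a ha hn => h.neg y k n a ha (by omega), h.zero⟩⟩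

theorem WeakMod.isWeakModule (W : WeakMod.{u, w} V) : IsWeakModule W.Y :=
  ⟨W.isModule.truncation, W.isModule.vacuum, W.isModule.jacobi⟩

theorem Generates.linearMap_ext {X : Type w} {X' : Type*} [AddCommGroup X] [Module ℂ X]
    [AddCommGroup X'] [Module ℂ X'] {M : Type v} [AddCommGroup M] [Module ℂ M]
    {Y : ℤ → V →ₗ[ℂ] X →ₗ[ℂ] X} {Y' : ℤ → V →ₗ[ℂ] X' →ₗ[ℂ] X'} {e : M →ₗ[ℂ] X}
    (hg : Generates Y e) {g h : X →ₗ[ℂ] X'} (hg' : ∀ n a x, g (Y n a x) = Y' n a (g x))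
    (hh : ∀ n a x, h (Y n a x) = Y' n a (h x)) (he : ∀ y, g (e y) = h (e y)) : g = h :=
  LinearMap.eqLocus_eq_top.1 (hg (LinearMap.eqLocus g h) he fun n a x (hx : g x = h x) => by
    change g _ = h _
    rw [hg', hh, hx])

/-- Uniqueness of lifts holds because `M` generates; the description of the part of degree `0` holds
because the grading is by the degree of words. -/
theorem hasUniversalProperty_of_lift {F : ZhuMod.{u, v} V ⥤ WeakMod.{u, max u v} V}
    {e : ∀ M : ZhuMod.{u, v} V, M →ₗ[ℂ] F.obj M}
    (hnat : ∀ (M N : ZhuMod.{u, v} V) (f : M ⟶ N) (y : M),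
      WeakHom.lin (F.map f) (e M y) = e N (ZhuHom.lin f y))
    (htop : ∀ M, IsTopMap M (F.obj M).Y (e M)) (hgen : ∀ M, Generates (F.obj M).Y (e M))
    (hinj : ∀ M, Function.Injective (e M))
    (hgr : ∀ M, (F.obj M).grading = wordDeg (F.obj M).Y (e M))
    (hlift : ∀ (M : ZhuMod.{u, v} V) (W : WeakMod.{u, w} V) (f : M →ₗ[ℂ] W), IsTopMap M W.Y f →
      ∃ g : F.obj M →ₗ[ℂ] W, (∀ y, g (e M y) = f y) ∧
        ∀ n a x, g ((F.obj M).Y n a x) = W.Y n a (g x)) :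
    HasUniversalProperty.{u, v, w} F e where
  natural := hnat
  isTopHom M := isTopHom_iff.2 (htop M)
  injective := hinj
  range M := by rw [hgr, wordDeg_zero (F.obj M).isWeakModule (htop M)]
  existsUnique_lift M W f hf := by
    obtain ⟨g, hge, hg⟩ := hlift M W f (isTopHom_iff.1 hf)
    refine ⟨⟨g, hg⟩, hge, fun g' hg' => WeakHom.ext ?_⟩
    exact (hgen M).linearMap_ext g'.comm hg fun y => by rw [hg', hge]

variable (hS : ∀ M : ZhuMod.{u, v} V, IsNGradableWeakModule (modeS M) (gradS M))
  (hMbar : ∀ M : ZhuMod.{u, v} V, IsNGradableWeakModule (modeMbar M) (gradMbar M))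

theorem exists_hom_S_Mbar (M : ZhuMod.{u, v} V) :
    ∃ g : (functorS hS).obj M ⟶ (functorMbar hMbar).obj M,
      ∀ y, WeakHom.lin g (inclS M y) = inclMbar M y := by
  obtain ⟨g, hge, hg⟩ := exists_lift_S (isWeakModule_modeMbar M) (isTopMap_inclMbar M)
  exact ⟨⟨g, hg⟩, hge⟩

theorem exists_hom_Mbar_S (M : ZhuMod.{u, v} V) :
    ∃ g : (functorMbar hMbar).obj M ⟶ (functorS hS).obj M,
      ∀ y, WeakHom.lin g (inclMbar M y) = inclS M y := by
  obtain ⟨g, hge, hg⟩ := (isWeakModule_modeS M).exists_lift_Mbar (isTopMap_inclS M)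
  exact ⟨⟨g, hg⟩, hge⟩

theorem exists_natIso_S_Mbar :
    ∃ Φ : functorS hS ≅ functorMbar hMbar, ∀ M : ZhuMod.{u, v} V,
      (∀ y : M, WeakHom.lin (Φ.hom.app M) (inclS M y) = inclMbar M y) ∧
      ∀ d : ℤ, (gradS M d).map (WeakHom.lin (Φ.hom.app M)) = gradMbar M d := by
  choose F hF using exists_hom_S_Mbar hS hMbar
  choose G hG using exists_hom_Mbar_S hS hMbar
  have hFG : ∀ M x, WeakHom.lin (F M) (WeakHom.lin (G M) x) = x := fun M x =>
    LinearMap.congr_fun ((generates_Mbar M).linearMap_ext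
      (g := WeakHom.lin (F M) ∘ₗ WeakHom.lin (G M)) (h := LinearMap.id) (Y' := modeMbar M)
      (WeakHom.comm (G M ≫ F M)) (fun _ _ _ => rfl)
      fun y => (congrArg (WeakHom.lin (F M)) (hG M y)).trans (hF M y)) x
  have hGF : ∀ M x, WeakHom.lin (G M) (WeakHom.lin (F M) x) = x := fun M x =>
    LinearMap.congr_fun ((generates_S M).linearMap_ext
      (g := WeakHom.lin (G M) ∘ₗ WeakHom.lin (F M)) (h := LinearMap.id) (Y' := modeS M)
      (WeakHom.comm (F M ≫ G M)) (fun _ _ _ => rfl)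
      fun y => (congrArg (WeakHom.lin (G M)) (hF M y)).trans (hG M y)) x
  refine ⟨NatIso.ofComponents (fun M => ⟨F M, G M, WeakHom.ext (LinearMap.ext (hGF M)),
    WeakHom.ext (LinearMap.ext (hFG M))⟩) fun {M N} f => WeakHom.ext ?_, fun M => ⟨hF M, fun d => ?_⟩⟩
  · refine (generates_S M).linearMap_ext (Y' := modeMbar N)
      (WeakHom.comm ((functorS hS).map f ≫ F N)) (WeakHom.comm (F M ≫ (functorMbar hMbar).map f))
      fun y => ?_
    change WeakHom.lin (F N) (inclS N (ZhuHom.lin f y))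
      = WeakHom.lin ((functorMbar hMbar).map f) (WeakHom.lin (F M) (inclS M y))
    rw [hF, hF]
    rfl
  · apply le_antisymm
    · rintro _ ⟨x, hx, rfl⟩
      exact map_wordDeg (WeakHom.lin (F M)) id (hF M) (WeakHom.comm (F M)) hx
    · intro x hx
      exact ⟨WeakHom.lin (G M) x,
        map_wordDeg (WeakHom.lin (G M)) id (hG M) (WeakHom.comm (G M)) hx, hFG M x⟩

end Universal

end ZhuInduction

end

open ZhuInduction

theorem corollary5p6 (V : Type u) [AddCommGroup V] [Module ℂ V]
    [NGradedVertexAlgebra V] :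
    ∃ (hS : ∀ M : ZhuMod.{u, v} V, IsNGradableWeakModule (modeS M) (gradS M))
      (hMbar : ∀ M : ZhuMod.{u, v} V, IsNGradableWeakModule (modeMbar M) (gradMbar M)),
      HasUniversalProperty.{u, v, w} (functorS hS) inclS ∧
      HasUniversalProperty.{u, v, w} (functorMbar hMbar) inclMbar ∧
      ∃ Φ : functorS hS ≅ functorMbar hMbar, ∀ M : ZhuMod.{u, v} V,
        (∀ y : M, WeakHom.lin (Φ.hom.app M) (inclS M y) = inclMbar M y) ∧
        ∀ d : ℤ, (gradS M d).map (WeakHom.lin (Φ.hom.app M)) = gradMbar M d := by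
  obtain ⟨Φ, hΦ⟩ := exists_natIso_S_Mbar (V := V) isNGradableWeakModule_S.{u, v}
    isNGradableWeakModule_Mbar.{u, v}
  refine ⟨isNGradableWeakModule_S, isNGradableWeakModule_Mbar,
    hasUniversalProperty_of_lift (fun _ _ _ _ => rfl) isTopMap_inclS generates_S (fun M => ?_)
      (fun _ => rfl) (fun M W f hf => exists_lift_S W.isWeakModule hf),
    hasUniversalProperty_of_lift (fun _ _ _ _ => rfl) isTopMap_inclMbar generates_Mbar
      injective_inclMbar (fun _ => rfl) (fun M W f hf => W.isWeakModule.exists_lift_Mbar hf),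
    Φ, hΦ⟩
  intro y y' h
  refine injective_inclMbar M ?_
  exact ((hΦ M).1 y).symm.trans
    ((congrArg (WeakHom.lin (Φ.hom.app M)) h).trans ((hΦ M).1 y'))
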